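/- Let $G=(V,E)$ be a finite simple graph with $V=\{0,\dots,n-1\}$ and $m=|E|$, and let $\mu(G)$ be the maximum size of a matching of $G$ (a set of edges no two of which share an endpoint). A deterministic single-pass streaming algorithm knows $n$ and $m$, receives the edges of $G$ one at a time, each exactly once, and at the end returns a set of edges; it is semi-streaming if its memory (all working memory included) is $\tilde O(n)$ bits, that is, $O(n\log^k n)$ bits for some constant $k$, on every graph and for every order of its edges. For every constant $c$ there is a deterministic single-pass semi-streaming algorithm and a function $\delta(n)=o(1)$ such that, for every $n$ and every graph $G$ on $n$ vertices, the algorithm returns a matching of $G$ for every order of arrival of the edges, and if the edges arrive in a uniformly random order, then with probability at least $1-n^{-c}$ this matching has size at least $\left(\frac{6}{11}-\delta(n)\right)\mu(G)$. -/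

import Mathlib

open Filter Topology Asymptotics

/-! ### Matchings -/

/-- `M` is a matching of `G`: a set of edges of `G`, no two different ones of which share an
endpoint. -/
def IsMatching {V : Type*} (G : SimpleGraph V) (M : Finset (Sym2 V)) : Prop :=
  (∀ e ∈ M, e ∈ G.edgeSet) ∧ ∀ e ∈ M, ∀ f ∈ M, ∀ v, v ∈ e → v ∈ f → e = f

/-- `μ(G)`, the size of a maximum matching of a graph on finitely many vertices. -/
noncomputable def matchingNumber {V : Type*} [Finite V] (G : SimpleGraph V) : ℕ :=
  sSup {k | ∃ M, IsMatching G M ∧ M.card = k}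

/-! ### The machine: while-programs over finitely many arrays of machine words -/

/-- Arithmetic expressions of a program with `a` arrays. Besides its memory, a program can read
the number `numVertices` of vertices, the number `numEdges` of edges, and the two endpoints `fst`
and `snd` of the edge that has just arrived. -/
inductive Expr (a : ℕ) : Type
  | const (c : ℕ)
  | numVertices
  | numEdges
  | fst
  | snd
  | get (k : Fin a) (i : Expr a)
  | add (e f : Expr a)
  | sub (e f : Expr a)
  | mul (e f : Expr a)
  | div (e f : Expr a)
  | mod (e f : Expr a)
  | log2 (e : Expr a)
  | lt (e f : Expr a)
  | eq (e f : Expr a)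

/-- Programs with `a` arrays; `store k i e` writes the value of `e` into cell number `i` of
array `k`. A condition holds if its value is not `0`. -/
inductive Cmd (a : ℕ) : Type
  | skip
  | store (k : Fin a) (i e : Expr a)
  | seq (p q : Cmd a)
  | ite (b : Expr a) (p q : Cmd a)
  | loop (b : Expr a) (p : Cmd a)

/-- The contents of `a` arrays. -/
abbrev Mem (a : ℕ) : Type := Fin a → ℕ → ℕ

/-- The values that a program can read outside its memory. -/
structure Visible : Type where
  numVertices : ℕ
  numEdges : ℕ
  fst : ℕ
  snd : ℕ

/-- The value of an expression (subtraction is truncated, division by zero gives zero). -/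
def Expr.eval {a : ℕ} (x : Visible) (s : Mem a) : Expr a → ℕ
  | .const c => c
  | .numVertices => x.numVertices
  | .numEdges => x.numEdges
  | .fst => x.fst
  | .snd => x.snd
  | .get k i => s k (i.eval x s)
  | .add e f => e.eval x s + f.eval x s
  | .sub e f => e.eval x s - f.eval x s
  | .mul e f => e.eval x s * f.eval x s
  | .div e f => e.eval x s / f.eval x s
  | .mod e f => e.eval x s % f.eval x s
  | .log2 e => Nat.log 2 (e.eval x s)
  | .lt e f => if e.eval x s < f.eval x s then 1 else 0
  | .eq e f => if e.eval x s = f.eval x s then 1 else 0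

/-- `Exec x S w p s t`: started in memory `s`, the program `p` terminates in memory `t`, and on
the way it writes only into the first `S` cells of each array, and only words of `w` bits. -/
inductive Exec {a : ℕ} (x : Visible) (S w : ℕ) : Cmd a → Mem a → Mem a → Prop
  | skip (s : Mem a) : Exec x S w .skip s s
  | store (k : Fin a) (i e : Expr a) (s : Mem a) (hi : i.eval x s < S) (he : e.eval x s < 2 ^ w) :
      Exec x S w (.store k i e) s
        (Function.update s k (Function.update (s k) (i.eval x s) (e.eval x s)))
  | seq (p q : Cmd a) (s t u : Mem a) (hp : Exec x S w p s t) (hq : Exec x S w q t u) :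
      Exec x S w (.seq p q) s u
  | ite_true (b : Expr a) (p q : Cmd a) (s t : Mem a) (hb : b.eval x s ≠ 0)
      (hp : Exec x S w p s t) : Exec x S w (.ite b p q) s t
  | ite_false (b : Expr a) (p q : Cmd a) (s t : Mem a) (hb : b.eval x s = 0)
      (hq : Exec x S w q s t) : Exec x S w (.ite b p q) s t
  | loop_stop (b : Expr a) (p : Cmd a) (s : Mem a) (hb : b.eval x s = 0) :
      Exec x S w (.loop b p) s s
  | loop_step (b : Expr a) (p : Cmd a) (s t u : Mem a) (hb : b.eval x s ≠ 0)
      (hp : Exec x S w p s t) (hl : Exec x S w (.loop b p) t u) : Exec x S w (.loop b p) s u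

/-- Programs are deterministic. -/
theorem Exec.deterministic {a : ℕ} {x : Visible} {S w : ℕ} {p : Cmd a} {s t t' : Mem a}
    (h : Exec x S w p s t) (h' : Exec x S w p s t') : t = t' := by
  induction h generalizing t' with
  | skip s => cases h'; rfl
  | store k i e s hi he => cases h'; rfl
  | seq p q s t u hp hq ihp ihq =>
    cases h' with
    | seq _ _ _ t₁ _ hp' hq' => exact ihq (ihp hp' ▸ hq')
  | ite_true b p q s t hb hp ih =>
    cases h' with
    | ite_true _ _ _ _ _ _ h₁ => exact ih h₁
    | ite_false _ _ _ _ _ h₀ _ => exact absurd h₀ hb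
  | ite_false b p q s t hb hq ih =>
    cases h' with
    | ite_true _ _ _ _ _ h₀ _ => exact absurd hb h₀
    | ite_false _ _ _ _ _ _ h₁ => exact ih h₁
  | loop_stop b p s hb =>
    cases h' with
    | loop_stop => rfl
    | loop_step _ _ _ _ _ h₀ _ _ => exact absurd hb h₀
  | loop_step b p s t u hb hp hl ihp ihl =>
    cases h' with
    | loop_stop _ _ _ h₀ => exact absurd h₀ hb
    | loop_step _ _ _ t₁ _ _ hp' hl' => exact ihl (ihp hp' ▸ hl')

/-! ### Deterministic single-pass streaming algorithms -/

/-- A deterministic single-pass graph streaming algorithm: one program, the same for inputs of all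
sizes. `start` is executed before the stream, `step` once for every arriving edge, and `finish`
after the stream. The output is the list of the pairs in the arrays `outFst` and `outSnd`; the
length of the list is in cell `0` of the array `outLen`. -/
structure StreamAlg : Type where
  numArrays : ℕ
  start : Cmd numArrays
  step : Cmd numArrays
  finish : Cmd numArrays
  outLen : Fin numArrays
  outFst : Fin numArrays
  outSnd : Fin numArrays

namespace StreamAlg

/-- The number of bits of the whole memory, if each array has `S` cells of `w` bits. -/
def memoryBits (A : StreamAlg) (S w : ℕ) : ℕ := A.numArrays * (S * w)

/-- The single pass over the stream `l`, from memory `s` to memory `t`. -/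
def Pass (A : StreamAlg) (S w n m : ℕ) : List (ℕ × ℕ) → Mem A.numArrays → Mem A.numArrays → Prop
  | [], s, t => s = t
  | e :: l, s, t => ∃ s', Exec ⟨n, m, e.1, e.2⟩ S w A.step s s' ∧ A.Pass S w n m l s' t

/-- On a graph with `n` vertices whose edges arrive as the list `l`, the algorithm, started with
empty memory, terminates within `S` cells of `w` bits in each array, with output `out`. -/
def Run (A : StreamAlg) (S w n : ℕ) (l out : List (ℕ × ℕ)) : Prop :=
  ∃ s₁ s₂ s₃ : Mem A.numArrays,
    Exec ⟨n, l.length, 0, 0⟩ S w A.start (fun _ _ => 0) s₁ ∧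
    A.Pass S w n l.length l s₁ s₂ ∧
    Exec ⟨n, l.length, 0, 0⟩ S w A.finish s₂ s₃ ∧
    out = (List.range (s₃ A.outLen 0)).map fun i => (s₃ A.outFst i, s₃ A.outSnd i)

end StreamAlg

/-! ### Random edge arrival -/

/-- The two endpoints of an edge, as numbers, the smaller one first. -/
def endpoints {n : ℕ} (e : Sym2 (Fin n)) : ℕ × ℕ := (e.inf, e.sup)

/-- The orders in which the edges of `G` can arrive. -/
abbrev EdgeOrder {n : ℕ} (G : SimpleGraph (Fin n)) : Type :=
  Fin (Nat.card G.edgeSet) ≃ G.edgeSet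

/-- The stream of edges in the order `σ`. -/
noncomputable def edgeStream {n : ℕ} {G : SimpleGraph (Fin n)} (σ : EdgeOrder G) : List (ℕ × ℕ) :=
  List.ofFn fun i => endpoints (σ i : Sym2 (Fin n))

/-- The probability of the event `P` for a uniformly random order of the edges of `G`. -/
noncomputable def orderProb {n : ℕ} (G : SimpleGraph (Fin n)) (P : EdgeOrder G → Prop) : ℝ :=
  (Nat.card {σ : EdgeOrder G // P σ} : ℝ) / Nat.card (EdgeOrder G)

/-- When the edges of `G` arrive in the order `σ`, the algorithm terminates within `S` cells of
`w` bits in each array, and the set of edges that it returns is `M`. -/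
def StreamAlg.Returns (A : StreamAlg) (S w : ℕ) {n : ℕ} {G : SimpleGraph (Fin n)}
    (σ : EdgeOrder G) (M : Finset (Sym2 (Fin n))) : Prop :=
  ∃ out, A.Run S w n (edgeStream σ) out ∧ out.toFinset = M.image endpoints

/-! ### A total-correctness calculus for programs -/

/-! Call the sum of the degrees of the two ends of an edge its edge degree. The algorithm maintains
a graph `H` of alive edges with edge degrees at most β, stores further edges as well, and outputs a
maximum matching of the graph `W` of all stored edges. Three facts carry the proof.

Structure (`exists_matching_of_bounded_edge_degree`). Take a matching whose edges missing from `W`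
have edge degree at least θ in `H`, with θ close to β. Some bipartition separates the ends of every
matching edge and halves all degrees of `H` up to a small error. By Hall's theorem the crossing part
of `W` has a matching and a vertex cover T of the same size or smaller. The uncovered edges of the
given matching are missing from `W`; their ends have average crossing degree about β/4 in `H`, and
all their crossing neighbours lie in T. Crossing edges have crossing edge degree at most about β/2,
so double counting (`sum_card_le_of_pair_degree`) shows that at most 2|T|/3 edges are uncovered.
Hence `W` has a matching of 3/5 of the given size.

Potential (`potential_le`, `potential_add`). An edge of edge degree below θ is inserted into `H`,
and edges above β are then deleted. Each insertion raises by 2 a potential bounded by nβ², and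
deletions do not lower it, so insertions are few. The first phase ends when a whole period brings no
edge of small edge degree. The period is so short that this phase covers at most a 2⁻²² fraction of
the stream. Afterwards `H` is frozen and every small edge is stored.

Probability. The small edges still to come after s arrivals form a set determined by those arrivals.
If it is large, the following period avoids it with probability at most n^-(c+4)
(`orderCount_avoidsLarge_le`), so the second phase stores few edges. The first phase holds more than
1/11 of a maximum matching with probability at most 2^-μ (`orderCount_prefix_large`), and μ is at
least (c+4) log n unless the graph is so sparse that the period is 0 and everything is stored. Each
of the remaining 10/11 of the matching is stored or has edge degree at least θ, and 3/5 · 10/11 =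
6/11. -/

/-- The memory `s` after writing `v` into cell `i` of array `k`. -/
def Mem.set {a : ℕ} (s : Mem a) (k : Fin a) (i v : ℕ) : Mem a :=
  Function.update s k (Function.update (s k) i v)

theorem Mem.set_apply {a : ℕ} (s : Mem a) (k : Fin a) (i v : ℕ) (k' : Fin a) (j : ℕ) :
    s.set k i v k' j = if k' = k ∧ j = i then v else s k' j := by
  by_cases hk : k' = k
  · subst hk
    by_cases hj : j = i
    · subst hj; simp [Mem.set]
    · simp [Mem.set, hj]
  · simp [Mem.set, hk]

/-- Weakest precondition: from memory `s`, the program terminates in a memory satisfying `Q`. -/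
def WP {a : ℕ} (x : Visible) (S w : ℕ) (p : Cmd a) (Q : Mem a → Prop) (s : Mem a) : Prop :=
  ∃ t, Exec x S w p s t ∧ Q t

section WP

variable {a : ℕ} {x : Visible} {S w : ℕ}

theorem WP.mono {p : Cmd a} {Q Q' : Mem a → Prop} {s : Mem a} (h : WP x S w p Q s)
    (hQ : ∀ t, Q t → Q' t) : WP x S w p Q' s :=
  let ⟨t, ht, hq⟩ := h
  ⟨t, ht, hQ t hq⟩

theorem WP.skip {Q : Mem a → Prop} {s : Mem a} (h : Q s) : WP x S w .skip Q s :=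
  ⟨s, .skip s, h⟩

theorem WP.store {k : Fin a} {i e : Expr a} {Q : Mem a → Prop} {s : Mem a}
    (hi : i.eval x s < S) (he : e.eval x s < 2 ^ w)
    (h : Q (s.set k (i.eval x s) (e.eval x s))) : WP x S w (.store k i e) Q s :=
  ⟨_, .store k i e s hi he, h⟩

theorem WP.seq {p q : Cmd a} {Q : Mem a → Prop} {s : Mem a}
    (h : WP x S w p (WP x S w q Q) s) : WP x S w (.seq p q) Q s :=
  let ⟨t, ht, u, hu, hq⟩ := h
  ⟨u, .seq p q s t u ht hu, hq⟩

theorem WP.ite {b : Expr a} {p q : Cmd a} {Q : Mem a → Prop} {s : Mem a}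
    (h₁ : b.eval x s ≠ 0 → WP x S w p Q s) (h₀ : b.eval x s = 0 → WP x S w q Q s) :
    WP x S w (.ite b p q) Q s := by
  by_cases hb : b.eval x s = 0
  · obtain ⟨t, ht, hq⟩ := h₀ hb
    exact ⟨t, .ite_false b p q s t hb ht, hq⟩
  · obtain ⟨t, ht, hq⟩ := h₁ hb
    exact ⟨t, .ite_true b p q s t hb ht, hq⟩

theorem Exec.loop_of_eq_zero {b : Expr a} {p : Cmd a} {s : Mem a} (hb : b.eval x s = 0) :
    Exec x S w (.loop b p) s s := by
  constructor
  exact hb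

theorem WP.loop {b : Expr a} {p : Cmd a} {Q : Mem a → Prop} (Inv : Mem a → Prop)
    (meas : Mem a → ℕ)
    (hstep : ∀ s, Inv s → b.eval x s ≠ 0 → WP x S w p (fun t => Inv t ∧ meas t < meas s) s)
    (hdone : ∀ s, Inv s → b.eval x s = 0 → Q s) (s : Mem a) (hs : Inv s) :
    WP x S w (.loop b p) Q s := by
  induction hm : meas s using Nat.strong_induction_on generalizing s with
  | _ N ih =>
    by_cases hb : b.eval x s = 0
    · exact ⟨s, .loop_of_eq_zero hb, hdone s hs hb⟩
    · obtain ⟨t, ht, hi, hlt⟩ := hstep s hs hb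
      obtain ⟨u, hu, hq⟩ := ih (meas t) (hm ▸ hlt) t hi rfl
      exact ⟨u, .loop_step b p s t u hb ht hu, hq⟩

/-- The value of the scalar variable kept in cell `0` of array `k`. -/
abbrev Expr.var (k : Fin a) : Expr a := .get k (.const 0)

/-- Assignment to the scalar variable kept in cell `0` of array `k`. -/
abbrev Cmd.assign (k : Fin a) (e : Expr a) : Cmd a := .store k (.const 0) e

theorem Expr.eval_lt_ne_zero {e f : Expr a} {s : Mem a} :
    (Expr.lt e f).eval x s ≠ 0 ↔ e.eval x s < f.eval x s := by
  simp only [Expr.eval]; split_ifs with h <;> simp [h]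

theorem Expr.eval_eq_ne_zero {e f : Expr a} {s : Mem a} :
    (Expr.eq e f).eval x s ≠ 0 ↔ e.eval x s = f.eval x s := by
  simp only [Expr.eval]; split_ifs with h <;> simp [h]

/-- `for i in 0, …, b - 1 do p`. -/
def Cmd.forLoop (i : Fin a) (b : Expr a) (p : Cmd a) : Cmd a :=
  .seq (.assign i (.const 0))
    (.loop (.lt (.var i) b) (.seq p (.assign i (.add (.var i) (.const 1)))))

/-- The invariant is indexed by the counter and asserted after the increment, so the body only has
to leave the counter cell as it found it. The bound may read memory; the invariant must pin its
value to `N`. -/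
theorem WP.forLoop {i : Fin a} {b : Expr a} {p : Cmd a} {Q : Mem a → Prop} {s : Mem a}
    (N : ℕ) (Inv : ℕ → Mem a → Prop) (hS : 0 < S) (hw : N < 2 ^ w)
    (hb : ∀ j t, Inv j t → t i 0 = j → b.eval x t = N)
    (h0 : Inv 0 (s.set i 0 0))
    (hstep : ∀ j t, j < N → Inv j t → t i 0 = j →
      WP x S w p (fun u => u i 0 = j ∧ Inv (j + 1) (u.set i 0 (j + 1))) t)
    (hdone : ∀ t, Inv N t → Q t) : WP x S w (.forLoop i b p) Q s := by
  refine WP.seq (WP.store (by simpa [Expr.eval] using hS) (by simp [Expr.eval]) ?_)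
  simp only [Expr.eval]
  refine WP.loop (fun t => t i 0 ≤ N ∧ Inv (t i 0) t) (fun t => N - t i 0) ?_ ?_ _ ?_
  · rintro t ⟨_, ht⟩ hlt
    have hbt := hb _ _ ht rfl
    have hlt' : t i 0 < N := by
      by_contra hc
      simp [Expr.eval, hbt, hc] at hlt
    refine WP.seq ((hstep _ t hlt' ht rfl).mono ?_)
    rintro u ⟨hu, hi⟩
    refine WP.store (by simpa [Expr.eval] using hS) (by simp only [Expr.eval]; omega) ?_
    simp only [Expr.eval, hu]
    have : (u.set i 0 (t i 0 + 1)) i 0 = t i 0 + 1 := by simp [Mem.set_apply]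
    rw [this]
    exact ⟨⟨by omega, hi⟩, by omega⟩
  · rintro t ⟨hle, ht⟩ hge
    have hbt := hb _ _ ht rfl
    have : t i 0 = N := by
      by_contra hc
      have : t i 0 < N := by omega
      simp [Expr.eval, hbt, this] at hge
    exact hdone t (this ▸ ht)
  · have : (s.set i 0 0) i 0 = 0 := by simp [Mem.set_apply]
    rw [this]
    exact ⟨by omega, h0⟩

end WP

/-! ### Composition and determinism of the pass -/

theorem StreamAlg.Pass.append {A : StreamAlg} {S w n m : ℕ} {l l' : List (ℕ × ℕ)}
    {s t u : Mem A.numArrays} (h : A.Pass S w n m l s t) (h' : A.Pass S w n m l' t u) :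
    A.Pass S w n m (l ++ l') s u := by
  induction l generalizing s with
  | nil => cases h; exact h'
  | cons e l ih =>
    obtain ⟨s', hs', hl⟩ := h
    exact ⟨s', hs', ih hl⟩

theorem StreamAlg.Pass.deterministic {A : StreamAlg} {S w n m : ℕ} {l : List (ℕ × ℕ)}
    {s t t' : Mem A.numArrays} (h : A.Pass S w n m l s t) (h' : A.Pass S w n m l s t') :
    t = t' := by
  induction l generalizing s with
  | nil => cases h; cases h'; rfl
  | cons e l ih =>
    obtain ⟨s₁, h₁, hl⟩ := h
    obtain ⟨s₂, h₂, hl'⟩ := h'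
    cases h₁.deterministic h₂
    exact ih hl hl'

/-! ### Degrees in a list of edges, and the potential function -/

/-- The degree of `v` in the multigraph with edges `(f i, g i)` for `i ∈ X`. -/
def edgeDeg (f g : ℕ → ℕ) (X : Finset ℕ) (v : ℕ) : ℕ :=
  ∑ i ∈ X, ((if f i = v then 1 else 0) + (if g i = v then 1 else 0))

theorem edgeDeg_le (f g : ℕ → ℕ) (X : Finset ℕ) (v : ℕ) : edgeDeg f g X v ≤ 2 * X.card := by
  unfold edgeDeg
  calc _ ≤ ∑ i ∈ X, 2 := Finset.sum_le_sum fun i _ => by split_ifs <;> omega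
    _ = 2 * X.card := by simp [mul_comm]

theorem edgeDeg_insert {f g : ℕ → ℕ} {X : Finset ℕ} {i : ℕ} (hi : i ∉ X) (v : ℕ) :
    edgeDeg f g (insert i X) v =
      edgeDeg f g X v + (if f i = v then 1 else 0) + (if g i = v then 1 else 0) := by
  unfold edgeDeg
  rw [Finset.sum_insert hi]; ring

theorem edgeDeg_erase {f g : ℕ → ℕ} {X : Finset ℕ} {i : ℕ} (hi : i ∈ X) (v : ℕ) :
    edgeDeg f g X v =
      edgeDeg f g (X.erase i) v + (if f i = v then 1 else 0) + (if g i = v then 1 else 0) := by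
  rw [← edgeDeg_insert (Finset.notMem_erase i X), Finset.insert_erase hi]

theorem edgeDeg_congr {f g f' g' : ℕ → ℕ} {X : Finset ℕ} (v : ℕ)
    (hf : ∀ i ∈ X, f i = f' i) (hg : ∀ i ∈ X, g i = g' i) :
    edgeDeg f g X v = edgeDeg f' g' X v :=
  Finset.sum_congr rfl fun i hi => by rw [hf i hi, hg i hi]

/-- The potential of a degree function that bounds the number of insertions into a subgraph of
bounded edge degree. -/
def potential (β n : ℕ) (D : ℕ → ℕ) : ℤ :=
  ∑ v ∈ Finset.range n, ((2 * β - 1) * (D v : ℤ) - 2 * (D v : ℤ) ^ 2)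

/-- Termwise, since β² - (2β-1)d + 2d² = (β-d)² + d² + d. -/
theorem potential_le (β n : ℕ) (D : ℕ → ℕ) : potential β n D ≤ n * β ^ 2 := by
  unfold potential
  calc _ ≤ ∑ v ∈ Finset.range n, (β : ℤ) ^ 2 := Finset.sum_le_sum fun v _ => by
        nlinarith [sq_nonneg ((β : ℤ) - D v), sq_nonneg ((D v : ℤ))]
    _ = n * β ^ 2 := by simp

/-- The change is at least 2 if the edge degree before the insertion is at most β-2, and at most -2
if it is at least β-1. A deleted edge had edge degree at least β+1, hence at least β-1 without
itself; so insertions and deletions both raise the potential. -/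
theorem potential_add {β n u v : ℕ} {D D' : ℕ → ℕ} (hu : u < n) (hv : v < n) (huv : u ≠ v)
    (hD : ∀ x, D' x = D x + (if u = x then 1 else 0) + (if v = x then 1 else 0)) :
    potential β n D' = potential β n D + (4 * β - 6 - 4 * (D u + D v)) := by
  have h : potential β n D' = ∑ x ∈ Finset.range n,
      (((2 * β - 1) * (D x : ℤ) - 2 * (D x : ℤ) ^ 2)
        + (if u = x then (2 * β - 3 - 4 * (D u : ℤ)) else 0)
        + (if v = x then (2 * β - 3 - 4 * (D v : ℤ)) else 0)) := by
    refine Finset.sum_congr rfl fun x _ => ?_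
    rw [hD x]
    by_cases h1 : u = x
    · subst h1
      rw [if_pos rfl, if_neg (Ne.symm huv), if_pos rfl, if_neg (Ne.symm huv)]
      push_cast; ring
    · by_cases h2 : v = x
      · subst h2
        rw [if_neg h1, if_pos rfl, if_neg h1, if_pos rfl]
        push_cast; ring
      · rw [if_neg h1, if_neg h2, if_neg h1, if_neg h2]
        push_cast; ring
  rw [h, Finset.sum_add_distrib, Finset.sum_add_distrib, Finset.sum_ite_eq, Finset.sum_ite_eq,
    if_pos (Finset.mem_range.2 hu), if_pos (Finset.mem_range.2 hv)]
  unfold potential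
  ring

/-! ### The arrays of the algorithm -/

notation "arrFst" => (0 : Fin 17)
notation "arrSnd" => (1 : Fin 17)
notation "arrAlive" => (2 : Fin 17)
notation "arrDeg" => (3 : Fin 17)
notation "varLen" => (4 : Fin 17)
-- Counts consecutive arrivals of large edge degree. Once it reaches the period it never changes
-- again, so it also serves as the flag of the second phase.
notation "varIdle" => (5 : Fin 17)
notation "varI" => (6 : Fin 17)
notation "arrBit" => (7 : Fin 17)
notation "arrBest" => (8 : Fin 17)
notation "varOk" => (9 : Fin 17)
notation "varCount" => (10 : Fin 17)
notation "varMax" => (11 : Fin 17)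
notation "varJ" => (12 : Fin 17)
notation "varCarry" => (13 : Fin 17)
notation "varOut" => (14 : Fin 17)
notation "arrOutFst" => (15 : Fin 17)
notation "arrOutSnd" => (16 : Fin 17)

theorem Mem.set_of_ne {a : ℕ} (s : Mem a) {k k' : Fin a} (i v : ℕ) (h : k' ≠ k) :
    s.set k i v k' = s k' := by
  funext j; simp [Mem.set_apply, h]

/-- The numbers of the stored edges that are alive, that is, belong to the current subgraph of
bounded edge degree. -/
def alive (s : Mem 17) : Finset ℕ := {i ∈ Finset.range (s varLen 0) | s arrAlive i ≠ 0}

/-- The array of degrees holds the degrees of the graph of alive edges. -/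
def DegOk (s : Mem 17) : Prop :=
  ∀ v, s arrDeg v = edgeDeg (s arrFst) (s arrSnd) (alive s) v

/-- Delete edge number `varI` from the alive edges if its edge degree exceeds the bound. -/
def cleanOne (βE : Expr 17) : Cmd 17 :=
  .ite (.get arrAlive (.var varI))
    (.ite (.lt βE (.add (.get arrDeg (.get arrFst (.var varI)))
        (.get arrDeg (.get arrSnd (.var varI)))))
      (.seq (.store arrAlive (.var varI) (.const 0))
        (.seq (.store arrDeg (.get arrFst (.var varI))
            (.sub (.get arrDeg (.get arrFst (.var varI))) (.const 1)))
          (.store arrDeg (.get arrSnd (.var varI))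
            (.sub (.get arrDeg (.get arrSnd (.var varI))) (.const 1)))))
      .skip)
    .skip

/-- Delete alive edges of too large edge degree, in one pass over the stored edges. -/
def clean (βE : Expr 17) : Cmd 17 := .forLoop varI (.var varLen) (cleanOne βE)

/-! ### Correctness of the cleaning pass -/

section Step

variable {x : Visible} {S w n β : ℕ}

/-- The invariant of the cleaning pass that starts in memory `s`. -/
structure CleanInv (n β : ℕ) (s : Mem 17) (j : ℕ) (t : Mem 17) : Prop where
  frame : ∀ k, k ≠ arrAlive → k ≠ arrDeg → k ≠ varI → t k = s k
  deg : DegOk t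
  le : ∀ v, t arrDeg v ≤ s arrDeg v
  pot : potential β n (s arrDeg) ≤ potential β n (t arrDeg)
  bdd : ∀ i < j, i ∈ alive t →
    t arrDeg (t arrFst i) + t arrDeg (t arrSnd i) ≤ β

theorem alive_set_of_ne {s : Mem 17} {k : Fin 17} {i v : ℕ} (h1 : varLen ≠ k) (h2 : arrAlive ≠ k) :
    alive (s.set k i v) = alive s := by
  simp only [alive, Mem.set_of_ne s i v h1, Mem.set_of_ne s i v h2]

theorem CleanInv.set_varI {s t : Mem 17} {j i v : ℕ} (h : CleanInv n β s j t) :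
    CleanInv n β s j (t.set varI i v) := by
  have ha : alive (t.set varI i v) = alive t := alive_set_of_ne (by decide) (by decide)
  have h0 : t.set varI i v arrFst = t arrFst := Mem.set_of_ne t i v (by decide)
  have h1 : t.set varI i v arrSnd = t arrSnd := Mem.set_of_ne t i v (by decide)
  have h3 : t.set varI i v arrDeg = t arrDeg := Mem.set_of_ne t i v (by decide)
  refine ⟨fun k h1 h2 h3 => ?_, ?_, ?_, ?_, ?_⟩
  · rw [Mem.set_of_ne t i v h3]; exact h.frame k h1 h2 h3
  · intro y; rw [ha, h0, h1, h3]; exact h.deg y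
  · rw [h3]; exact h.le
  · rw [h3]; exact h.pot
  · rw [ha, h0, h1, h3]; exact h.bdd

/-- One pass suffices: deletions only lower degrees, so an edge already passed keeps its edge degree
at most β. -/
theorem wp_clean {βE : Expr 17} (hβ : ∀ t, βE.eval x t = β) {s : Mem 17}
    (hw : 2 * s varLen 0 < 2 ^ w) (hlen : s varLen 0 ≤ S) (hn : n ≤ S) (hS : 0 < S)
    (hedge : ∀ i < s varLen 0, s arrFst i < n ∧ s arrSnd i < n ∧ s arrFst i ≠ s arrSnd i)
    (hdeg : DegOk s) :
    WP x S w (clean βE) (CleanInv n β s (s varLen 0)) s := by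
  have hw' : s varLen 0 < 2 ^ w := by omega
  refine WP.forLoop (s varLen 0) (CleanInv n β s) hS hw' ?_ ?_ ?_ (fun t ht => ht)
  · intro j t ht _
    simp only [Expr.eval]
    rw [ht.frame varLen (by decide) (by decide) (by decide)]
  · refine CleanInv.set_varI ⟨fun _ _ _ _ => rfl, hdeg, fun _ => le_rfl, le_rfl, ?_⟩
    intro i hi; omega
  · intro j t hj ht hIj
    have hF := ht.frame arrFst (by decide) (by decide) (by decide)
    have hG := ht.frame arrSnd (by decide) (by decide) (by decide)
    have hL := ht.frame varLen (by decide) (by decide) (by decide)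
    obtain ⟨hFn, hGn, hFG⟩ := hedge j hj
    rw [← hF, ← hG] at hFG
    rw [← hF] at hFn
    rw [← hG] at hGn
    have hmem : j ∈ alive t ↔ t arrAlive j ≠ 0 := by simp [alive, hL, hj]
    refine WP.ite (fun hal => ?_) (fun hal => ?_)
    · simp only [Expr.eval, hIj] at hal
      refine WP.ite (fun hgt => ?_) (fun hgt => ?_)
      · have hgt' : β < t arrDeg (t arrFst j) + t arrDeg (t arrSnd j) := by
          simpa [Expr.eval, hIj, hβ] using hgt
        -- A stored edge contributes at most 2 to a degree, so degrees fit into a word.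
        have hDle : ∀ v, t arrDeg v < 2 ^ w := fun v => by
          rw [ht.deg v]
          refine (edgeDeg_le _ _ _ _).trans_lt (lt_of_le_of_lt ?_ hw)
          rw [← hL]
          have : (alive t).card ≤ t varLen 0 := by
            simpa [alive] using Finset.card_filter_le (Finset.range (t varLen 0))
              (fun i => t arrAlive i ≠ 0)
          omega
        have hpos : ∀ v, t arrDeg v = edgeDeg (t arrFst) (t arrSnd) ((alive t).erase j) v
            + (if t arrFst j = v then 1 else 0) + (if t arrSnd j = v then 1 else 0) := fun v => by
          rw [ht.deg v, edgeDeg_erase (hmem.2 hal)]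
        refine WP.seq (WP.store (by simp only [Expr.eval, hIj]; omega) (by simp [Expr.eval]) ?_)
        refine WP.seq (WP.store ?_ ?_ ?_)
        · simp only [Expr.eval, hIj, Mem.set_apply]; simp; omega
        · simp only [Expr.eval, hIj, Mem.set_apply]; simp
          have := hDle (t arrFst j); omega
        refine WP.store ?_ ?_ ?_
        · simp only [Expr.eval, hIj, Mem.set_apply]; simp; omega
        · simp only [Expr.eval, hIj, Mem.set_apply]; simp [hFG.symm]
          have := hDle (t arrSnd j); omega
        simp only [Expr.eval, hIj, Mem.set_apply]
        simp [hFG.symm]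
        set t' := ((t.set arrAlive j 0).set arrDeg (t arrFst j) (t arrDeg (t arrFst j) - 1)).set
          arrDeg (t arrSnd j) (t arrDeg (t arrSnd j) - 1) with ht'
        have hF' : t' arrFst = t arrFst := by funext i; simp [ht', Mem.set_apply]
        have hG' : t' arrSnd = t arrSnd := by funext i; simp [ht', Mem.set_apply]
        have hA' : alive t' = (alive t).erase j := by
          ext i
          by_cases hi : i = j <;> simp [alive, ht', Mem.set_apply, hi]
        have hD' : ∀ v, t' arrDeg v =
            edgeDeg (t arrFst) (t arrSnd) ((alive t).erase j) v := fun v => by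
          have h := hpos v
          simp only [ht', Mem.set_apply]
          by_cases h1 : v = t arrSnd j
          · subst h1
            rw [if_neg hFG, if_pos rfl] at h
            simp; omega
          · by_cases h2 : v = t arrFst j
            · subst h2
              rw [if_neg (Ne.symm h1), if_pos rfl] at h
              simp [h1]; omega
            · rw [if_neg (Ne.symm h1), if_neg (Ne.symm h2)] at h
              simp [h1, h2]; omega
        have hle : ∀ v, t' arrDeg v ≤ t arrDeg v := fun v => by
          rw [hD' v, hpos v]; omega
        refine CleanInv.set_varI ⟨?_, ?_, ?_, ?_, ?_⟩
        · intro k h1 h2 h3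
          rw [ht', Mem.set_of_ne _ _ _ h2, Mem.set_of_ne _ _ _ h2, Mem.set_of_ne _ _ _ h1]
          exact ht.frame k h1 h2 h3
        · intro v; rw [hA', hF', hG', hD']
        · intro v; exact (hle v).trans (ht.le v)
        · refine ht.pot.trans ?_
          -- The deletion read backwards: `t` arises from `t'` by adding edge `j`, at edge degree at
          -- least β-1.
          have hp := potential_add (β := β) (n := n) (D := t' arrDeg) (D' := t arrDeg) hFn hGn hFG
            (fun v => by rw [hD' v]; exact hpos v)
          have e1 := hpos (t arrFst j)
          have e2 := hpos (t arrSnd j)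
          rw [← hD', if_pos rfl, if_neg hFG.symm] at e1
          rw [← hD', if_neg hFG, if_pos rfl] at e2
          rw [hp]
          omega
        · rw [hF', hG', hA']
          intro i hi hia
          have hij : i ≠ j := Finset.ne_of_mem_erase hia
          have := ht.bdd i (by omega) (Finset.mem_of_mem_erase hia)
          have := hle (t arrFst i)
          have := hle (t arrSnd i)
          omega
      · have hgt' : t arrDeg (t arrFst j) + t arrDeg (t arrSnd j) ≤ β := by
          simpa [Expr.eval, hIj, hβ] using hgt
        refine WP.skip ⟨hIj, CleanInv.set_varI ⟨ht.frame, ht.deg, ht.le, ht.pot, ?_⟩⟩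
        intro i hi hia
        rcases Nat.lt_succ_iff_lt_or_eq.1 hi with h | h
        · exact ht.bdd i h hia
        · subst h; exact hgt'
    · simp only [Expr.eval, hIj] at hal
      refine WP.skip ⟨hIj, CleanInv.set_varI ⟨ht.frame, ht.deg, ht.le, ht.pot, ?_⟩⟩
      intro i hi hia
      rcases Nat.lt_succ_iff_lt_or_eq.1 hi with h | h
      · exact ht.bdd i h hia
      · subst h; exact absurd hal (hmem.1 hia)

end Step

/-! ### The arrival of one edge -/

/-- The treatment of an arriving edge: an edge whose edge degree is less than `θE` is stored, and as
long as fewer than `αE` consecutive edges of larger edge degree have been seen, it is also made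
alive. -/
def stepCmd (βE θE αE capE : Expr 17) : Cmd 17 :=
  .ite (.lt (.add (.get arrDeg .fst) (.get arrDeg .snd)) θE)
    (.ite (.lt (.var varLen) capE)
      (.seq (.store arrFst (.var varLen) .fst)
        (.seq (.store arrSnd (.var varLen) .snd)
          (.ite (.lt (.var varIdle) αE)
            (.seq (.store arrAlive (.var varLen) (.const 1))
              (.seq (.store arrDeg .fst (.add (.get arrDeg .fst) (.const 1)))
                (.seq (.store arrDeg .snd (.add (.get arrDeg .snd) (.const 1)))
                  (.seq (.assign varIdle (.const 0))
                    (.seq (.assign varLen (.add (.var varLen) (.const 1)))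
                      (clean βE))))))
            (.seq (.store arrAlive (.var varLen) (.const 0))
              (.assign varLen (.add (.var varLen) (.const 1)))))))
      .skip)
    (.ite (.lt (.var varIdle) αE) (.assign varIdle (.add (.var varIdle) (.const 1))) .skip)

/-- The memory holds a list of at most `cap` stored edges, together with the degrees of the alive
ones, which have edge degree at most `β`. -/
structure Consistent (n β cap : ℕ) (s : Mem 17) : Prop where
  len : s varLen 0 ≤ cap
  edge : ∀ i < s varLen 0, s arrFst i < n ∧ s arrSnd i < n ∧ s arrFst i ≠ s arrSnd i
  deg : DegOk s
  bdd : ∀ i ∈ alive s, s arrDeg (s arrFst i) + s arrDeg (s arrSnd i) ≤ β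

/-- `t` arises from `s` by storing the edge `(u, v)` at the end of the list. -/
def Stored (s t : Mem 17) (u v : ℕ) : Prop :=
  t varLen 0 = s varLen 0 + 1 ∧ t arrFst = Function.update (s arrFst) (s varLen 0) u ∧
    t arrSnd = Function.update (s arrSnd) (s varLen 0) v

/-- What happens on arrival of the edge `(u, v)`. -/
def StepResult (n β θ α cap u v : ℕ) (s t : Mem 17) : Prop :=
  Consistent n β cap t ∧
  ((s arrDeg u + s arrDeg v < θ ∧ s varLen 0 < cap ∧ s varIdle 0 < α ∧ Stored s t u v ∧
      t varIdle 0 = 0 ∧ potential β n (s arrDeg) + 2 ≤ potential β n (t arrDeg)) ∨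
    (s arrDeg u + s arrDeg v < θ ∧ s varLen 0 < cap ∧ α ≤ s varIdle 0 ∧ Stored s t u v ∧
      t varIdle 0 = s varIdle 0 ∧ t arrDeg = s arrDeg) ∨
    (s arrDeg u + s arrDeg v < θ ∧ cap ≤ s varLen 0 ∧ t = s) ∨
    (θ ≤ s arrDeg u + s arrDeg v ∧ s varIdle 0 < α ∧ t varIdle 0 = s varIdle 0 + 1 ∧
      t varLen = s varLen ∧ t arrFst = s arrFst ∧ t arrSnd = s arrSnd ∧ t arrDeg = s arrDeg) ∨
    (θ ≤ s arrDeg u + s arrDeg v ∧ α ≤ s varIdle 0 ∧ t = s))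

theorem mem_alive_lt {s : Mem 17} {i : ℕ} (h : i ∈ alive s) : i < s varLen 0 := by
  simp only [alive, Finset.mem_filter, Finset.mem_range] at h; exact h.1

theorem card_alive_le (s : Mem 17) : (alive s).card ≤ s varLen 0 := by
  simpa [alive] using Finset.card_filter_le (Finset.range (s varLen 0)) (fun i => s arrAlive i ≠ 0)

/-- The delicate case is an insertion in the first phase: it may push edge degrees above β, which
`wp_clean` repairs without loss of potential. In all other cases the alive graph is untouched. -/
theorem wp_step {x : Visible} {S w n m u v β θ α cap : ℕ} {βE θE αE capE : Expr 17}
    (hx : x = ⟨n, m, u, v⟩) (hβ : ∀ t, βE.eval x t = β) (hθ : ∀ t, θE.eval x t = θ)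
    (hα : ∀ t, αE.eval x t = α) (hcap : ∀ t, capE.eval x t = cap)
    (hθβ : θ < β) (hS : cap < S) (hn : n ≤ S) (hnw : n ≤ 2 ^ w) (hαw : α < 2 ^ w)
    (hcw : 2 * cap + 1 < 2 ^ w) (hu : u < n) (hv : v < n) (huv : u ≠ v) {s : Mem 17}
    (hs : Consistent n β cap s) :
    WP x S w (stepCmd βE θE αE capE) (StepResult n β θ α cap u v s) s := by
  have xf : x.fst = u := by rw [hx]
  have xs : x.snd = v := by rw [hx]
  have hlen := hs.len
  have hvar : ∀ (t : Mem 17) k, (Expr.var k : Expr 17).eval x t = t k 0 := fun _ _ => rfl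
  have hDw : ∀ y, s arrDeg y + 1 < 2 ^ w := fun y => by
    rw [hs.deg y]
    have h1 := edgeDeg_le (s arrFst) (s arrSnd) (alive s) y
    have h2 := card_alive_le s
    omega
  refine WP.ite (fun h => ?_) (fun h => ?_)
  · have hlt : s arrDeg u + s arrDeg v < θ := by
      simpa [Expr.eval, hθ, xf, xs] using h
    refine WP.ite (fun h => ?_) (fun h => ?_)
    · have hlc : s varLen 0 < cap := by simpa [Expr.eval, hcap] using h
      set L := s varLen 0 with hL
      refine WP.seq (WP.store ?_ ?_ ?_)
      · simp only [Expr.eval]; omega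
      · simp only [Expr.eval, xf]; omega
      refine WP.seq (WP.store ?_ ?_ ?_)
      · simp only [Expr.eval, Mem.set_apply]; simp; omega
      · simp only [Expr.eval, xs]; omega
      have hnot : ∀ i ∈ alive s, i ≠ L := fun i hi => (mem_alive_lt hi).ne
      refine WP.ite (fun h => ?_) (fun h => ?_)
      · have hid : s varIdle 0 < α := by
          simpa [Expr.eval, hα, Mem.set_apply] using h
        refine WP.seq (WP.store ?_ ?_ ?_)
        · simp only [Expr.eval, Mem.set_apply]; simp; omega
        · simp only [Expr.eval]; omega
        refine WP.seq (WP.store ?_ ?_ ?_)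
        · simp only [Expr.eval]; omega
        · simp only [Expr.eval, Mem.set_apply]; simp; exact hDw _
        refine WP.seq (WP.store ?_ ?_ ?_)
        · simp only [Expr.eval]; omega
        · simp only [Expr.eval, Mem.set_apply, xf, xs]; simp [huv.symm]; exact hDw _
        refine WP.seq (WP.store ?_ ?_ ?_)
        · simp only [Expr.eval]; omega
        · simp only [Expr.eval]; omega
        refine WP.seq (WP.store ?_ ?_ ?_)
        · simp only [Expr.eval]; omega
        · simp only [Expr.eval, Mem.set_apply]; simp; omega
        simp only [Expr.eval, Mem.set_apply, xf, xs]
        simp [huv.symm]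
        generalize ht : Mem.set (a := 17) _ varLen 0 _ = t
        have tL : t varLen 0 = L + 1 := by simp [← ht, Mem.set_apply, hL]
        have tI : t varIdle 0 = 0 := by simp [← ht, Mem.set_apply]
        have tF : t arrFst = Function.update (s arrFst) L u := by
          funext i; simp [← ht, Mem.set_apply, Function.update_apply, hL]
        have tG : t arrSnd = Function.update (s arrSnd) L v := by
          funext i; simp [← ht, Mem.set_apply, Function.update_apply, hL]
        have tA : alive t = insert L (alive s) := by
          ext i
          by_cases hi : i = L
          · subst hi; simp [alive, ← ht, Mem.set_apply, ← hL]
          · have : i < L + 1 ↔ i < L := by omega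
            simp [alive, tL, hi, ← hL, this]
            simp [← ht, Mem.set_apply, ← hL, hi]
        have hFold : ∀ i, i ≠ L → t arrFst i = s arrFst i := fun i hi => by rw [tF]; simp [hi]
        have hGold : ∀ i, i ≠ L → t arrSnd i = s arrSnd i := fun i hi => by rw [tG]; simp [hi]
        have hFL : t arrFst L = u := by rw [tF]; simp
        have hGL : t arrSnd L = v := by rw [tG]; simp
        have tD : ∀ y, t arrDeg y =
            s arrDeg y + (if u = y then 1 else 0) + (if v = y then 1 else 0) := fun y => by
          by_cases h1 : v = y
          · subst h1; simp [← ht, Mem.set_apply, huv]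
          · by_cases h2 : u = y
            · subst h2; simp [← ht, Mem.set_apply, huv, h1]
            · simp [← ht, Mem.set_apply, h1, h2, Ne.symm h1, Ne.symm h2]
        have hedge : ∀ i < t varLen 0, t arrFst i < n ∧ t arrSnd i < n ∧
            t arrFst i ≠ t arrSnd i := fun i hi => by
          by_cases hiL : i = L
          · subst hiL; rw [hFL, hGL]; exact ⟨hu, hv, huv⟩
          · rw [hFold i hiL, hGold i hiL]; exact hs.edge i (by omega)
        have hdeg : DegOk t := fun y => by
          rw [tA, edgeDeg_insert (fun hh => hnot L hh rfl), hFL, hGL, tD y, hs.deg y]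
          rw [edgeDeg_congr y (fun i hi => (hFold i (hnot i hi)).symm)
            (fun i hi => (hGold i (hnot i hi)).symm)]
        refine (wp_clean hβ (by omega) (by omega) hn (by omega) hedge hdeg).mono ?_
        intro r hr
        have rF := hr.frame arrFst (by decide) (by decide) (by decide)
        have rG := hr.frame arrSnd (by decide) (by decide) (by decide)
        have rL := hr.frame varLen (by decide) (by decide) (by decide)
        have rI := hr.frame varIdle (by decide) (by decide) (by decide)
        refine ⟨⟨?_, ?_, hr.deg, fun i hi => hr.bdd i (rL ▸ mem_alive_lt hi) hi⟩,
          Or.inl ⟨hlt, hlc, hid, ⟨?_, ?_, ?_⟩, ?_, ?_⟩⟩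
        · rw [rL]; omega
        · rw [rL, rF, rG]; exact hedge
        · rw [rL, tL]
        · rw [rF, tF]
        · rw [rG, tG]
        · rw [rI, tI]
        -- The old edge degree is at most θ - 1 ≤ β - 2, so the gain is at least 4β - 6 - 4(β - 2) =
        -- 2.
        · have := potential_add (β := β) hu hv huv tD
          have := hr.pot
          omega
      · have hid : α ≤ s varIdle 0 := by
          simpa [Expr.eval, hα, Mem.set_apply] using h
        refine WP.seq (WP.store ?_ ?_ ?_)
        · simp only [Expr.eval, Mem.set_apply]; simp; omega
        · simp only [Expr.eval]; omega
        refine WP.store ?_ ?_ ?_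
        · simp only [Expr.eval]; omega
        · simp only [Expr.eval, Mem.set_apply]; simp; omega
        simp only [Expr.eval, Mem.set_apply, xf, xs]
        simp
        generalize ht : Mem.set (a := 17) _ varLen 0 _ = t
        have tL : t varLen 0 = L + 1 := by simp [← ht, Mem.set_apply, hL]
        have tI : t varIdle 0 = s varIdle 0 := by simp [← ht, Mem.set_apply]
        have tF : t arrFst = Function.update (s arrFst) L u := by
          funext i; simp [← ht, Mem.set_apply, Function.update_apply, hL]
        have tG : t arrSnd = Function.update (s arrSnd) L v := by
          funext i; simp [← ht, Mem.set_apply, Function.update_apply, hL]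
        have tD : t arrDeg = s arrDeg := by
          funext i; simp [← ht, Mem.set_apply]
        have tA : alive t = alive s := by
          ext i
          by_cases hi : i = L
          · subst hi; simp [alive, ← ht, Mem.set_apply, ← hL]
          · have : i < L + 1 ↔ i < L := by omega
            simp [alive, tL, ← hL, this]
            simp [← ht, Mem.set_apply, ← hL, hi]
        have hFold : ∀ i, i ≠ L → t arrFst i = s arrFst i := fun i hi => by rw [tF]; simp [hi]
        have hGold : ∀ i, i ≠ L → t arrSnd i = s arrSnd i := fun i hi => by rw [tG]; simp [hi]
        have hFL : t arrFst L = u := by rw [tF]; simp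
        have hGL : t arrSnd L = v := by rw [tG]; simp
        refine ⟨⟨by omega, fun i hi => ?_, fun y => ?_, fun i hi => ?_⟩,
          Or.inr (Or.inl ⟨hlt, hlc, hid, ⟨tL, tF, tG⟩, tI, tD⟩)⟩
        · by_cases hiL : i = L
          · subst hiL; rw [hFL, hGL]; exact ⟨hu, hv, huv⟩
          · rw [hFold i hiL, hGold i hiL]; exact hs.edge i (by omega)
        · rw [tD, tA, hs.deg y]
          exact edgeDeg_congr y (fun i hi => (hFold i (hnot i hi)).symm)
            (fun i hi => (hGold i (hnot i hi)).symm)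
        · rw [tA] at hi
          rw [tD, hFold i (hnot i hi), hGold i (hnot i hi)]
          exact hs.bdd i hi
    · have hlc : cap ≤ s varLen 0 := by simpa [Expr.eval, hcap] using h
      exact WP.skip ⟨hs, Or.inr (Or.inr (Or.inl ⟨hlt, hlc, rfl⟩))⟩
  · have hlt : θ ≤ s arrDeg u + s arrDeg v := by
      simpa [Expr.eval, hθ, xf, xs] using h
    refine WP.ite (fun h => ?_) (fun h => ?_)
    · have hid : s varIdle 0 < α := by simpa [Expr.eval, hα] using h
      refine WP.store ?_ ?_ ?_
      · simp only [Expr.eval]; omega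
      · simp only [Expr.eval]; omega
      simp only [Expr.eval]
      generalize ht : Mem.set (a := 17) _ varIdle 0 _ = t
      have hne : ∀ k, k ≠ varIdle → t k = s k := fun k hk => by
        rw [← ht]; exact Mem.set_of_ne s _ _ hk
      have tA : alive t = alive s := by
        rw [← ht]; exact alive_set_of_ne (by decide) (by decide)
      have tL := hne varLen (by decide)
      have tF := hne arrFst (by decide)
      have tG := hne arrSnd (by decide)
      have tD := hne arrDeg (by decide)
      refine ⟨⟨by rw [tL]; exact hs.len, by rw [tL, tF, tG]; exact hs.edge, fun y => ?_, ?_⟩,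
        Or.inr (Or.inr (Or.inr (Or.inl ⟨hlt, hid, ?_, tL, tF, tG, tD⟩)))⟩
      · rw [tD, tA, tF, tG]; exact hs.deg y
      · rw [tD, tA, tF, tG]; exact hs.bdd
      · simp [← ht, Mem.set_apply]
    · have hid : α ≤ s varIdle 0 := by simpa [Expr.eval, hα] using h
      exact WP.skip ⟨hs, Or.inr (Or.inr (Or.inr (Or.inr ⟨hlt, hid, rfl⟩)))⟩

/-- The progress measure `v` is a ghost value carried by the invariant instead of a function of the
memory; in the search it is the number encoded by the bit array. -/
theorem WP.loop_count {a : ℕ} {x : Visible} {S w : ℕ} {b : Expr a} {p : Cmd a}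
    {Q : Mem a → Prop} (N : ℕ) (Inv : ℕ → Mem a → Prop)
    (hstep : ∀ v s, Inv v s → b.eval x s ≠ 0 → v < N ∧ WP x S w p (Inv (v + 1)) s)
    (hdone : ∀ v s, Inv v s → b.eval x s = 0 → Q s) (v : ℕ) (s : Mem a) (hs : Inv v s) :
    WP x S w (.loop b p) Q s := by
  induction hm : N - v generalizing v s with
  | zero =>
    have hb : b.eval x s = 0 := by
      by_contra hb
      have := (hstep v s hs hb).1
      omega
    exact ⟨s, .loop_of_eq_zero hb, hdone v s hs hb⟩
  | succ k ih =>
    by_cases hb : b.eval x s = 0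
    · exact ⟨s, .loop_of_eq_zero hb, hdone v s hs hb⟩
    · obtain ⟨_, t, ht, hi⟩ := hstep v s hs hb
      obtain ⟨u, hu, hq⟩ := ih (v + 1) t hi (by omega)
      exact ⟨u, .loop_step b p s t u hb ht hu, hq⟩

/-! ### Maximum matching among the stored edges by exhaustive search -/

/-- The two edges number `i` and `j` share an endpoint. -/
def Conflict (f g : ℕ → ℕ) (i j : ℕ) : Prop := f i = f j ∨ f i = g j ∨ g i = f j ∨ g i = g j

/-- No two edges with numbers in `X` share an endpoint. -/
def IndepEdges (f g : ℕ → ℕ) (X : Finset ℕ) : Prop :=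
  ∀ i ∈ X, ∀ j ∈ X, j < i → ¬ Conflict f g i j

/-- The set selected by the first `L` entries of an indicator array. -/
def selected (b : ℕ → ℕ) (L : ℕ) : Finset ℕ := {i ∈ Finset.range L | b i ≠ 0}

theorem selected_congr {b b' : ℕ → ℕ} {L : ℕ} (h : ∀ i < L, b i = b' i) :
    selected b L = selected b' L := by
  ext i
  simp only [selected, Finset.mem_filter, Finset.mem_range]
  exact ⟨fun ⟨h1, h2⟩ => ⟨h1, h i h1 ▸ h2⟩, fun ⟨h1, h2⟩ => ⟨h1, (h i h1).symm ▸ h2⟩⟩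

/-- Makes the search exhaustive: counting from 0 to `2 ^ L - 1` meets every subset of the `L`
positions. -/
theorem exists_selected_bits (L : ℕ) (Y : Finset ℕ) (hY : Y ⊆ Finset.range L) :
    ∃ v < 2 ^ L, selected (fun i => v / 2 ^ i % 2) L = Y := by
  classical
  refine ⟨Nat.ofBits (fun i : Fin L => decide ((i : ℕ) ∈ Y)), Nat.ofBits_lt_two_pow _, ?_⟩
  ext i
  simp only [selected, Finset.mem_filter, Finset.mem_range]
  constructor
  · rintro ⟨hi, hb⟩
    have h := Nat.testBit_ofBits_lt (fun i : Fin L => decide ((i : ℕ) ∈ Y)) i hi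
    rw [Nat.testBit_eq_decide_div_mod_eq] at h
    have h1 : Nat.ofBits (fun i : Fin L => decide ((i : ℕ) ∈ Y)) / 2 ^ i % 2 = 1 := by omega
    rw [h1] at h
    simpa using h.symm
  · intro hi
    have hiL := Finset.mem_range.1 (hY hi)
    have h := Nat.testBit_ofBits_lt (fun i : Fin L => decide ((i : ℕ) ∈ Y)) i hiL
    rw [Nat.testBit_eq_decide_div_mod_eq] at h
    simp only [hi, decide_true, decide_eq_true_eq] at h
    exact ⟨hiL, by omega⟩

/-- Nonzero if the edges number `varI` and `varJ` share an endpoint. -/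
def conflictE : Expr 17 :=
  .add (.add (.eq (.get arrFst (.var varI)) (.get arrFst (.var varJ)))
      (.eq (.get arrFst (.var varI)) (.get arrSnd (.var varJ))))
    (.add (.eq (.get arrSnd (.var varI)) (.get arrFst (.var varJ)))
      (.eq (.get arrSnd (.var varI)) (.get arrSnd (.var varJ))))

/-- Count the edges selected by `arrBit`, and test whether they form a matching. -/
def checkCmd : Cmd 17 :=
  .seq (.assign varOk (.const 1)) (.seq (.assign varCount (.const 0))
    (.forLoop varI (.var varLen) (.ite (.get arrBit (.var varI))
      (.seq (.assign varCount (.add (.var varCount) (.const 1)))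
        (.forLoop varJ (.var varI) (.ite (.get arrBit (.var varJ))
          (.ite conflictE (.assign varOk (.const 0)) .skip) .skip)))
      .skip)))

/-- Remember the selected edges, if they form a larger matching than the best one so far. -/
def saveCmd : Cmd 17 :=
  .ite (.var varOk) (.ite (.lt (.var varMax) (.var varCount))
    (.seq (.assign varMax (.var varCount))
      (.forLoop varI (.var varLen) (.store arrBest (.var varI) (.get arrBit (.var varI)))))
    .skip) .skip

/-- Increase the binary counter in `arrBit` by one. -/
def incCmd : Cmd 17 :=
  .seq (.assign varCarry (.const 1))
    (.forLoop varI (.var varLen)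
      (.seq (.assign varJ (.add (.get arrBit (.var varI)) (.var varCarry)))
        (.seq (.store arrBit (.var varI) (.mod (.var varJ) (.const 2)))
          (.assign varCarry (.div (.var varJ) (.const 2))))))

/-- Write the edges selected by `arrBest` to the output. -/
def outCmd : Cmd 17 :=
  .seq (.assign varOut (.const 0))
    (.forLoop varI (.var varLen) (.ite (.get arrBest (.var varI))
      (.seq (.store arrOutFst (.var varOut) (.get arrFst (.var varI)))
        (.seq (.store arrOutSnd (.var varOut) (.get arrSnd (.var varI)))
          (.assign varOut (.add (.var varOut) (.const 1)))))
      .skip))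

/-- Output a maximum matching of the stored edges. -/
def finishCmd : Cmd 17 :=
  .seq (.forLoop varI (.var varLen)
      (.seq (.store arrBit (.var varI) (.const 0)) (.store arrBest (.var varI) (.const 0))))
    (.seq (.assign varMax (.const 0)) (.seq (.assign varCarry (.const 0))
      (.seq (.loop (.eq (.var varCarry) (.const 0)) (.seq checkCmd (.seq saveCmd incCmd)))
        outCmd)))

/-! ### Correctness of the exhaustive search -/

section Finish

variable {x : Visible} {S w L : ℕ} {f g : ℕ → ℕ}

/-- The memory holds the list of the `L` edges `(f i, g i)`. -/
def Holds (f g : ℕ → ℕ) (L : ℕ) (t : Mem 17) : Prop :=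
  t arrFst = f ∧ t arrSnd = g ∧ t varLen 0 = L

theorem Holds.set {t : Mem 17} (h : Holds f g L t) {k : Fin 17} (i v : ℕ) (h0 : arrFst ≠ k)
    (h1 : arrSnd ≠ k) (h4 : varLen ≠ k) : Holds f g L (t.set k i v) := by
  refine ⟨?_, ?_, ?_⟩
  · rw [Mem.set_of_ne t i v h0]; exact h.1
  · rw [Mem.set_of_ne t i v h1]; exact h.2.1
  · rw [Mem.set_of_ne t i v h4]; exact h.2.2

theorem indepEdges_insert {f g : ℕ → ℕ} {X : Finset ℕ} {i : ℕ} (hX : ∀ j ∈ X, j < i) :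
    IndepEdges f g (insert i X) ↔ IndepEdges f g X ∧ ∀ j ∈ X, ¬ Conflict f g i j := by
  constructor
  · intro h
    exact ⟨fun a ha b hb => h a (Finset.mem_insert_of_mem ha) b (Finset.mem_insert_of_mem hb),
      fun j hj => h i (Finset.mem_insert_self _ _) j (Finset.mem_insert_of_mem hj) (hX j hj)⟩
  · rintro ⟨h1, h2⟩ a ha b hb hba
    rcases Finset.mem_insert.1 ha with rfl | ha'
    · rcases Finset.mem_insert.1 hb with rfl | hb'
      · omega
      · exact h2 b hb'
    · rcases Finset.mem_insert.1 hb with rfl | hb'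
      · have := hX a ha'; omega
      · exact h1 a ha' b hb' hba

theorem selected_succ (b : ℕ → ℕ) (i : ℕ) :
    selected b (i + 1) = if b i ≠ 0 then insert i (selected b i) else selected b i := by
  ext j
  split_ifs with h
  · simp only [selected, Finset.mem_filter, Finset.mem_range, Finset.mem_insert]
    constructor
    · rintro ⟨h1, h2⟩
      by_cases hj : j = i
      · exact Or.inl hj
      · exact Or.inr ⟨by omega, h2⟩
    · rintro (rfl | ⟨h1, h2⟩)
      · exact ⟨by omega, h⟩
      · exact ⟨by omega, h2⟩
  · simp only [selected, Finset.mem_filter, Finset.mem_range]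
    constructor
    · rintro ⟨h1, h2⟩
      by_cases hj : j = i
      · subst hj; exact absurd h2 h
      · exact ⟨by omega, h2⟩
    · rintro ⟨h1, h2⟩
      exact ⟨by omega, h2⟩

theorem mem_selected {b : ℕ → ℕ} {L i : ℕ} : i ∈ selected b L ↔ i < L ∧ b i ≠ 0 := by
  simp [selected]

theorem card_selected_le (b : ℕ → ℕ) (L : ℕ) : (selected b L).card ≤ L := by
  simpa [selected] using Finset.card_filter_le (Finset.range L) (fun i => b i ≠ 0)

/-- Edges are examined in increasing order, so by `indepEdges_insert` a new one need only be
compared with the selected ones before it. -/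
theorem wp_check (hS : 0 < S) (hw : L + 1 < 2 ^ w) {s : Mem 17} (hs : Holds f g L s) :
    WP x S w checkCmd (fun t => Holds f g L t ∧ t arrBit = s arrBit ∧ t arrBest = s arrBest ∧
      t varMax = s varMax ∧ t varCount 0 = (selected (s arrBit) L).card ∧
      (t varOk 0 ≠ 0 ↔ IndepEdges f g (selected (s arrBit) L))) s := by
  have hvar : ∀ (t : Mem 17) k, (Expr.var k : Expr 17).eval x t = t k 0 := fun _ _ => rfl
  refine WP.seq (WP.store (by simpa [Expr.eval] using hS) (by simp only [Expr.eval]; omega) ?_)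
  refine WP.seq (WP.store (by simpa [Expr.eval] using hS) (by simp [Expr.eval]) ?_)
  simp only [Expr.eval]
  refine WP.forLoop L (fun j t => Holds f g L t ∧ t arrBit = s arrBit ∧ t arrBest = s arrBest ∧
      t varMax = s varMax ∧ t varCount 0 = (selected (s arrBit) j).card ∧
      (t varOk 0 ≠ 0 ↔ IndepEdges f g (selected (s arrBit) j))) hS (by omega) ?_ ?_ ?_ ?_
  · intro j t ht _
    exact ht.1.2.2
  · refine ⟨(((hs.set _ _ (by decide) (by decide) (by decide)).set _ _ (by decide) (by decide)
      (by decide)).set _ _ (by decide) (by decide) (by decide)), ?_, ?_, ?_, ?_, ?_⟩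
    · funext i; simp [Mem.set_apply]
    · funext i; simp [Mem.set_apply]
    · funext i; simp [Mem.set_apply]
    · simp [Mem.set_apply, selected]
    · simp [Mem.set_apply, selected, IndepEdges]
  · rintro i t hi ⟨hH, hB, hBest, hM, hC, hOk⟩ hI
    have hcard := card_selected_le (s arrBit) i
    refine WP.ite (fun hb => ?_) (fun hb => ?_)
    · simp only [Expr.eval, hI, hB] at hb
      have hsucc : selected (s arrBit) (i + 1) = insert i (selected (s arrBit) i) := by
        rw [selected_succ, if_pos hb]
      have hlt : ∀ j ∈ selected (s arrBit) i, j < i := fun j hj => (mem_selected.1 hj).1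
      refine WP.seq (WP.store (by simpa [Expr.eval] using hS) (by simp only [Expr.eval]; omega) ?_)
      simp only [Expr.eval]
      refine WP.forLoop i (fun j t => Holds f g L t ∧ t arrBit = s arrBit ∧
        t arrBest = s arrBest ∧ t varMax = s varMax ∧
        t varCount 0 = (selected (s arrBit) (i + 1)).card ∧ t varI 0 = i ∧
        (t varOk 0 ≠ 0 ↔ IndepEdges f g (selected (s arrBit) i) ∧
          ∀ k ∈ selected (s arrBit) j, ¬ Conflict f g i k)) hS (by omega) ?_ ?_ ?_ ?_
      · rintro j u ⟨_, _, _, _, _, h, _⟩ _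
        exact h
      · refine ⟨(hH.set _ _ (by decide) (by decide) (by decide)).set _ _ (by decide) (by decide)
          (by decide), ?_, ?_, ?_, ?_, ?_, ?_⟩
        · rw [← hB]; funext k; simp [Mem.set_apply]
        · rw [← hBest]; funext k; simp [Mem.set_apply]
        · rw [← hM]; funext k; simp [Mem.set_apply]
        · rw [hsucc, Finset.card_insert_of_notMem (fun h => (hlt i h).ne rfl)]
          simp [Mem.set_apply, hC]
        · simp [Mem.set_apply, hI]
        · rw [← hOk]; simp [Mem.set_apply, selected]
      · rintro j u hj ⟨uH, uB, uBest, uM, uC, uI, uOk⟩ uJ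
        -- Every branch of the inner body changes at most `varOk`, so the rest of the invariant is
        -- transported once for all branches.
        have key : ∀ r : Mem 17, (∀ k, k ≠ varOk → r k = u k) →
            (r varOk 0 ≠ 0 ↔ IndepEdges f g (selected (s arrBit) i) ∧
              ∀ k ∈ selected (s arrBit) (j + 1), ¬ Conflict f g i k) →
            r varJ 0 = j ∧ (Holds f g L (r.set varJ 0 (j + 1)) ∧
              (r.set varJ 0 (j + 1)) arrBit = s arrBit ∧
              (r.set varJ 0 (j + 1)) arrBest = s arrBest ∧
              (r.set varJ 0 (j + 1)) varMax = s varMax ∧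
              (r.set varJ 0 (j + 1)) varCount 0 = (selected (s arrBit) (i + 1)).card ∧
              (r.set varJ 0 (j + 1)) varI 0 = i ∧
              ((r.set varJ 0 (j + 1)) varOk 0 ≠ 0 ↔ IndepEdges f g (selected (s arrBit) i) ∧
                ∀ k ∈ selected (s arrBit) (j + 1), ¬ Conflict f g i k)) := by
          intro r hr hok
          have hne : ∀ k, k ≠ varOk → k ≠ varJ → (r.set varJ 0 (j + 1)) k = u k :=
            fun k h1 h2 => by rw [Mem.set_of_ne _ _ _ h2, hr k h1]
          refine ⟨by rw [hr _ (by decide), uJ], ⟨?_, ?_, ?_⟩, ?_, ?_, ?_, ?_, ?_, ?_⟩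
          · rw [hne _ (by decide) (by decide)]; exact uH.1
          · rw [hne _ (by decide) (by decide)]; exact uH.2.1
          · rw [hne _ (by decide) (by decide)]; exact uH.2.2
          · rw [hne _ (by decide) (by decide)]; exact uB
          · rw [hne _ (by decide) (by decide)]; exact uBest
          · rw [hne _ (by decide) (by decide)]; exact uM
          · rw [hne _ (by decide) (by decide)]; exact uC
          · rw [hne _ (by decide) (by decide)]; exact uI
          · rw [Mem.set_of_ne _ _ _ (by decide)]; exact hok
        refine WP.ite (fun hb' => ?_) (fun hb' => ?_)
        · simp only [Expr.eval, uJ, uB] at hb'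
          have hs' : selected (s arrBit) (j + 1) = insert j (selected (s arrBit) j) := by
            rw [selected_succ, if_pos hb']
          have hconf : conflictE.eval x u ≠ 0 ↔ Conflict f g i j := by
            simp only [conflictE, Expr.eval, uI, uJ, uH.1, uH.2.1, Conflict]
            split_ifs <;> simp [*]
          refine WP.ite (fun hc => ?_) (fun hc => ?_)
          · rw [hconf] at hc
            refine WP.store (by simpa [Expr.eval] using hS) (by simp [Expr.eval]) ?_
            simp only [Expr.eval]
            refine key _ (fun k hk => Mem.set_of_ne _ _ _ hk) ?_
            rw [hs']
            simp only [Mem.set_apply]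
            simp [hc]
          · have hc' : ¬ Conflict f g i j := fun h => hconf.2 h hc
            refine WP.skip (key u (fun _ _ => rfl) ?_)
            rw [uOk, hs']
            simp [hc']
        · simp only [Expr.eval, uJ, uB] at hb'
          refine WP.skip (key u (fun _ _ => rfl) ?_)
          rw [uOk, selected_succ, if_neg (by simpa using hb')]
      · rintro u ⟨uH, uB, uBest, uM, uC, uI, uOk⟩
        refine ⟨uI, uH.set _ _ (by decide) (by decide) (by decide), ?_, ?_, ?_, ?_, ?_⟩
        · rw [Mem.set_of_ne _ _ _ (by decide)]; exact uB
        · rw [Mem.set_of_ne _ _ _ (by decide)]; exact uBest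
        · rw [Mem.set_of_ne _ _ _ (by decide)]; exact uM
        · rw [Mem.set_of_ne _ _ _ (by decide)]; exact uC
        · rw [Mem.set_of_ne _ _ _ (by decide), uOk, hsucc, indepEdges_insert hlt]
    · simp only [Expr.eval, hI, hB] at hb
      have hsucc : selected (s arrBit) (i + 1) = selected (s arrBit) i := by
        rw [selected_succ, if_neg (by simpa using hb)]
      refine WP.skip ⟨hI, hH.set _ _ (by decide) (by decide) (by decide), ?_, ?_, ?_, ?_, ?_⟩
      · rw [Mem.set_of_ne _ _ _ (by decide)]; exact hB
      · rw [Mem.set_of_ne _ _ _ (by decide)]; exact hBest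
      · rw [Mem.set_of_ne _ _ _ (by decide)]; exact hM
      · rw [Mem.set_of_ne _ _ _ (by decide), hsucc]; exact hC
      · rw [Mem.set_of_ne _ _ _ (by decide), hsucc]; exact hOk
  · exact fun t ht => ht

/-- The matching in `arrBest` has size `varMax`, which is at least the size of every matching
selected by a number smaller than `v`. -/
def BestBelow (f g : ℕ → ℕ) (L v : ℕ) (t : Mem 17) : Prop :=
  IndepEdges f g (selected (t arrBest) L) ∧ t varMax 0 = (selected (t arrBest) L).card ∧
    ∀ v' < v, IndepEdges f g (selected (fun i => v' / 2 ^ i % 2) L) →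
      (selected (fun i => v' / 2 ^ i % 2) L).card ≤ t varMax 0

theorem wp_save (hS : 0 < S) (hLS : L ≤ S) (hw : L + 1 < 2 ^ w) {s : Mem 17} {v : ℕ}
    (hs : Holds f g L s) (hbit : ∀ i < L, s arrBit i = v / 2 ^ i % 2)
    (hcount : s varCount 0 = (selected (s arrBit) L).card)
    (hok : s varOk 0 ≠ 0 ↔ IndepEdges f g (selected (s arrBit) L)) (hbest : BestBelow f g L v s) :
    WP x S w saveCmd (fun t => Holds f g L t ∧ t arrBit = s arrBit ∧
      BestBelow f g L (v + 1) t) s := by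
  have hsel := selected_congr hbit
  have hcard := card_selected_le (s arrBit) L
  obtain ⟨hb1, hb2, hb3⟩ := hbest
  refine WP.ite (fun hb => ?_) (fun hb => ?_)
  · simp only [Expr.eval] at hb
    refine WP.ite (fun hlt => ?_) (fun hlt => ?_)
    · have hlt' : s varMax 0 < s varCount 0 := Expr.eval_lt_ne_zero.1 hlt
      refine WP.seq (WP.store (by simpa [Expr.eval] using hS) (by simp only [Expr.eval]; omega) ?_)
      simp only [Expr.eval]
      refine WP.forLoop L (fun j t => Holds f g L t ∧ t arrBit = s arrBit ∧
        t varMax 0 = s varCount 0 ∧ ∀ i < j, t arrBest i = s arrBit i) hS (by omega) ?_ ?_ ?_ ?_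
      · intro j t ht _
        exact ht.1.2.2
      · refine ⟨(hs.set _ _ (by decide) (by decide) (by decide)).set _ _ (by decide) (by decide)
          (by decide), ?_, ?_, ?_⟩
        · funext i; simp [Mem.set_apply]
        · simp [Mem.set_apply]
        · intro i hi; omega
      · rintro j t hj ⟨hH, hB, hM, hbest⟩ hI
        refine WP.store (by simp only [Expr.eval, hI]; omega) ?_ ?_
        · simp only [Expr.eval, hI, hB]
          rw [hbit j hj]
          have := Nat.mod_lt (v / 2 ^ j) (show 0 < 2 by norm_num)
          omega
        · simp only [Expr.eval, hI, hB]
          refine ⟨by simp [Mem.set_apply, hI], (hH.set _ _ (by decide) (by decide)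
            (by decide)).set _ _ (by decide) (by decide) (by decide), ?_, ?_, ?_⟩
          · rw [← hB]; funext i; simp [Mem.set_apply]
          · rw [← hM]; simp [Mem.set_apply]
          · intro i hi
            by_cases hij : i = j
            · subst hij; simp [Mem.set_apply]
            · simp [Mem.set_apply, hij]
              exact hbest i (by omega)
      · rintro t ⟨hH, hB, hM, hbest⟩
        refine ⟨hH, hB, ?_, ?_, ?_⟩
        · rw [selected_congr hbest]; exact hok.1 hb
        · rw [selected_congr hbest, hM, hcount]
        · intro v' hv' hi
          rcases Nat.lt_succ_iff_lt_or_eq.1 hv' with h | h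
          · have := hb3 v' h hi; omega
          · subst h; rw [hM, hcount, hsel]
    · have hlt' : s varCount 0 ≤ s varMax 0 :=
        not_lt.1 fun h => absurd hlt (Expr.eval_lt_ne_zero.2 (by exact h))
      refine WP.skip ⟨hs, rfl, hb1, hb2, fun v' hv' hi => ?_⟩
      rcases Nat.lt_succ_iff_lt_or_eq.1 hv' with h | h
      · exact hb3 v' h hi
      · subst h; rw [← hsel, ← hcount]; exact hlt'
  · simp only [Expr.eval] at hb
    refine WP.skip ⟨hs, rfl, hb1, hb2, fun v' hv' hi => ?_⟩
    rcases Nat.lt_succ_iff_lt_or_eq.1 hv' with h | h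
    · exact hb3 v' h hi
    · subst h; rw [← hsel] at hi; exact absurd hb (hok.2 hi)

/-- Schoolbook addition: after `j` positions the carry is the difference of the quotients of `v + 1`
and `v` by `2 ^ j`. At `j = L` the quotient of `v` is 0, so a carry remains exactly on overflow,
which ends the search. -/
theorem wp_inc (hS : 0 < S) (hLS : L ≤ S) (hw : L + 2 < 2 ^ w) {s : Mem 17} {v : ℕ}
    (hs : Holds f g L s) (hbit : ∀ i < L, s arrBit i = v / 2 ^ i % 2) (hv : v < 2 ^ L)
    (hbest : BestBelow f g L (v + 1) s) :
    WP x S w incCmd (fun t => Holds f g L t ∧ BestBelow f g L (v + 1) t ∧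
      (∀ i < L, t arrBit i = (v + 1) / 2 ^ i % 2) ∧ (t varCarry 0 = 0 ↔ v + 1 < 2 ^ L)) s := by
  refine WP.seq (WP.store (by simpa [Expr.eval] using hS) (by simp only [Expr.eval]; omega) ?_)
  simp only [Expr.eval]
  refine WP.forLoop L (fun j t => Holds f g L t ∧ t arrBest = s arrBest ∧ t varMax = s varMax ∧
    (∀ i < j, t arrBit i = (v + 1) / 2 ^ i % 2) ∧ (∀ i, j ≤ i → i < L → t arrBit i = s arrBit i) ∧
    t varCarry 0 ≤ 1 ∧ (v + 1) / 2 ^ j = v / 2 ^ j + t varCarry 0) hS (by omega) ?_ ?_ ?_ ?_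
  · intro j t ht _
    exact ht.1.2.2
  · refine ⟨(hs.set _ _ (by decide) (by decide) (by decide)).set _ _ (by decide) (by decide)
      (by decide), ?_, ?_, ?_, ?_, ?_, ?_⟩
    · funext i; simp [Mem.set_apply]
    · funext i; simp [Mem.set_apply]
    · intro i hi; omega
    · intro i _ _; simp [Mem.set_apply]
    · simp [Mem.set_apply]
    · simp [Mem.set_apply]
  · rintro j t hj ⟨hH, hB, hM, hlo, hhi, hc1, hc⟩ hI
    have hbj : t arrBit j = v / 2 ^ j % 2 := by rw [hhi j le_rfl hj, hbit j hj]
    have hb1 : t arrBit j ≤ 1 := by omega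
    refine WP.seq (WP.store (by simpa [Expr.eval] using hS)
      (by simp only [Expr.eval, hI]; omega) ?_)
    simp only [Expr.eval, hI]
    set r := t arrBit j + t varCarry 0 with hr
    refine WP.seq (WP.store ?_ ?_ ?_)
    · simp only [Expr.eval, Mem.set_apply]; simp [hI]; omega
    · simp only [Expr.eval, Mem.set_apply]; simp; omega
    refine WP.store (by simpa [Expr.eval] using hS) ?_ ?_
    · simp only [Expr.eval, Mem.set_apply]; simp; omega
    simp only [Expr.eval, Mem.set_apply]
    simp [hI]
    have hpow : ∀ y, y / 2 ^ (j + 1) = y / 2 ^ j / 2 := fun y => by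
      rw [pow_succ, Nat.div_div_eq_div_mul]
    refine ⟨((((hH.set _ _ (by decide) (by decide) (by decide)).set _ _ (by decide) (by decide)
      (by decide)).set _ _ (by decide) (by decide) (by decide)).set _ _ (by decide) (by decide)
      (by decide)), ?_, ?_, ?_, ?_, ?_, ?_⟩
    · rw [← hB]; funext i; simp [Mem.set_apply]
    · rw [← hM]; funext i; simp [Mem.set_apply]
    · intro i hi
      by_cases hij : i = j
      · subst hij
        simp
        omega
      · simp [hij]
        exact hlo i (by omega)
    · intro i h1 h2
      have hij : i ≠ j := by omega
      simp [hij]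
      exact hhi i (by omega) h2
    · omega
    · rw [hpow, hpow]
      omega
  · rintro t ⟨hH, hB, hM, hlo, -, hc1, hc⟩
    refine ⟨hH, ?_, hlo, ?_⟩
    · unfold BestBelow at hbest ⊢
      rw [hB, hM]; exact hbest
    · rw [Nat.div_eq_of_lt hv] at hc
      constructor
      · intro h
        rw [h] at hc
        exact (Nat.div_eq_zero_iff_lt (by positivity)).1 (by omega)
      · intro h
        rw [Nat.div_eq_of_lt h] at hc
        omega

theorem wp_out (hS : 0 < S) (hLS : L ≤ S) (hw : L + 1 < 2 ^ w) (hf : ∀ i < L, f i < 2 ^ w)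
    (hg : ∀ i < L, g i < 2 ^ w) {s : Mem 17} (hs : Holds f g L s) :
    WP x S w outCmd (fun t => (List.range (t varOut 0)).map
        (fun i => (t arrOutFst i, t arrOutSnd i)) =
      ((List.range L).filter (fun i => s arrBest i ≠ 0)).map fun i => (f i, g i)) s := by
  refine WP.seq (WP.store (by simpa [Expr.eval] using hS) (by simp [Expr.eval]) ?_)
  simp only [Expr.eval]
  refine WP.forLoop L (fun j t => Holds f g L t ∧ t arrBest = s arrBest ∧ t varOut 0 ≤ j ∧
    (List.range (t varOut 0)).map (fun i => (t arrOutFst i, t arrOutSnd i)) =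
      ((List.range j).filter (fun i => s arrBest i ≠ 0)).map fun i => (f i, g i))
    hS (by omega) ?_ ?_ ?_ ?_
  · intro j t ht _
    exact ht.1.2.2
  · refine ⟨(hs.set _ _ (by decide) (by decide) (by decide)).set _ _ (by decide) (by decide)
      (by decide), ?_, ?_, ?_⟩
    · funext i; simp [Mem.set_apply]
    · simp [Mem.set_apply]
    · simp [Mem.set_apply]
  · rintro j t hj ⟨hH, hB, ho, hl⟩ hI
    refine WP.ite (fun hb => ?_) (fun hb => ?_)
    · simp only [Expr.eval, hI, hB] at hb
      refine WP.seq (WP.store ?_ ?_ ?_)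
      · simp only [Expr.eval]; omega
      · simp only [Expr.eval, hI, hH.1]; exact hf j hj
      refine WP.seq (WP.store ?_ ?_ ?_)
      · simp only [Expr.eval, Mem.set_apply]; simp; omega
      · simp only [Expr.eval, Mem.set_apply]; simp [hI, hH.2.1]; exact hg j hj
      refine WP.store ?_ ?_ ?_
      · simp only [Expr.eval]; omega
      · simp only [Expr.eval, Mem.set_apply]; simp; omega
      simp only [Expr.eval, Mem.set_apply]
      simp [hI, hH.1, hH.2.1]
      refine ⟨((((hH.set _ _ (by decide) (by decide) (by decide)).set _ _ (by decide) (by decide)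
        (by decide)).set _ _ (by decide) (by decide) (by decide)).set _ _ (by decide) (by decide)
        (by decide)), ?_, ?_, ?_⟩
      · rw [← hB]; funext i; simp [Mem.set_apply]
      · omega
      · simp only [List.range_succ, List.map_append, List.filter_append]
        rw [show ([j].filter fun i => !decide (s arrBest i = 0)) = [j] by simp [hb]]
        have hl' : (List.range (t varOut 0)).map (fun i => (t arrOutFst i, t arrOutSnd i)) =
          ((List.range j).filter (fun i => !decide (s arrBest i = 0))).map fun i => (f i, g i) := by
          simpa using hl
        rw [← hl']
        congr 1
        · refine List.map_congr_left fun i hi => ?_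
          have : i ≠ t varOut 0 := (List.mem_range.1 hi).ne
          simp [this]
        · simp
    · simp only [Expr.eval, hI, hB] at hb
      refine WP.skip ⟨hI, hH.set _ _ (by decide) (by decide) (by decide), ?_, ?_, ?_⟩
      · rw [Mem.set_of_ne _ _ _ (by decide)]; exact hB
      · rw [Mem.set_of_ne _ _ _ (by decide)]; omega
      · rw [Mem.set_of_ne _ _ _ (by decide), Mem.set_of_ne _ _ _ (by decide),
          Mem.set_of_ne _ _ _ (by decide), hl]
        simp [List.range_succ, List.filter_append, hb]
  · exact fun t ht => ht.2.2.2

/-- The loop leaves only by overflow of the counter, and then every subset has been tested. The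
empty `arrBest` with `varMax` equal to 0 is a valid start because the empty set is a matching. -/
theorem wp_finish (hS : 0 < S) (hLS : L ≤ S) (hw : L + 2 < 2 ^ w) (hf : ∀ i < L, f i < 2 ^ w)
    (hg : ∀ i < L, g i < 2 ^ w) {s : Mem 17} (hs : Holds f g L s) :
    WP x S w finishCmd (fun t => ∃ X ⊆ Finset.range L, IndepEdges f g X ∧
      (∀ Y ⊆ Finset.range L, IndepEdges f g Y → Y.card ≤ X.card) ∧
      ((List.range (t varOut 0)).map fun i => (t arrOutFst i, t arrOutSnd i)).toFinset =
        X.image fun i => (f i, g i)) s := by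
  refine WP.seq (WP.mono (Q := fun t => Holds f g L t ∧
    ∀ i < L, t arrBit i = 0 ∧ t arrBest i = 0) ?_ ?_)
  · refine WP.forLoop L (fun j t => Holds f g L t ∧ ∀ i < j, t arrBit i = 0 ∧ t arrBest i = 0)
      hS (by omega) ?_ ?_ ?_ (fun t ht => ht)
    · intro j t ht _
      exact ht.1.2.2
    · exact ⟨hs.set _ _ (by decide) (by decide) (by decide), fun i hi => by omega⟩
    · rintro j t hj ⟨hH, hz⟩ hI
      refine WP.seq (WP.store ?_ ?_ ?_)
      · simp only [Expr.eval, hI]; omega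
      · simp [Expr.eval]
      refine WP.store ?_ ?_ ?_
      · simp only [Expr.eval, Mem.set_apply]; simp [hI]; omega
      · simp [Expr.eval]
      simp only [Expr.eval, Mem.set_apply]
      simp [hI]
      refine ⟨((hH.set _ _ (by decide) (by decide) (by decide)).set _ _ (by decide) (by decide)
        (by decide)).set _ _ (by decide) (by decide) (by decide), fun i hi => ?_⟩
      by_cases hij : i = j
      · simp [hij]
      · simp [hij]; exact hz i (by omega)
  rintro s₁ ⟨h₁, hz⟩
  refine WP.seq (WP.store (by simpa [Expr.eval] using hS) (by simp [Expr.eval]) ?_)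
  refine WP.seq (WP.store (by simpa [Expr.eval] using hS) (by simp [Expr.eval]) ?_)
  simp only [Expr.eval]
  refine WP.seq (WP.mono (Q := fun t => Holds f g L t ∧ BestBelow f g L (2 ^ L) t) ?_ ?_)
  · refine WP.loop_count (2 ^ L) (fun v t => Holds f g L t ∧ BestBelow f g L v t ∧
      (∀ i < L, t arrBit i = v / 2 ^ i % 2) ∧ (t varCarry 0 = 0 ↔ v < 2 ^ L) ∧ v ≤ 2 ^ L)
      ?_ ?_ 0 _ ?_
    · rintro v t ⟨hH, hbest, hbit, hc, -⟩ hcond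
      have hc0 : t varCarry 0 = 0 := Expr.eval_eq_ne_zero.1 hcond
      have hv := hc.1 hc0
      refine ⟨hv, WP.seq ((wp_check hS (by omega) hH).mono ?_)⟩
      rintro t₁ ⟨hH₁, hB₁, hBest₁, hM₁, hC₁, hOk₁⟩
      rw [← hB₁] at hC₁ hOk₁ hbit
      refine WP.seq ((wp_save hS hLS (by omega) hH₁ hbit hC₁ hOk₁ ?_).mono ?_)
      · unfold BestBelow at hbest ⊢
        rw [hBest₁, hM₁]; exact hbest
      rintro t₂ ⟨hH₂, hB₂, hbest₂⟩
      rw [← hB₂] at hbit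
      refine (wp_inc hS hLS hw hH₂ hbit hv hbest₂).mono ?_
      rintro t₃ ⟨hH₃, hbest₃, hbit₃, hc₃⟩
      exact ⟨hH₃, hbest₃, hbit₃, hc₃, hv⟩
    · rintro v t ⟨hH, hbest, -, hc, hv⟩ hcond
      have hc0 : t varCarry 0 ≠ 0 := fun h =>
        absurd hcond (Expr.eval_eq_ne_zero.2 (by exact h))
      have hv' : v = 2 ^ L := by
        by_contra h
        exact hc0 (hc.2 (lt_of_le_of_ne hv h))
      exact ⟨hH, hv' ▸ hbest⟩
    · have hempty : selected (s₁ arrBest) L = ∅ := by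
        ext i
        simp only [mem_selected, Finset.notMem_empty, iff_false, not_and, not_not]
        exact fun hi => (hz i hi).2
      refine ⟨(h₁.set _ _ (by decide) (by decide) (by decide)).set _ _ (by decide) (by decide)
        (by decide), ?_, ?_, ?_, by positivity⟩
      · refine ⟨?_, ?_, fun v' hv' => by omega⟩
        · rw [Mem.set_of_ne _ _ _ (by decide), Mem.set_of_ne _ _ _ (by decide), hempty]
          intro i hi; simp at hi
        · rw [Mem.set_of_ne _ 0 0 (show arrBest ≠ varCarry by decide),
            Mem.set_of_ne _ _ _ (show arrBest ≠ varMax by decide), hempty]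
          simp [Mem.set_apply]
      · intro i hi
        rw [Mem.set_of_ne _ _ _ (by decide), Mem.set_of_ne _ _ _ (by decide)]
        simpa using (hz i hi).1
      · simp [Mem.set_apply]
  rintro s₂ ⟨h₂, hind, hmax, hall⟩
  refine (wp_out hS hLS (by omega) hf hg h₂).mono ?_
  intro t ht
  refine ⟨selected (s₂ arrBest) L, Finset.filter_subset _ _, hind, fun Y hY hYi => ?_, ?_⟩
  · obtain ⟨v, hv, rfl⟩ := exists_selected_bits L Y hY
    rw [← hmax]
    exact hall v hv hYi
  · rw [ht]
    ext e
    simp [selected]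

end Finish

/-! ### Subgraphs of bounded edge degree contain large matchings -/

/-- Add `d` dummy elements to every set, where `d` is the largest deficiency, attained at `X`.
Hall's condition then holds, and at most `d` vertices are sent to dummies. -/
theorem hall_deficiency {V : Type*} [Fintype V] [DecidableEq V] (t : V → Finset V) :
    ∃ (X I : Finset V) (f : V → V), Set.InjOn f I ∧ (∀ i ∈ I, f i ∈ t i) ∧
      Fintype.card V + (X.biUnion t).card ≤ I.card + X.card := by
  obtain ⟨X, -, hX⟩ := Finset.exists_max_image (Finset.univ : Finset (Finset V))
    (fun Y => (Y.card : ℤ) - (Y.biUnion t).card) ⟨∅, Finset.mem_univ _⟩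
  have h0 : (0 : ℤ) ≤ (X.card : ℤ) - (X.biUnion t).card := by
    simpa using hX ∅ (Finset.mem_univ _)
  obtain ⟨d, hd⟩ := Int.eq_ofNat_of_zero_le h0
  obtain ⟨f, hf, hft⟩ := (Finset.all_card_le_biUnion_card_iff_exists_injective
    (fun i => (t i).disjSum (Finset.univ : Finset (Fin d)))).1 (by
      intro Y
      -- The dummies belong to the union only if `Y` is nonempty.
      rcases Y.eq_empty_or_nonempty with rfl | ⟨y, hy⟩
      · simp
      have hsub : (Y.biUnion t).disjSum (Finset.univ : Finset (Fin d)) ⊆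
          Y.biUnion fun i => (t i).disjSum (Finset.univ : Finset (Fin d)) := by
        intro z hz
        rw [Finset.mem_biUnion]
        rcases z with z | z
        · obtain ⟨i, hi, hz⟩ := Finset.mem_biUnion.1 (Finset.inl_mem_disjSum.1 hz)
          exact ⟨i, hi, Finset.inl_mem_disjSum.2 hz⟩
        · exact ⟨y, hy, Finset.inr_mem_disjSum.2 (Finset.mem_univ _)⟩
      have h1 := Finset.card_le_card hsub
      rw [Finset.card_disjSum, Finset.card_univ, Fintype.card_fin] at h1
      have h2 := hX Y (Finset.mem_univ _)
      omega)
  let I : Finset V := Finset.univ.filter fun i => (f i).isLeft = true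
  have hI : ∀ i ∈ I, ∃ u, f i = Sum.inl u := fun i hi =>
    Sum.isLeft_iff.1 (Finset.mem_filter.1 hi).2
  refine ⟨X, I, fun i => (f i).elim id fun _ => i, ?_, ?_, ?_⟩
  · intro i hi j hj hij
    obtain ⟨u, hu⟩ := hI i hi
    obtain ⟨v, hv⟩ := hI j hj
    apply hf
    simp only [hu, hv, Sum.elim_inl, id] at hij
    rw [hu, hv, hij]
  · intro i hi
    obtain ⟨u, hu⟩ := hI i hi
    have := hft i
    rw [hu, Finset.inl_mem_disjSum] at this
    simpa [hu] using this
  · have hc : (Finset.univ.filter fun i => ¬ (f i).isLeft = true).card ≤ d := by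
      have : ((Finset.univ.filter fun i => ¬ (f i).isLeft = true).image f) ⊆
          (Finset.univ : Finset (Fin d)).image Sum.inr := by
        intro y hy
        obtain ⟨i, hi, rfl⟩ := Finset.mem_image.1 hy
        obtain ⟨k, hk⟩ := Sum.isRight_iff.1 (by simpa using (Finset.mem_filter.1 hi).2)
        exact Finset.mem_image.2 ⟨k, Finset.mem_univ _, hk.symm⟩
      have h1 := Finset.card_le_card this
      rw [Finset.card_image_of_injective _ hf] at h1
      refine h1.trans (Finset.card_image_le.trans ?_)
      simp
    have hsum := Finset.card_filter_add_card_filter_not (s := (Finset.univ : Finset V))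
      (fun i => (f i).isLeft = true)
    rw [Finset.card_univ] at hsum
    simp only [I]
    omega

/-- Let E be the number of related pairs. Summing both degrees over these pairs gives ∑ d² + ∑ e² ≤
B E. The tangents of the square at `a` and `B - a`, the degrees of the biregular extremal case, then
give B E ≤ a²|S| + (B-a)²|T|, and E ≥ a|S| finishes. -/
theorem sum_card_le_of_pair_degree {V : Type*} [DecidableEq V] (S T : Finset V) (h : V → V → Prop)
    [∀ s t, Decidable (h s t)] {a B : ℝ} (ha : 0 < a) (hB : a < B)
    (hpair : ∀ s ∈ S, ∀ t ∈ T, h s t →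
      ((T.filter (h s)).card : ℝ) + ((S.filter fun s' => h s' t).card : ℝ) ≤ B)
    (hsum : a * S.card ≤ ∑ s ∈ S, ((T.filter (h s)).card : ℝ)) :
    a * S.card ≤ (B - a) * T.card := by
  set d : V → ℝ := fun s => ((T.filter (h s)).card : ℝ) with hd
  set e : V → ℝ := fun t => ((S.filter fun s' => h s' t).card : ℝ) with he
  set χ : V → V → ℝ := fun s t => if h s t then 1 else 0 with hχ
  have hdχ : ∀ s, d s = ∑ t ∈ T, χ s t := fun s => by simp [hd, hχ]
  have heχ : ∀ t, e t = ∑ s ∈ S, χ s t := fun t => by simp [he, hχ]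
  set E := ∑ s ∈ S, d s with hE
  have hE' : E = ∑ t ∈ T, e t := by
    simp only [hE, hdχ, heχ]; exact Finset.sum_comm
  have h1 : ∑ s ∈ S, d s ^ 2 + ∑ t ∈ T, e t ^ 2 ≤ B * E := by
    have e1 : ∑ s ∈ S, d s ^ 2 = ∑ s ∈ S, ∑ t ∈ T, χ s t * d s :=
      Finset.sum_congr rfl fun s _ => by rw [← Finset.sum_mul, ← hdχ, sq]
    have e2 : ∑ t ∈ T, e t ^ 2 = ∑ s ∈ S, ∑ t ∈ T, χ s t * e t := by
      rw [Finset.sum_comm]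
      exact Finset.sum_congr rfl fun t _ => by rw [← Finset.sum_mul, ← heχ, sq]
    have e3 : B * E = ∑ s ∈ S, ∑ t ∈ T, χ s t * B := by
      rw [hE, Finset.mul_sum]
      exact Finset.sum_congr rfl fun s _ => by rw [← Finset.sum_mul, ← hdχ, mul_comm]
    rw [e1, e2, e3, ← Finset.sum_add_distrib]
    refine Finset.sum_le_sum fun s hs => ?_
    rw [← Finset.sum_add_distrib]
    refine Finset.sum_le_sum fun t ht => ?_
    by_cases hst : h s t
    · simp only [hχ, hst, if_true, one_mul]
      exact hpair s hs t ht hst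
    · simp [hχ, hst]
  have h2 : 2 * a * E - a ^ 2 * S.card ≤ ∑ s ∈ S, d s ^ 2 := by
    have : ∑ s ∈ S, (2 * a * d s - a ^ 2) ≤ ∑ s ∈ S, d s ^ 2 :=
      Finset.sum_le_sum fun s _ => by nlinarith [sq_nonneg (d s - a)]
    rw [Finset.sum_sub_distrib, ← Finset.mul_sum, Finset.sum_const, nsmul_eq_mul] at this
    linarith
  have h3 : 2 * (B - a) * E - (B - a) ^ 2 * T.card ≤ ∑ t ∈ T, e t ^ 2 := by
    have : ∑ t ∈ T, (2 * (B - a) * e t - (B - a) ^ 2) ≤ ∑ t ∈ T, e t ^ 2 :=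
      Finset.sum_le_sum fun t _ => by nlinarith [sq_nonneg (e t - (B - a))]
    rw [Finset.sum_sub_distrib, ← Finset.mul_sum, Finset.sum_const, nsmul_eq_mul, ← hE'] at this
    linarith
  have h4 : B * (a * S.card) ≤ B * E := mul_le_mul_of_nonneg_left hsum (by linarith)
  have h5 : (B - a) * (a * S.card) ≤ (B - a) * ((B - a) * T.card) := by nlinarith
  exact le_of_mul_le_mul_left h5 (by linarith)

/-- The sign of a side of a bipartition. -/
def boolSign (b : Bool) : ℝ := if b then 1 else -1

/-- The sum over all sign vectors factors into terms 2 cosh c_j ≤ 2 exp(c_j²/2). -/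
theorem sum_exp_sign_le {V : Type*} [Fintype V] [DecidableEq V] (c : V → ℝ) :
    ∑ x : V → Bool, Real.exp (∑ j, c j * boolSign (x j)) ≤
      2 ^ Fintype.card V * Real.exp (∑ j, c j ^ 2 / 2) := by
  have h1 : ∑ x : V → Bool, Real.exp (∑ j, c j * boolSign (x j)) =
      ∏ j : V, ∑ b : Bool, Real.exp (c j * boolSign b) := by
    rw [Finset.prod_univ_sum, Fintype.piFinset_univ]
    exact Finset.sum_congr rfl fun x _ => Real.exp_sum _ _
  have h2 : ∀ j, ∑ b : Bool, Real.exp (c j * boolSign b) ≤ 2 * Real.exp (c j ^ 2 / 2) := fun j => by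
    have := Real.cosh_le_exp_half_sq (c j)
    rw [Real.cosh_eq] at this
    simp only [Fintype.sum_bool, boolSign]
    simp
    linarith
  rw [h1, Real.exp_sum]
  calc _ ≤ ∏ j : V, (2 * Real.exp (c j ^ 2 / 2)) :=
        Finset.prod_le_prod (fun j _ => Finset.sum_nonneg fun _ _ => (Real.exp_pos _).le)
          fun j _ => h2 j
    _ = _ := by rw [Finset.prod_mul_distrib, Finset.prod_const, Finset.card_univ]

/-- Chernoff bound: every vertex gets a fair coin, except that `b i` takes the opposite of the coin
of `a i`. The union bound over all vertices and both tails leaves a good outcome. -/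
theorem exists_balanced_bipartition {V ι : Type*} [Fintype V] [DecidableEq V] (a b : ι → V)
    (ha : Function.Injective a) (hb : Function.Injective b) (hab : ∀ i j, a i ≠ b j)
    (N : V → Finset V) {β R : ℝ} (hβ : 0 < β) (hR0 : 0 ≤ R) (hN : ∀ v, ((N v).card : ℝ) ≤ β)
    (hR : 2 * (Fintype.card V : ℝ) < Real.exp (R ^ 2 / (4 * β))) :
    ∃ side : V → Bool, (∀ i, side (a i) = !side (b i)) ∧
      ∀ v, |∑ u ∈ N v, boolSign (side u)| ≤ R := by
  classical
  -- `p v` is the vertex whose coin decides the side of `v`; the coins of the `b i` themselves are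
  -- ignored.
  let p : V → V := fun v => if h : ∃ i, b i = v then a h.choose else v
  let neg : V → Bool := fun v => decide (∃ i, b i = v)
  have hpb : ∀ i, p (b i) = a i := fun i => by
    have h : ∃ j, b j = b i := ⟨i, rfl⟩
    have : p (b i) = a h.choose := dif_pos h
    rw [this, hb h.choose_spec]
  have hpa : ∀ v, (¬ ∃ i, b i = v) → p v = v := fun v hv => dif_neg hv
  let side : (V → Bool) → V → Bool := fun x v => xor (neg v) (x (p v))
  have hside : ∀ x i, side x (a i) = !side x (b i) := fun x i => by
    have h1 : neg (a i) = false := by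
      simp only [neg, decide_eq_false_iff_not]
      rintro ⟨j, hj⟩; exact hab i j hj.symm
    have h2 : neg (b i) = true := by simp [neg]
    have h3 : p (a i) = a i := hpa _ (by rintro ⟨j, hj⟩; exact hab i j hj.symm)
    simp [side, h1, h2, h3, hpb]
  have hfib : ∀ (Y : Finset V) j, (Y.filter fun u => p u = j).card ≤ 2 := by
    intro Y j
    by_cases hj : ∃ i, a i = j
    · obtain ⟨i, rfl⟩ := hj
      refine (Finset.card_le_card (t := {a i, b i}) fun u hu => ?_).trans Finset.card_le_two
      have hu := (Finset.mem_filter.1 hu).2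
      by_cases h : ∃ k, b k = u
      · obtain ⟨k, rfl⟩ := h
        rw [hpb] at hu
        rw [ha hu]; simp
      · rw [hpa u h] at hu
        simp [hu]
    · refine (Finset.card_le_card (t := {j}) fun u hu => ?_).trans (by simp)
      have hu := (Finset.mem_filter.1 hu).2
      by_cases h : ∃ k, b k = u
      · obtain ⟨k, rfl⟩ := h
        rw [hpb] at hu
        exact absurd ⟨k, hu⟩ hj
      · rw [hpa u h] at hu
        simp [hu]
  let ε : V → ℝ := fun u => if neg u then -1 else 1
  have hε : ∀ u, |ε u| = 1 := fun u => by
    simp only [ε]; split_ifs <;> simp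
  have hsign : ∀ x u, boolSign (side x u) = ε u * boolSign (x (p u)) := fun x u => by
    have h : ∀ y z : Bool, (if xor y z = true then (1 : ℝ) else -1) =
        (if y = true then -1 else 1) * (if z = true then 1 else -1) := by
      rintro (_ | _) (_ | _) <;> simp
    exact h _ _
  let c : V → V → ℝ := fun v j => ∑ u ∈ N v with p u = j, ε u
  have hY : ∀ x v, ∑ u ∈ N v, boolSign (side x u) = ∑ j, c v j * boolSign (x j) := fun x v => by
    rw [← Finset.sum_fiberwise (N v) p]
    refine Finset.sum_congr rfl fun j _ => ?_
    simp only [c]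
    rw [Finset.sum_mul]
    exact Finset.sum_congr rfl fun u hu => by rw [hsign, (Finset.mem_filter.1 hu).2]
  -- A coin governs at most two vertices, so each squared coefficient is at most twice its fibre,
  -- and the fibres partition `N v`.
  have hc : ∀ v, ∑ j, c v j ^ 2 ≤ 2 * β := fun v => by
    have h1 : ∀ j, c v j ^ 2 ≤ 2 * (((N v).filter fun u => p u = j).card : ℝ) := fun j => by
      have h2 : |c v j| ≤ (((N v).filter fun u => p u = j).card : ℝ) := by
        refine (Finset.abs_sum_le_sum_abs _ _).trans ?_
        simp [hε]
      have h3 : (((N v).filter fun u => p u = j).card : ℝ) ≤ 2 := by exact_mod_cast hfib (N v) j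
      rw [← sq_abs]
      nlinarith [abs_nonneg (c v j)]
    calc ∑ j, c v j ^ 2 ≤ ∑ j, 2 * (((N v).filter fun u => p u = j).card : ℝ) :=
          Finset.sum_le_sum fun j _ => h1 j
      _ = 2 * ((N v).card : ℝ) := by
          rw [← Finset.mul_sum, Finset.card_eq_sum_card_fiberwise (f := p) (t := Finset.univ)
            (fun _ _ => by simp)]
          push_cast; rfl
      _ ≤ 2 * β := by linarith [hN v]
  have key : ∀ (τ : ℝ) v, ∑ x : V → Bool, Real.exp (τ * ∑ u ∈ N v, boolSign (side x u)) ≤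
      2 ^ Fintype.card V * Real.exp (τ ^ 2 * β) := fun τ v => by
    have h1 : ∀ x : V → Bool, τ * ∑ u ∈ N v, boolSign (side x u) =
        ∑ j, (τ * c v j) * boolSign (x j) := fun x => by
      rw [hY, Finset.mul_sum]
      exact Finset.sum_congr rfl fun j _ => by ring
    simp only [h1]
    refine (sum_exp_sign_le _).trans ?_
    refine mul_le_mul_of_nonneg_left (Real.exp_le_exp.2 ?_) (by positivity)
    have : ∑ j, (τ * c v j) ^ 2 / 2 = τ ^ 2 / 2 * ∑ j, c v j ^ 2 := by
      rw [Finset.mul_sum]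
      exact Finset.sum_congr rfl fun j _ => by ring
    rw [this]
    nlinarith [hc v, sq_nonneg τ]
  by_contra hcon
  push Not at hcon
  have hbad : ∀ x, ∃ v, R < |∑ u ∈ N v, boolSign (side x u)| := fun x => hcon (side x) (hside x)
  -- Minimizes the exponent τ²β - τR, with minimum -R²/(4β).
  set τ := R / (2 * β) with hτ
  have hτ0 : 0 ≤ τ := by positivity
  have hlow : ∀ x : V → Bool, Real.exp (τ * R) ≤
      ∑ v, (Real.exp (τ * ∑ u ∈ N v, boolSign (side x u)) +
        Real.exp (-τ * ∑ u ∈ N v, boolSign (side x u))) := fun x => by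
    obtain ⟨v, hv⟩ := hbad x
    refine le_trans ?_ (Finset.single_le_sum (fun v _ => by positivity) (Finset.mem_univ v))
    rcases lt_abs.1 hv with h | h
    · have : Real.exp (τ * R) ≤ Real.exp (τ * ∑ u ∈ N v, boolSign (side x u)) :=
        Real.exp_le_exp.2 (mul_le_mul_of_nonneg_left h.le hτ0)
      linarith [Real.exp_pos (-τ * ∑ u ∈ N v, boolSign (side x u))]
    · have : Real.exp (τ * R) ≤ Real.exp (-τ * ∑ u ∈ N v, boolSign (side x u)) :=
        Real.exp_le_exp.2 (by nlinarith)
      linarith [Real.exp_pos (τ * ∑ u ∈ N v, boolSign (side x u))]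
  have hup : (2 : ℝ) ^ Fintype.card V * Real.exp (τ * R) ≤
      Fintype.card V * (2 * (2 ^ Fintype.card V * Real.exp (τ ^ 2 * β))) := by
    calc (2 : ℝ) ^ Fintype.card V * Real.exp (τ * R) = ∑ x : V → Bool, Real.exp (τ * R) := by
          simp
      _ ≤ _ := Finset.sum_le_sum fun x _ => hlow x
      _ = ∑ v, (∑ x : V → Bool, Real.exp (τ * ∑ u ∈ N v, boolSign (side x u)) +
            ∑ x : V → Bool, Real.exp (-τ * ∑ u ∈ N v, boolSign (side x u))) := by
          rw [Finset.sum_comm]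
          exact Finset.sum_congr rfl fun v _ => Finset.sum_add_distrib
      _ ≤ ∑ v : V, (2 * (2 ^ Fintype.card V * Real.exp (τ ^ 2 * β))) :=
          Finset.sum_le_sum fun v _ => by
            have h1 := key τ v
            have h2 := key (-τ) v
            rw [neg_sq] at h2
            linarith
      _ = _ := by simp
  have e1 : τ * R = R ^ 2 / (4 * β) + R ^ 2 / (4 * β) := by
    rw [hτ]; field_simp; ring
  have e2 : τ ^ 2 * β = R ^ 2 / (4 * β) := by
    rw [hτ]; field_simp; ring
  rw [e1, e2, Real.exp_add] at hup
  have hpos := mul_pos (pow_pos (two_pos : (0 : ℝ) < 2) (Fintype.card V))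
    (Real.exp_pos (R ^ 2 / (4 * β)))
  nlinarith

/-- If `H` has edge degrees at most `β` and `W ⊇ H` contains all edges `a i, b i` of a matching that
have edge degree less than `θ`, where `θ` is almost `β`, then `W` contains a matching of three
fifths of the size. -/
theorem exists_matching_of_bounded_edge_degree {V ι : Type*} [Fintype V] [DecidableEq V] [Fintype ι]
    (H W : SimpleGraph V) [DecidableRel H.Adj] (hHW : H ≤ W) (a b : ι → V)
    (ha : Function.Injective a) (hb : Function.Injective b) (hab : ∀ i j, a i ≠ b j)
    {β θ R : ℝ} (hβ : 0 < β) (hR0 : 0 ≤ R)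
    (hdeg : ∀ u v, H.Adj u v → (H.degree u : ℝ) + H.degree v ≤ β)
    (hlow : ∀ i, ¬ W.Adj (a i) (b i) → θ ≤ (H.degree (a i) : ℝ) + H.degree (b i))
    (hR : 2 * (Fintype.card V : ℝ) < Real.exp (R ^ 2 / (4 * β)))
    (hθβ : θ ≤ β) (hθR : 0 < θ - 2 * R) (hρ : 6 * (β + 2 * R) ≤ 7 * (θ - 2 * R)) :
    ∃ M : Finset (Sym2 V), IsMatching W M ∧ 3 * Fintype.card ι ≤ 5 * M.card := by
  classical
  -- A vertex is isolated, or it lies on an edge and its degree is part of an edge degree at most β.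
  have hN : ∀ v, ((H.neighborFinset v).card : ℝ) ≤ β := fun v => by
    rw [H.card_neighborFinset_eq_degree]
    by_cases hv : ∃ u, H.Adj v u
    · obtain ⟨u, hu⟩ := hv
      have := hdeg v u hu
      have h0 : (0 : ℝ) ≤ H.degree u := by positivity
      linarith
    · have : H.degree v = 0 := by
        rw [← H.card_neighborFinset_eq_degree, Finset.card_eq_zero]
        ext u
        simp only [SimpleGraph.mem_neighborFinset, Finset.notMem_empty, iff_false]
        exact fun h => hv ⟨u, h⟩
      rw [this]; simpa using hβ.le
  obtain ⟨side, hside, hbal⟩ := exists_balanced_bipartition a b ha hb hab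
    (fun v => H.neighborFinset v) hβ hR0 hN hR
  set h : V → V → Prop := fun u v => H.Adj u v ∧ side u ≠ side v with hh
  have hsymm : ∀ {u v}, h u v → h v u := fun ⟨h1, h2⟩ => ⟨h1.symm, h2.symm⟩
  set d : V → ℝ := fun u => ((Finset.univ.filter (h u)).card : ℝ) with hd
  -- Multiplied by the sign of `u`, the neighbourhood sum is the number of neighbours on the same
  -- side minus the number of those across.
  have hdd : ∀ u, |2 * d u - H.degree u| ≤ R := fun u => by
    have h1 : ∑ w ∈ H.neighborFinset u, boolSign (side u) * boolSign (side w) =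
        H.degree u - 2 * d u := by
      have h2 : ∀ w, boolSign (side u) * boolSign (side w) =
          1 - 2 * (if side u ≠ side w then 1 else 0) := fun w => by
        unfold boolSign
        cases side u <;> cases side w <;> norm_num
      simp only [h2]
      rw [Finset.sum_sub_distrib, ← Finset.mul_sum, Finset.sum_boole]
      have h3 : (H.neighborFinset u).filter (fun w => side u ≠ side w) =
          Finset.univ.filter (h u) := by
        ext w; simp [hh]
      rw [h3]
      simp [hd]
    rw [← Finset.mul_sum] at h1
    rw [abs_sub_comm, ← h1, abs_mul]
    have h4 : |boolSign (side u)| = 1 := by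
      unfold boolSign; split_ifs <;> simp
    rw [h4, one_mul]
    exact hbal u
  -- Hall is applied to all vertices, those on the `false` side with empty sets; `I` and `f` then
  -- form a matching of `W` across the bipartition.
  obtain ⟨X, I, f, hfI, hft, hcount⟩ := hall_deficiency
    (fun v => Finset.univ.filter fun u => side v = true ∧ side u = false ∧ W.Adj v u)
  have hIW : ∀ v ∈ I, side v = true ∧ side (f v) = false ∧ W.Adj v (f v) := fun v hv => by
    simpa using hft v hv
  set N := X.biUnion fun v => Finset.univ.filter fun u =>
    side v = true ∧ side u = false ∧ W.Adj v u with hNdef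
  have hNmem : ∀ u, u ∈ N ↔ ∃ v ∈ X, side v = true ∧ side u = false ∧ W.Adj v u := fun u => by
    simp [hNdef]
  -- `l i` is the end of the pair on the `true` side, `r i` the end on the `false` side.
  let l : ι → V := fun i => if side (a i) then a i else b i
  let r : ι → V := fun i => if side (a i) then b i else a i
  have hl : ∀ i, side (l i) = true := fun i => by
    simp only [l]; have := hside i
    split_ifs with h
    · exact h
    · simpa [h] using this.symm
  have hr : ∀ i, side (r i) = false := fun i => by
    simp only [r]; have := hside i
    split_ifs with h
    · simpa [h] using this.symm
    · simpa using h
  have hlinj : Function.Injective l := fun i j hij => by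
    simp only [l] at hij
    split_ifs at hij with h1 h2 h2
    · exact ha hij
    · exact absurd hij (hab _ _)
    · exact absurd hij.symm (hab _ _)
    · exact hb hij
  have hrinj : Function.Injective r := fun i j hij => by
    simp only [r] at hij
    split_ifs at hij with h1 h2 h2
    · exact hb hij
    · exact absurd hij.symm (hab _ _)
    · exact absurd hij (hab _ _)
    · exact ha hij
  have hlr : ∀ i, ¬ W.Adj (l i) (r i) → θ ≤ (H.degree (l i) : ℝ) + H.degree (r i) := fun i hi => by
    have : (l i = a i ∧ r i = b i) ∨ (l i = b i ∧ r i = a i) := by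
      simp only [l, r]; split_ifs <;> simp
    rcases this with ⟨h1, h2⟩ | ⟨h1, h2⟩
    · rw [h1, h2] at hi ⊢; exact hlow i hi
    · rw [h1, h2] at hi ⊢; rw [add_comm]; exact hlow i fun hw => hi hw.symm
  -- As in König's theorem, `A ∪ N` covers the crossing edges of `W` and is no larger than `I`. `P`
  -- consists of the pairs without an end in the cover, none of which is an edge of `W`.
  let P : Finset ι := Finset.univ.filter fun i => l i ∈ X ∧ r i ∉ N
  let A : Finset V := Finset.univ.filter fun v => side v = true ∧ v ∉ X
  have hPcard : Fintype.card ι ≤ P.card + (A ∪ N).card := by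
    have h1 : (Finset.univ.filter fun i => ¬ (l i ∈ X ∧ r i ∉ N)).card ≤ (A ∪ N).card := by
      refine Finset.card_le_card_of_injOn (fun i => if l i ∈ X then r i else l i) ?_ ?_
      · intro i hi
        simp only [Finset.coe_filter, Finset.mem_univ, true_and, Set.mem_ofPred_eq, not_and,
          not_not] at hi
        rw [Finset.mem_coe, Finset.mem_union]
        dsimp only
        split_ifs with h
        · exact Or.inr (hi h)
        · exact Or.inl (Finset.mem_filter.2 ⟨Finset.mem_univ _, hl i, h⟩)
      · intro i _ j _ hij
        dsimp only at hij
        split_ifs at hij with h1 h2 h2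
        · exact hrinj hij
        · have := hr i; rw [hij, hl j] at this; simp at this
        · have := hl i; rw [hij, hr j] at this; simp at this
        · exact hlinj hij
    have h2 := Finset.card_filter_add_card_filter_not (s := (Finset.univ : Finset ι))
      (fun i => l i ∈ X ∧ r i ∉ N)
    rw [Finset.card_univ] at h2
    simp only [P]
    omega
  have hTcard : (A ∪ N).card ≤ I.card := by
    have h1 := Finset.card_union_le A N
    have h2 : A.card + X.card ≤ Fintype.card V := by
      rw [← Finset.card_union_of_disjoint]
      · exact Finset.card_le_univ _
      · rw [Finset.disjoint_left]
        intro v hv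
        exact (Finset.mem_filter.1 hv).2.2
    omega
  -- An uncovered vertex has all its crossing neighbours in the cover.
  have hTadj : ∀ i ∈ P, ∀ s, (s = l i ∨ s = r i) → ∀ t, h s t → t ∈ A ∪ N := by
    intro i hi s hs t hst
    obtain ⟨hiX, hiN⟩ := (Finset.mem_filter.1 hi).2
    rw [Finset.mem_union]
    rcases hs with rfl | rfl
    · refine Or.inr ((hNmem t).2 ⟨l i, hiX, hl i, ?_, hHW hst.1⟩)
      have := hst.2; rw [hl i] at this
      simpa using this.symm
    · have ht : side t = true := by
        have := hst.2; rw [hr i] at this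
        simpa using this.symm
      refine Or.inl (Finset.mem_filter.2 ⟨Finset.mem_univ _, ht, fun htX => ?_⟩)
      exact hiN ((hNmem _).2 ⟨t, htX, ht, hr i, (hHW hst.1).symm⟩)
  let Sset : Finset V := P.image l ∪ P.image r
  have hdisj : Disjoint (P.image l) (P.image r) := by
    rw [Finset.disjoint_left]
    rintro v hv hv'
    obtain ⟨i, _, rfl⟩ := Finset.mem_image.1 hv
    obtain ⟨j, _, hj⟩ := Finset.mem_image.1 hv'
    have := hl i; rw [← hj, hr j] at this; simp at this
  have hScard : (Sset.card : ℝ) = 2 * P.card := by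
    simp only [Sset]
    rw [Finset.card_union_of_disjoint hdisj, Finset.card_image_of_injective _ hlinj,
      Finset.card_image_of_injective _ hrinj]
    push_cast; ring
  have hSmem : ∀ s ∈ Sset, ∃ i ∈ P, s = l i ∨ s = r i := fun s hs => by
    rcases Finset.mem_union.1 hs with hs | hs
    · obtain ⟨i, hi, rfl⟩ := Finset.mem_image.1 hs; exact ⟨i, hi, Or.inl rfl⟩
    · obtain ⟨i, hi, rfl⟩ := Finset.mem_image.1 hs; exact ⟨i, hi, Or.inr rfl⟩
  have hSd : ∀ s ∈ Sset, (((A ∪ N).filter (h s)).card : ℝ) = d s := fun s hs => by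
    obtain ⟨i, hi, his⟩ := hSmem s hs
    have : (A ∪ N).filter (h s) = Finset.univ.filter (h s) := by
      ext t
      simp only [Finset.mem_filter, Finset.mem_univ, true_and, and_iff_right_iff_imp]
      exact hTadj i hi s his t
    rw [this]
  -- Crossing degrees are half the degrees of `H` up to `R / 2`: they sum to at least `(θ - 2 * R) /
  -- 2` over a pair of `P`, and to at most `(β + 2 * R) / 2` over a crossing edge.
  have hmain := sum_card_le_of_pair_degree Sset (A ∪ N) h (a := (θ - 2 * R) / 4)
    (B := (β + 2 * R) / 2) (by linarith) (by linarith) (by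
      intro s hs t ht hst
      rw [hSd s hs]
      have h1 : ((Sset.filter fun s' => h s' t).card : ℝ) ≤ d t := by
        have : (Sset.filter fun s' => h s' t) ⊆ Finset.univ.filter (h t) := fun s' hs' =>
          Finset.mem_filter.2 ⟨Finset.mem_univ _, hsymm (Finset.mem_filter.1 hs').2⟩
        exact Nat.cast_le.2 (Finset.card_le_card this)
      have h2 := (abs_le.1 (hdd s)).2
      have h3 := (abs_le.1 (hdd t)).2
      have h4 := hdeg s t hst.1
      linarith) (by
      rw [Finset.sum_congr rfl hSd, hScard]
      simp only [Sset]
      rw [Finset.sum_union hdisj, Finset.sum_image fun _ _ _ _ h => hlinj h,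
        Finset.sum_image fun _ _ _ _ h => hrinj h, ← Finset.sum_add_distrib]
      have : ∑ i ∈ P, (θ - 2 * R) / 2 ≤ ∑ i ∈ P, (d (l i) + d (r i)) := by
        refine Finset.sum_le_sum fun i hi => ?_
        obtain ⟨hiX, hiN⟩ := (Finset.mem_filter.1 hi).2
        have h1 := hlr i fun hw => hiN ((hNmem _).2 ⟨l i, hiX, hl i, hr i, hw⟩)
        have h2 := (abs_le.1 (hdd (l i))).1
        have h3 := (abs_le.1 (hdd (r i))).1
        linarith
      rw [Finset.sum_const, nsmul_eq_mul] at this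
      linarith)
  rw [hScard] at hmain
  -- By `hρ`, `B - a ≤ (θ - 2 * R) / 3`, and the set of ends has `2 * P.card` elements. In the limit
  -- θ = β, R = 0 the factor 2/3 would be 1/2.
  have h3P : 3 * P.card ≤ 2 * (A ∪ N).card := by
    have h1 : (0 : ℝ) ≤ ((A ∪ N).card : ℝ) := by positivity
    have h2 : (θ - 2 * R) * (3 * (P.card : ℝ)) ≤ (θ - 2 * R) * (2 * ((A ∪ N).card : ℝ)) := by
      nlinarith
    exact_mod_cast le_of_mul_le_mul_left h2 hθR
  have hfne : ∀ v ∈ I, ∀ u ∈ I, v ≠ f u := fun v hv u hu huv => by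
    have h1 := (hIW v hv).1
    rw [huv, (hIW u hu).2.1] at h1
    simp at h1
  have hinj : Set.InjOn (fun v => s(v, f v)) (I : Set V) := by
    intro v hv u hu huv
    rcases Sym2.eq_iff.1 huv with ⟨h1, _⟩ | ⟨h1, _⟩
    · exact h1
    · exact absurd h1 (hfne v hv u hu)
  refine ⟨I.image fun v => s(v, f v), ⟨?_, ?_⟩, ?_⟩
  · intro e he
    obtain ⟨v, hv, rfl⟩ := Finset.mem_image.1 he
    exact (hIW v hv).2.2
  · intro e he e' he' w hw hw'
    obtain ⟨v, hv, rfl⟩ := Finset.mem_image.1 he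
    obtain ⟨u, hu, rfl⟩ := Finset.mem_image.1 he'
    have : v = u := by
      rcases Sym2.mem_iff.1 hw with rfl | rfl <;> rcases Sym2.mem_iff.1 hw' with h | h
      · exact h
      · exact absurd h (hfne _ hv _ hu)
      · exact absurd h.symm (hfne _ hu _ hv)
      · exact hfI hv hu h
    rw [this]
  · rw [Finset.card_image_of_injOn hinj]
    omega

/-! ### Uniformly random orders -/

section RandomOrder

variable {E : Type*} [Fintype E] [DecidableEq E] {m : ℕ}

open Classical in
/-- The number of orders of `E` with property `P`. -/
noncomputable def orderCount (P : (Fin m ≃ E) → Prop) : ℕ := (Finset.univ.filter P).card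

theorem orderCount_eq (P : (Fin m ≃ E) → Prop) [DecidablePred P] :
    orderCount P = (Finset.univ.filter P).card := by
  unfold orderCount; congr

theorem orderCount_eq_zero {P : (Fin m ≃ E) → Prop} (h : ∀ σ, ¬ P σ) : orderCount P = 0 := by
  simp [orderCount, h]

theorem orderCount_mono {P Q : (Fin m ≃ E) → Prop} (h : ∀ σ, P σ → Q σ) :
    orderCount P ≤ orderCount Q := by
  classical
  exact Finset.card_le_card fun σ hσ => by
    simp only [Finset.mem_filter, Finset.mem_univ, true_and] at hσ ⊢
    exact h σ hσ

theorem orderCount_le_sum {κ : Type*} (s : Finset κ) {P : (Fin m ≃ E) → Prop}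
    (Q : κ → (Fin m ≃ E) → Prop) (h : ∀ σ, P σ → ∃ k ∈ s, Q k σ) :
    orderCount P ≤ ∑ k ∈ s, orderCount (Q k) := by
  classical
  refine (Finset.card_le_card (t := s.biUnion fun k => Finset.univ.filter (Q k))
    fun σ hσ => ?_).trans Finset.card_biUnion_le
  simp only [Finset.mem_filter, Finset.mem_univ, true_and, Finset.mem_biUnion] at hσ ⊢
  exact h σ hσ

/-- The property of an order that a set `Q`, which is determined by the first `s` elements, has at
least `T` elements, but none of the first `t` elements is in `Q`. -/
def AvoidsLarge (Q : (Fin m ≃ E) → Finset E) (T t : ℕ) (σ : Fin m ≃ E) : Prop :=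
  T ≤ (Q σ).card ∧ ∀ j : Fin m, (j : ℕ) < t → σ j ∉ Q σ

/-- Given the first `t` entries, all of the at least `T` elements of `Q` are still to come, so
position `t` hits `Q` with probability at least `T / m`. To count this, exchange an element of `Q`
with the entry at position `t`; the first `s` entries stay, hence so does `Q`. -/
theorem orderCount_avoidsLarge_succ {Q : (Fin m ≃ E) → Finset E} {s : ℕ}
    (hQ : ∀ σ σ' : Fin m ≃ E, (∀ i : Fin m, (i : ℕ) < s → σ i = σ' i) → Q σ = Q σ') (T : ℕ) {t : ℕ}
    (hst : s ≤ t) (ht : t < m) :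
    m * orderCount (AvoidsLarge Q T (t + 1)) + T * orderCount (AvoidsLarge Q T t) ≤
      m * orderCount (AvoidsLarge Q T t) := by
  classical
  let p : Fin m := ⟨t, ht⟩
  have hsplit : orderCount (AvoidsLarge Q T t) = orderCount (AvoidsLarge Q T (t + 1)) +
      orderCount (fun σ => AvoidsLarge Q T t σ ∧ σ p ∈ Q σ) := by
    rw [orderCount_eq, orderCount_eq, orderCount_eq,
      ← Finset.card_filter_add_card_filter_not (s := Finset.univ.filter (AvoidsLarge Q T t))
      (fun σ => σ p ∉ Q σ), Finset.filter_filter, Finset.filter_filter]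
    congr 2
    · ext σ
      rw [Finset.mem_filter, Finset.mem_filter]
      simp only [Finset.mem_univ, true_and, AvoidsLarge]
      constructor
      · rintro ⟨⟨h1, h2⟩, h3⟩
        refine ⟨h1, fun j hj => ?_⟩
        rcases Nat.lt_succ_iff_lt_or_eq.1 hj with h | h
        · exact h2 j h
        · rw [show j = p from Fin.ext h]; exact h3
      · rintro ⟨h1, h2⟩
        exact ⟨⟨h1, fun j hj => h2 j (by omega)⟩, h2 p (by simp [p])⟩
    · ext σ
      simp
  have hinj : T * orderCount (AvoidsLarge Q T t) ≤
      m * orderCount (fun σ => AvoidsLarge Q T t σ ∧ σ p ∈ Q σ) := by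
    rw [orderCount_eq, orderCount_eq]
    have h1 : T * (Finset.univ.filter (AvoidsLarge Q T t)).card ≤
        ((Finset.univ.filter (AvoidsLarge Q T t)).sigma fun σ => Q σ).card := by
      rw [Finset.card_sigma, mul_comm, ← smul_eq_mul]
      refine Finset.card_nsmul_le_sum _ _ _ fun σ hσ => ?_
      exact (Finset.mem_filter.1 hσ).2.1
    refine h1.trans ?_
    have h2 : (((Finset.univ : Finset (Fin m)) ×ˢ Finset.univ.filter
        fun σ => AvoidsLarge Q T t σ ∧ σ p ∈ Q σ)).card =
        m * (Finset.univ.filter fun σ => AvoidsLarge Q T t σ ∧ σ p ∈ Q σ).card := by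
      rw [Finset.card_product, Finset.card_univ, Fintype.card_fin]
    rw [← h2]
    -- The old position of `e` is recorded, so the exchange can be undone.
    refine Finset.card_le_card_of_injOn
      (fun x => (x.1.symm x.2, (Equiv.swap p (x.1.symm x.2)).trans x.1)) ?_ ?_
    · rintro ⟨σ, e⟩ hx
      simp only [Finset.coe_sigma, Set.mem_sigma_iff, Finset.mem_coe, Finset.mem_filter,
        Finset.mem_univ, true_and] at hx
      obtain ⟨⟨hT, hav⟩, he⟩ := hx
      simp only [Finset.mem_coe, Finset.mem_product, Finset.mem_univ, Finset.mem_filter, true_and]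
      have hj : t ≤ (σ.symm e : ℕ) := by
        by_contra hlt
        exact hav (σ.symm e) (not_le.1 hlt) (by simpa using he)
      have hfix : ∀ i : Fin m, (i : ℕ) < t → Equiv.swap p (σ.symm e) i = i := fun i hi =>
        Equiv.swap_apply_of_ne_of_ne (fun h => by rw [h] at hi; simp [p] at hi)
          (fun h => by rw [h] at hi; omega)
      have hQ' : Q ((Equiv.swap p (σ.symm e)).trans σ) = Q σ :=
        hQ _ _ fun i hi => by simp [hfix i (by omega)]
      refine ⟨⟨by rw [hQ']; exact hT, fun j hj => ?_⟩, ?_⟩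
      · rw [hQ', Equiv.trans_apply, hfix j hj]; exact hav j hj
      · rw [hQ']; simpa using he
    · rintro ⟨σ, e⟩ _ ⟨σ', e'⟩ _ h
      simp only [Prod.mk.injEq] at h
      obtain ⟨h1, h2⟩ := h
      rw [← h1] at h2
      have h3 : σ = σ' := by
        ext i
        have := congrArg (fun τ : Fin m ≃ E => τ (Equiv.swap p (σ.symm e) i)) h2
        simpa using this
      subst h3
      have h4 : e = e' := σ.symm.injective h1
      subst h4
      rfl
  calc _ ≤ m * orderCount (AvoidsLarge Q T (t + 1)) +
        m * orderCount (fun σ => AvoidsLarge Q T t σ ∧ σ p ∈ Q σ) := Nat.add_le_add_left hinj _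
    _ = _ := by rw [← mul_add, ← hsplit]

/-- Each of the `r` positions costs a factor 1 - T/m ≤ exp(-T/m). -/
theorem orderCount_avoidsLarge_le {Q : (Fin m ≃ E) → Finset E} {s : ℕ}
    (hQ : ∀ σ σ' : Fin m ≃ E, (∀ i : Fin m, (i : ℕ) < s → σ i = σ' i) → Q σ = Q σ') (T : ℕ) (r : ℕ)
    (hr : s + r ≤ m) :
    (orderCount (AvoidsLarge Q T (s + r)) : ℝ) ≤
      Real.exp (-(T * r / m : ℝ)) * Fintype.card (Fin m ≃ E) := by
  classical
  induction r with
  | zero =>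
    simp only [orderCount]
    simpa using Finset.card_le_univ (Finset.univ.filter (AvoidsLarge Q T s))
  | succ r ih =>
    have hm : (0 : ℝ) < m := by
      have : 0 < m := by omega
      exact_mod_cast this
    have h1 := orderCount_avoidsLarge_succ hQ T (t := s + r) (by omega) (by omega)
    have h1' : (m : ℝ) * orderCount (AvoidsLarge Q T (s + r + 1)) +
        T * orderCount (AvoidsLarge Q T (s + r)) ≤ m * orderCount (AvoidsLarge Q T (s + r)) := by
      exact_mod_cast h1
    have h2 : (orderCount (AvoidsLarge Q T (s + r + 1)) : ℝ) ≤
        (1 - T / m) * orderCount (AvoidsLarge Q T (s + r)) := by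
      rw [sub_mul, one_mul, div_mul_eq_mul_div, le_sub_iff_add_le, ← mul_le_mul_iff_right₀ hm]
      rw [mul_add, mul_div_cancel₀ _ hm.ne']
      exact h1'
    have h3 : (1 : ℝ) - T / m ≤ Real.exp (-(T / m)) := by
      have := Real.add_one_le_exp (-(T / m : ℝ))
      linarith
    calc (orderCount (AvoidsLarge Q T (s + (r + 1))) : ℝ) ≤
          (1 - T / m) * orderCount (AvoidsLarge Q T (s + r)) := h2
      _ ≤ Real.exp (-(T / m)) * (Real.exp (-(T * r / m : ℝ)) * Fintype.card (Fin m ≃ E)) :=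
          mul_le_mul h3 (ih (by omega)) (by positivity) (Real.exp_pos _).le
      _ = _ := by
          rw [← mul_assoc, ← Real.exp_add]
          congr 2
          push_cast; ring

/-- Exchanging `x` with an arbitrary position keeps the other elements of `X` in the prefix, because
a displaced element lands on the old position of `x`, which is below `p`. So every element costs a
factor p/m. -/
theorem orderCount_subset_prefix (X : Finset E) (p : ℕ) :
    m ^ X.card * orderCount (fun σ : Fin m ≃ E => ∀ e ∈ X, (σ.symm e : ℕ) < p) ≤
      p ^ X.card * Fintype.card (Fin m ≃ E) := by
  classical
  induction X using Finset.induction_on with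
  | empty => simp [orderCount]
  | insert x X hx ih =>
    have hstep : m * orderCount (fun σ : Fin m ≃ E => ∀ e ∈ insert x X, (σ.symm e : ℕ) < p) ≤
        p * orderCount (fun σ : Fin m ≃ E => ∀ e ∈ X, (σ.symm e : ℕ) < p) := by
      rw [orderCount_eq, orderCount_eq]
      have hcard : (Finset.univ.filter fun i : Fin m => (i : ℕ) < p).card ≤ p := by
        have h := Finset.card_le_card_of_injOn (s := Finset.univ.filter
          fun i : Fin m => (i : ℕ) < p) (t := Finset.range p) (fun i => (i : ℕ))
          (fun i hi => by
            simp only [Finset.coe_filter, Finset.mem_univ, true_and, Set.mem_ofPred_eq] at hi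
            simpa using hi)
          (fun i _ j _ h => Fin.ext h)
        simpa using h
      calc m * (Finset.univ.filter fun σ : Fin m ≃ E =>
              ∀ e ∈ insert x X, (σ.symm e : ℕ) < p).card
          = ((Finset.univ : Finset (Fin m)) ×ˢ Finset.univ.filter fun σ : Fin m ≃ E =>
              ∀ e ∈ insert x X, (σ.symm e : ℕ) < p).card := by
            rw [Finset.card_product, Finset.card_univ, Fintype.card_fin]
        _ ≤ ((Finset.univ.filter fun i : Fin m => (i : ℕ) < p) ×ˢ
              Finset.univ.filter fun σ : Fin m ≃ E => ∀ e ∈ X, (σ.symm e : ℕ) < p).card := by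
            refine Finset.card_le_card_of_injOn
              (fun y => (y.2.symm x, (Equiv.swap (y.2.symm x) y.1).trans y.2)) ?_ ?_
            · rintro ⟨q, σ⟩ hy
              simp only [Finset.mem_coe, Finset.mem_product, Finset.mem_univ, Finset.mem_filter,
                true_and] at hy ⊢
              refine ⟨hy x (Finset.mem_insert_self _ _), fun e he => ?_⟩
              have he' := hy e (Finset.mem_insert_of_mem he)
              have hxp := hy x (Finset.mem_insert_self _ _)
              have hne : σ.symm e ≠ σ.symm x := fun h => hx (σ.symm.injective h ▸ he)
              rw [Equiv.symm_trans_apply, Equiv.symm_swap]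
              by_cases h : σ.symm e = q
              · rw [h, Equiv.swap_apply_right]; exact hxp
              · rw [Equiv.swap_apply_of_ne_of_ne hne h]; exact he'
            · rintro ⟨q, σ⟩ _ ⟨q', σ'⟩ _ h
              simp only [Prod.mk.injEq] at h
              obtain ⟨h1, h2⟩ := h
              have h3 : q = q' := by
                have h4 := congrArg (fun τ : Fin m ≃ E => τ.symm x) h2
                simp only [Equiv.symm_trans_apply, Equiv.symm_swap, Equiv.swap_apply_left] at h4
                exact h4
              subst h3
              rw [← h1] at h2
              have h5 : σ = σ' := by
                ext i
                have := congrArg (fun τ : Fin m ≃ E => τ (Equiv.swap (σ.symm x) q i)) h2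
                simpa using this
              rw [h5]
        _ ≤ _ := by
            rw [Finset.card_product]
            exact Nat.mul_le_mul_right _ hcard
    rw [Finset.card_insert_of_notMem hx, pow_succ, pow_succ]
    calc _ = m ^ X.card *
          (m * orderCount (fun σ : Fin m ≃ E => ∀ e ∈ insert x X, (σ.symm e : ℕ) < p)) := by ring
      _ ≤ m ^ X.card * (p * orderCount (fun σ : Fin m ≃ E => ∀ e ∈ X, (σ.symm e : ℕ) < p)) :=
          Nat.mul_le_mul_left _ hstep
      _ = p * (m ^ X.card * orderCount (fun σ : Fin m ≃ E => ∀ e ∈ X, (σ.symm e : ℕ) < p)) := by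
          ring
      _ ≤ p * (p ^ X.card * Fintype.card (Fin m ≃ E)) := Nat.mul_le_mul_left _ ih
      _ = _ := by ring

/-- It is unlikely that many elements of a set are among the first `p` ones. -/
theorem orderCount_prefix_large (M : Finset E) (p : ℕ) (hm : 0 < m) (k : ℕ) :
    (orderCount (fun σ : Fin m ≃ E => k ≤ (M.filter fun e => (σ.symm e : ℕ) < p).card) : ℝ) ≤
      2 ^ M.card * ((p : ℝ) / m) ^ k * Fintype.card (Fin m ≃ E) := by
  classical
  have hm' : (0 : ℝ) < m := by exact_mod_cast hm
  -- Union bound over the `k`-subsets of `M`; their number is later bounded by `2 ^ M.card`.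
  have h1 := orderCount_le_sum (m := m) (E := E) (M.powersetCard k)
    (P := fun σ => k ≤ (M.filter fun e => (σ.symm e : ℕ) < p).card)
    (fun X σ => ∀ e ∈ X, (σ.symm e : ℕ) < p) (fun σ hσ => by
      obtain ⟨X, hX, hXk⟩ := Finset.exists_subset_card_eq hσ
      exact ⟨X, Finset.mem_powersetCard.2 ⟨hX.trans (Finset.filter_subset _ _), hXk⟩,
        fun e he => (Finset.mem_filter.1 (hX he)).2⟩)
  have h2 : ∀ X ∈ M.powersetCard k,
      (orderCount (fun σ : Fin m ≃ E => ∀ e ∈ X, (σ.symm e : ℕ) < p) : ℝ) ≤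
        ((p : ℝ) / m) ^ k * Fintype.card (Fin m ≃ E) := fun X hX => by
    have h3 := orderCount_subset_prefix (m := m) X p
    rw [(Finset.mem_powersetCard.1 hX).2] at h3
    have h3' : (m : ℝ) ^ k * orderCount (fun σ : Fin m ≃ E => ∀ e ∈ X, (σ.symm e : ℕ) < p) ≤
        (p : ℝ) ^ k * Fintype.card (Fin m ≃ E) := by exact_mod_cast h3
    rw [div_pow, div_mul_eq_mul_div, le_div_iff₀ (by positivity), mul_comm]
    exact h3'
  calc _ ≤ ∑ X ∈ M.powersetCard k,
        (orderCount (fun σ : Fin m ≃ E => ∀ e ∈ X, (σ.symm e : ℕ) < p) : ℝ) := by exact_mod_cast h1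
    _ ≤ ∑ X ∈ M.powersetCard k, ((p : ℝ) / m) ^ k * Fintype.card (Fin m ≃ E) :=
        Finset.sum_le_sum h2
    _ = (M.card.choose k : ℝ) * (((p : ℝ) / m) ^ k * Fintype.card (Fin m ≃ E)) := by
        rw [Finset.sum_const, Finset.card_powersetCard, nsmul_eq_mul]
    _ ≤ 2 ^ M.card * (((p : ℝ) / m) ^ k * Fintype.card (Fin m ≃ E)) := by
        refine mul_le_mul_of_nonneg_right ?_ (by positivity)
        exact_mod_cast Nat.choose_le_two_pow _ _
    _ = _ := by ring

end RandomOrder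

/-! ### The parameters of the algorithm -/

namespace MatchParam

/-- A logarithm of the number of vertices. -/
def logSize (n : ℕ) : ℕ := Nat.log 2 n + 1

/-- The unit in which degree bounds are measured. -/
def unit (c n : ℕ) : ℕ := 1792 * (c + 4) * logSize n

/-- The bound for edge degrees of alive edges. -/
def beta (c n : ℕ) : ℕ := 14 * unit c n

/-- Edges of smaller edge degree are stored. -/
def theta (c n : ℕ) : ℕ := 13 * unit c n

/-- A bound for the number of insertions. -/
def inserts (c n : ℕ) : ℕ := n * (beta c n * beta c n)

/-- The ratio between the number of edges and the length of an uneventful period. -/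
def ratio (c n : ℕ) : ℕ := (inserts c n + 1) * 2 ^ 22

/-- The number of consecutive edges of large edge degree that ends the first phase. -/
def period (c n m : ℕ) : ℕ := m / ratio c n

/-- A bound for the number of edges that are stored in the second phase. -/
def late (c n : ℕ) : ℕ := 2 * (c + 4) * (ratio c n * logSize n)

/-- The maximum number of stored edges. -/
def cap (c n : ℕ) : ℕ := inserts c n + late c n + 1

/-- The number of cells of each array. -/
def cells (c n : ℕ) : ℕ := cap c n + n + 1

/-- The number of bits of each word. -/
def wordSize (c n : ℕ) : ℕ := (3 * c + 80) * logSize n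

/-- The program recomputes its parameters from n and m whenever it needs them, so they occupy no
memory. -/
def logSizeE : Expr 17 := .add (.log2 .numVertices) (.const 1)
def unitE (c : ℕ) : Expr 17 := .mul (.const (1792 * (c + 4))) logSizeE
def betaE (c : ℕ) : Expr 17 := .mul (.const 14) (unitE c)
def thetaE (c : ℕ) : Expr 17 := .mul (.const 13) (unitE c)
def insertsE (c : ℕ) : Expr 17 := .mul .numVertices (.mul (betaE c) (betaE c))
def ratioE (c : ℕ) : Expr 17 := .mul (.add (insertsE c) (.const 1)) (.const (2 ^ 22))
def periodE (c : ℕ) : Expr 17 := .div .numEdges (ratioE c)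
def lateE (c : ℕ) : Expr 17 := .mul (.const (2 * (c + 4))) (.mul (ratioE c) logSizeE)
def capE (c : ℕ) : Expr 17 := .add (.add (insertsE c) (lateE c)) (.const 1)

theorem logSize_pos (n : ℕ) : 0 < logSize n := Nat.succ_pos _

theorem lt_two_pow_logSize (n : ℕ) : n < 2 ^ logSize n := Nat.lt_pow_succ_log_self (by norm_num) n

theorem unit_pos (c n : ℕ) : 0 < unit c n := by
  have := logSize_pos n
  unfold unit; positivity

theorem ratio_pos (c n : ℕ) : 0 < ratio c n := by unfold ratio; positivity

theorem ratio_le_late (c n : ℕ) : ratio c n ≤ late c n := by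
  have := logSize_pos n
  unfold late
  nlinarith [Nat.mul_le_mul_left (ratio c n) this, Nat.zero_le (c * (ratio c n * logSize n))]

theorem mul_le_two_pow {l i j x y : ℕ} (hx : x ≤ 2 ^ (i * l)) (hy : y ≤ 2 ^ (j * l)) :
    x * y ≤ 2 ^ ((i + j) * l) := by
  rw [add_mul, pow_add]; exact Nat.mul_le_mul hx hy

theorem const_le_two_pow {l i x : ℕ} (hl : 0 < l) (hx : x ≤ 2 ^ i) : x ≤ 2 ^ (i * l) :=
  hx.trans (Nat.pow_le_pow_right (by norm_num) (Nat.le_mul_of_pos_right i hl))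

theorem add_le_two_pow {l i x y : ℕ} (hl : 0 < l) (hx : x ≤ 2 ^ (i * l)) (hy : y ≤ 2 ^ (i * l)) :
    x + y ≤ 2 ^ ((i + 1) * l) := by
  have h : 2 * 2 ^ (i * l) ≤ 2 ^ ((i + 1) * l) := by
    rw [← pow_succ']
    exact Nat.pow_le_pow_right (by norm_num) (by rw [add_mul]; omega)
  omega

/-- Exponents add under multiplication, with 1792 ≤ 2¹¹ and 14 ≤ 2⁴. The term 3c stems from three
factors c + 4: two in the square of `beta` and one in `late`. -/
theorem cap_le_two_pow (c n : ℕ) : cap c n ≤ 2 ^ ((3 * c + 75) * logSize n) := by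
  have hl := logSize_pos n
  have one : ∀ i, 1 ≤ 2 ^ (i * logSize n) := fun i => Nat.one_le_two_pow
  have hn : n ≤ 2 ^ (1 * logSize n) := by rw [one_mul]; exact (lt_two_pow_logSize n).le
  have hlog : logSize n ≤ 2 ^ (1 * logSize n) := by rw [one_mul]; exact Nat.lt_two_pow_self.le
  have hc : c + 4 ≤ 2 ^ ((c + 4) * logSize n) := const_le_two_pow hl Nat.lt_two_pow_self.le
  have hu : unit c n ≤ 2 ^ ((11 + (c + 4) + 1) * logSize n) :=
    mul_le_two_pow (mul_le_two_pow (const_le_two_pow hl (by norm_num)) hc) hlog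
  have hb : beta c n ≤ 2 ^ ((4 + (11 + (c + 4) + 1)) * logSize n) :=
    mul_le_two_pow (const_le_two_pow hl (by norm_num)) hu
  have hi := mul_le_two_pow hn (mul_le_two_pow hb hb)
  have hr := mul_le_two_pow (add_le_two_pow hl hi (one _))
    (const_le_two_pow hl (le_refl (2 ^ 22)))
  have ht := mul_le_two_pow (mul_le_two_pow (const_le_two_pow (i := 1) hl (le_refl 2)) hc)
    (mul_le_two_pow hr hlog)
  have hmono : ∀ {i j : ℕ}, i ≤ j → 2 ^ (i * logSize n) ≤ 2 ^ (j * logSize n) := fun h =>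
    Nat.pow_le_pow_right (by norm_num) (Nat.mul_le_mul_right _ h)
  have h1 := add_le_two_pow (i := 3 * c + 73) hl (hi.trans (hmono (by omega)))
    (ht.trans (hmono (by omega)))
  exact add_le_two_pow hl h1 (one _)

theorem cap_lt_word (c n : ℕ) : 2 * cap c n + 3 < 2 ^ wordSize c n := by
  have hl := logSize_pos n
  have h1 := cap_le_two_pow c n
  have h2 : 2 ^ ((3 * c + 75) * logSize n) * 2 ^ 5 ≤ 2 ^ wordSize c n := by
    rw [← pow_add]
    refine Nat.pow_le_pow_right (by norm_num) ?_
    unfold wordSize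
    nlinarith
  have h3 : 1 ≤ 2 ^ ((3 * c + 75) * logSize n) := Nat.one_le_two_pow
  omega

theorem sq_lt_word (c n : ℕ) : n * n < 2 ^ wordSize c n := by
  have h1 := lt_two_pow_logSize n
  have h2 : 2 ^ logSize n * 2 ^ logSize n ≤ 2 ^ wordSize c n := by
    rw [← pow_add]
    refine Nat.pow_le_pow_right (by norm_num) ?_
    unfold wordSize
    nlinarith
  nlinarith

theorem lt_word (c n : ℕ) : n < 2 ^ wordSize c n := by
  refine (lt_two_pow_logSize n).trans_le (Nat.pow_le_pow_right (by norm_num) ?_)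
  unfold wordSize
  nlinarith [logSize_pos n]

end MatchParam

open MatchParam in
/-- The streaming algorithm: it maintains a subgraph of bounded edge degree until no edge of small
edge degree has arrived for a while, then stores all edges of small edge degree, and outputs a
maximum matching of the stored edges. -/
def matchAlg (c : ℕ) : StreamAlg where
  numArrays := 17
  start := .skip
  step := stepCmd (betaE c) (thetaE c) (periodE c) (capE c)
  finish := finishCmd
  outLen := varOut
  outFst := arrOutFst
  outSnd := arrOutSnd

/-! ### The invariant of the stream -/

section Stream

open MatchParam

variable {c n m : ℕ}

/-- The algorithm is in memory `s` after the edges in `l`. -/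
def Reach (c n m : ℕ) (l : List (ℕ × ℕ)) (s : Mem 17) : Prop :=
  (matchAlg c).Pass (cells c n) (wordSize c n) n m l (fun _ _ => 0) s

theorem Reach.deterministic {l : List (ℕ × ℕ)} {s t : Mem 17} (h : Reach c n m l s)
    (h' : Reach c n m l t) : s = t :=
  StreamAlg.Pass.deterministic (A := matchAlg c) h h'

/-- The edge `e` has small edge degree. -/
abbrev Under (c n : ℕ) (D : ℕ → ℕ) (e : ℕ × ℕ) : Prop := D e.1 + D e.2 < theta c n

/-- The stream `l` consists of a first phase `l₀`, after which the subgraph of alive edges does not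
change any more, a period `l₁` in which no edge has small edge degree, and a second phase `l₂`. -/
structure History (c n m : ℕ) (s : Mem 17) (l₀ l₁ l₂ : List (ℕ × ℕ)) (k : ℕ) : Prop where
  reach : ∃ t, Reach c n m l₀ t ∧ t arrDeg = s arrDeg
  idle : l₁.length = s varIdle 0
  idle_le : s varIdle 0 ≤ period c n m
  length_le : l₀.length ≤ k * period c n m
  pot : 2 * (k : ℤ) ≤ potential (beta c n) n (s arrDeg)
  quiet : ∀ e ∈ l₁, ¬ Under c n (s arrDeg) e
  first : s varIdle 0 < period c n m → l₂ = [] ∧ s varLen 0 = k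
  len : s varLen 0 ≤ k + (l₂.filter fun e => Under c n (s arrDeg) e).length
  stored : s varLen 0 < cap c n → ∀ e ∈ l₂, Under c n (s arrDeg) e →
    ∃ i < s varLen 0, s arrFst i = e.1 ∧ s arrSnd i = e.2

/-- Every insertion has gained 2 in a potential that is at most nβ². -/
theorem History.le_inserts {s : Mem 17} {l₀ l₁ l₂ : List (ℕ × ℕ)} {k : ℕ}
    (h : History c n m s l₀ l₁ l₂ k) : k ≤ inserts c n := by
  have h1 := h.pot.trans (potential_le _ _ _)
  have h2 : (inserts c n : ℤ) = n * (beta c n) ^ 2 := by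
    unfold inserts; push_cast; ring
  omega

/-- The state of the algorithm after the edges in `l`. -/
structure StreamInv (c n m : ℕ) (l : List (ℕ × ℕ)) (s : Mem 17) : Prop where
  reach : Reach c n m l s
  cons : Consistent n (beta c n) (cap c n) s
  mem : ∀ i < s varLen 0, (s arrFst i, s arrSnd i) ∈ l
  inj : ∀ i < s varLen 0, ∀ j < s varLen 0, s arrFst i = s arrFst j → s arrSnd i = s arrSnd j →
    i = j
  hist : ∃ l₀ l₁ l₂ k, l = l₀ ++ l₁ ++ l₂ ∧ History c n m s l₀ l₁ l₂ k

theorem streamInv_nil : StreamInv c n m [] (fun _ _ => 0) := by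
  refine ⟨rfl, ⟨by simp, fun i hi => by simp at hi, ?_, ?_⟩, fun i hi => by simp at hi,
    fun i hi => by simp at hi, [], [], [], 0, rfl, ⟨⟨_, rfl, rfl⟩, rfl, by simp, by simp, ?_,
      by simp, by simp, by simp, by simp⟩⟩
  · intro v; simp [edgeDeg, alive]
  · intro i hi; simp [alive] at hi
  · simp [potential]

/-- An insertion turns the whole stream so far into `l₀`, a large edge in the first phase prolongs
`l₁`, and all later arrivals go to `l₂`. Since edges do not repeat, the stored list stays free of
repetitions. -/
theorem StreamInv.append {l : List (ℕ × ℕ)} {s t : Mem 17} {e : ℕ × ℕ} (h : StreamInv c n m l s)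
    (he : e ∉ l) (hreach : Reach c n m (l ++ [e]) t)
    (hres : StepResult n (beta c n) (theta c n) (period c n m) (cap c n) e.1 e.2 s t) :
    StreamInv c n m (l ++ [e]) t := by
  obtain ⟨hcons, hres⟩ := hres
  obtain ⟨l₀, l₁, l₂, k, hl, hh⟩ := h.hist
  have hk := hh.le_inserts
  have hstored : Stored s t e.1 e.2 →
      (∀ i < t varLen 0, (t arrFst i, t arrSnd i) ∈ l ++ [e]) ∧
      (∀ i < t varLen 0, ∀ j < t varLen 0, t arrFst i = t arrFst j → t arrSnd i = t arrSnd j →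
        i = j) ∧ (∀ i < s varLen 0, t arrFst i = s arrFst i ∧ t arrSnd i = s arrSnd i) ∧
      t arrFst (s varLen 0) = e.1 ∧ t arrSnd (s varLen 0) = e.2 := by
    rintro ⟨h1, h2, h3⟩
    have hold : ∀ i < s varLen 0, t arrFst i = s arrFst i ∧ t arrSnd i = s arrSnd i := by
      intro i hi
      rw [h2, h3]
      simp [hi.ne]
    have hnew : t arrFst (s varLen 0) = e.1 ∧ t arrSnd (s varLen 0) = e.2 := by
      rw [h2, h3]; simp
    refine ⟨?_, ?_, hold, hnew⟩
    · intro i hi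
      by_cases hi' : i = s varLen 0
      · rw [hi', hnew.1, hnew.2]; simp
      · have hi'' : i < s varLen 0 := by omega
        rw [(hold i hi'').1, (hold i hi'').2]
        exact List.mem_append_left _ (h.mem i hi'')
    · have hne : ∀ i < s varLen 0, ¬ (t arrFst i = e.1 ∧ t arrSnd i = e.2) := by
        rintro i hi ⟨e1, e2⟩
        have := h.mem i hi
        rw [(hold i hi).1] at e1
        rw [(hold i hi).2] at e2
        rw [e1, e2] at this
        exact he this
      intro i hi j hj hij hij'
      by_cases hi' : i = s varLen 0 <;> by_cases hj' : j = s varLen 0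
      · rw [hi', hj']
      · rw [hi', hnew.1] at hij
        rw [hi', hnew.2] at hij'
        exact absurd ⟨hij.symm, hij'.symm⟩ (hne j (by omega))
      · rw [hj', hnew.1] at hij
        rw [hj', hnew.2] at hij'
        exact absurd ⟨hij, hij'⟩ (hne i (by omega))
      · have hi'' : i < s varLen 0 := by omega
        have hj'' : j < s varLen 0 := by omega
        rw [(hold i hi'').1, (hold j hj'').1] at hij
        rw [(hold i hi'').2, (hold j hj'').2] at hij'
        exact h.inj i hi'' j hj'' hij hij'
  have hlen : l.length = l₀.length + l₁.length + l₂.length := by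
    rw [hl, List.length_append, List.length_append]
  have hsecond : period c n m ≤ s varIdle 0 → s varIdle 0 = period c n m := fun h =>
    le_antisymm hh.idle_le h
  rcases hres with ⟨hu, hc, hid, hst, hidle, hpot⟩ | ⟨hu, hc, hid, hst, hidle, hD⟩ |
    ⟨hu, hc, rfl⟩ | ⟨hu, hid, hidle, hL, hF, hS, hD⟩ | ⟨hu, hid, rfl⟩
  · obtain ⟨hmem, hinj, -⟩ := hstored hst
    obtain ⟨hl2, hlk⟩ := hh.first hid
    refine ⟨hreach, hcons, hmem, hinj, l ++ [e], [], [], k + 1, by simp, ⟨⟨t, hreach, rfl⟩,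
      by simp [hidle], by omega, ?_, ?_, by simp, fun _ => ⟨rfl, ?_⟩, ?_, by simp⟩⟩
    -- The new insertion accounts for itself and the idle arrivals before it, together at most one
    -- period.
    · rw [List.length_append, hlen, hl2, hh.idle]
      simp only [List.length_nil, List.length_singleton]
      have := hh.length_le
      rw [add_mul, one_mul]
      omega
    · have := hh.pot
      push_cast; omega
    · rw [hst.1, hlk]
    · rw [hst.1, hlk]; simp
  · obtain ⟨hmem, hinj, hold, hnew⟩ := hstored hst
    obtain ⟨r, hr, hrD⟩ := hh.reach
    have hunder : Under c n (s arrDeg) e := hu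
    refine ⟨hreach, hcons, hmem, hinj, l₀, l₁, l₂ ++ [e], k, by simp [hl], ⟨⟨r, hr, by rw [hD, hrD]⟩,
      by rw [hidle, hh.idle], by rw [hidle]; exact hh.idle_le, hh.length_le, by rw [hD]; exact hh.pot,
      by rw [hD]; exact hh.quiet, fun h => by omega, ?_, ?_⟩⟩
    · rw [hD, hst.1, List.filter_append, List.length_append]
      have := hh.len
      rw [List.filter_cons_of_pos (by simpa using hunder)]
      simp only [List.filter_nil, List.length_cons, List.length_nil]
      omega
    · rw [hD]
      intro hlt f hf hfu
      rw [hst.1] at hlt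
      rcases List.mem_append.1 hf with hf | hf
      · obtain ⟨i, hi, h1, h2⟩ := hh.stored hc f hf hfu
        exact ⟨i, by rw [hst.1]; omega, (hold i hi).1.trans h1, (hold i hi).2.trans h2⟩
      · rw [List.mem_singleton.1 hf]
        exact ⟨s varLen 0, by rw [hst.1]; omega, hnew.1, hnew.2⟩
  -- In the first phase only the `k ≤ inserts c n` inserted edges are stored, so the list cannot be
  -- full yet.
  · have hid : ¬ t varIdle 0 < period c n m := fun hid => by
      have := (hh.first hid).2
      unfold cap at hc
      omega
    refine ⟨hreach, hcons, fun i hi => List.mem_append_left _ (h.mem i hi), h.inj, l₀, l₁,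
      l₂ ++ [e], k, by simp [hl], ⟨hh.reach, hh.idle, hh.idle_le, hh.length_le, hh.pot, hh.quiet,
      fun h => absurd h hid, ?_, fun hlt => by omega⟩⟩
    rw [List.filter_append, List.length_append]
    have := hh.len
    omega
  · obtain ⟨hl2, hlk⟩ := hh.first hid
    obtain ⟨r, hr, hrD⟩ := hh.reach
    refine ⟨hreach, hcons, ?_, ?_, l₀, l₁ ++ [e], [], k, by simp [hl, hl2],
      ⟨⟨r, hr, by rw [hD, hrD]⟩, by simp [hidle, hh.idle], by omega, hh.length_le,
      by rw [hD]; exact hh.pot, ?_, fun _ => ⟨rfl, by rw [hL, hlk]⟩, by rw [hL, hlk]; simp,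
      by simp⟩⟩
    · rw [hL, hF, hS]
      exact fun i hi => List.mem_append_left _ (h.mem i hi)
    · rw [hL, hF, hS]; exact h.inj
    · rw [hD]
      intro f hf
      rcases List.mem_append.1 hf with hf | hf
      · exact hh.quiet f hf
      · rw [List.mem_singleton.1 hf]; exact not_lt.2 hu
  · have hunder : ¬ Under c n (t arrDeg) e := not_lt.2 hu
    refine ⟨hreach, hcons, fun i hi => List.mem_append_left _ (h.mem i hi), h.inj, l₀, l₁,
      l₂ ++ [e], k, by simp [hl], ⟨hh.reach, hh.idle, hh.idle_le, hh.length_le, hh.pot, hh.quiet,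
      fun h => by omega, ?_, ?_⟩⟩
    · rw [List.filter_append, List.length_append]
      have := hh.len
      omega
    · intro hlt f hf hfu
      rcases List.mem_append.1 hf with hf | hf
      · exact hh.stored hlt f hf hfu
      · rw [List.mem_singleton.1 hf] at hfu; exact absurd hfu hunder

/-- The bound on `m` guarantees that the idle counter fits into a word. -/
theorem exists_streamInv (hm : m ≤ n * n) (l : List (ℕ × ℕ)) (hl : l.Nodup)
    (hedge : ∀ e ∈ l, e.1 < n ∧ e.2 < n ∧ e.1 ≠ e.2) : ∃ s, StreamInv c n m l s := by
  induction l using List.reverseRecOn with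
  | nil => exact ⟨_, streamInv_nil⟩
  | append_singleton l e ih =>
    obtain ⟨hl', -, hdisj⟩ := List.nodup_append.1 hl
    obtain ⟨s, hs⟩ := ih hl' fun f hf => hedge f (List.mem_append_left _ hf)
    obtain ⟨hu, hv, huv⟩ := hedge e (by simp)
    have hcw := cap_lt_word c n
    have hper : period c n m ≤ m := Nat.div_le_self _ _
    have hsq := sq_lt_word c n
    obtain ⟨t, ht, hres⟩ := wp_step (x := ⟨n, m, e.1, e.2⟩) (S := cells c n) (w := wordSize c n)
      (β := beta c n) (θ := theta c n) (α := period c n m) (cap := cap c n) (βE := betaE c)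
      (θE := thetaE c) (αE := periodE c) (capE := capE c) rfl (fun _ => rfl) (fun _ => rfl)
      (fun _ => rfl) (fun _ => rfl)
      (by have := unit_pos c n; unfold theta beta; omega) (by unfold cells; omega)
      (by unfold cells; omega) (lt_word c n).le (by omega) (by omega) hu hv huv hs.cons
    refine ⟨t, hs.append (fun he => hdisj e he e (by simp) rfl) ?_ hres⟩
    exact StreamAlg.Pass.append (A := matchAlg c) hs.reach ⟨t, ht, rfl⟩

end Stream

/-! ### Edges as pairs of numbers -/

section Endpoints

variable {n : ℕ}

theorem endpoints_mk (u v : Fin n) :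
    endpoints s(u, v) = (((min u v : Fin n) : ℕ), ((max u v : Fin n) : ℕ)) := rfl

theorem mem_iff_endpoints {v : Fin n} {e : Sym2 (Fin n)} :
    v ∈ e ↔ (v : ℕ) = (endpoints e).1 ∨ (v : ℕ) = (endpoints e).2 := by
  induction e using Sym2.ind with
  | _ x y =>
    rw [endpoints_mk, Sym2.mem_iff, Fin.ext_iff, Fin.ext_iff]
    rcases le_total x y with h | h
    · rw [min_eq_left h, max_eq_right h]
    · rw [min_eq_right h, max_eq_left h]; exact or_comm

theorem endpoints_injective : Function.Injective (endpoints : Sym2 (Fin n) → ℕ × ℕ) := by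
  intro e f h
  refine Sym2.ext fun v => ?_
  rw [mem_iff_endpoints, mem_iff_endpoints, h]

theorem endpoints_lt (e : Sym2 (Fin n)) : (endpoints e).1 < n ∧ (endpoints e).2 < n :=
  ⟨Fin.is_lt _, Fin.is_lt _⟩

theorem mk_endpoints (e : Sym2 (Fin n)) (h1 : (endpoints e).1 < n) (h2 : (endpoints e).2 < n) :
    s((⟨(endpoints e).1, h1⟩ : Fin n), ⟨(endpoints e).2, h2⟩) = e := by
  induction e using Sym2.ind with
  | _ x y =>
    simp only [endpoints_mk]
    rcases le_total x y with h | h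
    · simp [min_eq_left h, max_eq_right h]
    · simp [min_eq_right h, max_eq_left h, Sym2.eq_swap]

theorem endpoints_ne {G : SimpleGraph (Fin n)} {e : Sym2 (Fin n)} (he : e ∈ G.edgeSet) :
    (endpoints e).1 ≠ (endpoints e).2 := by
  intro h
  have h1 := mk_endpoints e (endpoints_lt e).1 (endpoints_lt e).2
  rw [← h1, SimpleGraph.mem_edgeSet] at he
  exact he.ne (Fin.ext h)

theorem card_edgeSet_le (G : SimpleGraph (Fin n)) : Nat.card G.edgeSet ≤ n * n := by
  have h := Nat.card_le_card_of_injective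
    (fun e : G.edgeSet => ((⟨_, (endpoints_lt (e : Sym2 (Fin n))).1⟩ : Fin n),
      (⟨_, (endpoints_lt (e : Sym2 (Fin n))).2⟩ : Fin n))) (fun e f h => by
        simp only [Prod.mk.injEq, Fin.mk.injEq] at h
        exact Subtype.ext (endpoints_injective (Prod.ext h.1 h.2)))
  simpa using h

variable {G : SimpleGraph (Fin n)} (σ : EdgeOrder G)

theorem length_edgeStream : (edgeStream σ).length = Nat.card G.edgeSet := by simp [edgeStream]

theorem nodup_edgeStream : (edgeStream σ).Nodup :=
  List.nodup_ofFn_ofInjective fun _ _ h => σ.injective (Subtype.ext (endpoints_injective h))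

theorem mem_edgeStream {x : ℕ × ℕ} :
    x ∈ edgeStream σ ↔ ∃ i, endpoints (σ i : Sym2 (Fin n)) = x := by
  simp [edgeStream, List.mem_ofFn]

theorem mem_take_edgeStream {s : ℕ} {i : Fin (Nat.card G.edgeSet)} :
    endpoints (σ i : Sym2 (Fin n)) ∈ (edgeStream σ).take s ↔ (i : ℕ) < s := by
  rw [List.mem_take_iff_getElem]
  constructor
  · rintro ⟨j, hj, h⟩
    simp only [edgeStream, List.getElem_ofFn] at h
    have := σ.injective (Subtype.ext (endpoints_injective h))
    rw [← this]
    exact lt_of_lt_of_le hj (min_le_left _ _)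
  · intro h
    refine ⟨i, lt_min h (by rw [length_edgeStream]; exact i.2), ?_⟩
    simp only [edgeStream, List.getElem_ofFn]

theorem take_edgeStream_congr {σ σ' : EdgeOrder G} {s : ℕ}
    (h : ∀ i : Fin (Nat.card G.edgeSet), (i : ℕ) < s → σ i = σ' i) :
    (edgeStream σ).take s = (edgeStream σ').take s := by
  refine List.ext_getElem (by simp [length_edgeStream]) fun i h1 h2 => ?_
  simp only [List.getElem_take, edgeStream, List.getElem_ofFn]
  rw [h]
  simp only [List.length_take] at h1
  exact lt_of_lt_of_le h1 (min_le_left _ _)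

end Endpoints

/-! ### The output of the algorithm -/

section Output

open MatchParam

variable {c n : ℕ} {G : SimpleGraph (Fin n)}

theorem indepEdges_ne {f g : ℕ → ℕ} {X : Finset ℕ} (h : IndepEdges f g X) {i j : ℕ} (hi : i ∈ X)
    (hj : j ∈ X) (hij : i ≠ j) : ¬ Conflict f g i j := by
  rcases lt_or_gt_of_ne hij with hlt | hlt
  · intro hc
    refine h j hj i hi hlt ?_
    unfold Conflict at hc ⊢
    omega
  · exact h i hi j hj hlt

/-- Needs no randomness: stored pairs are distinct edges of `G`, so index sets without conflicts are
matchings of the same size, and the search is optimal among them. -/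
theorem exists_returns (σ : EdgeOrder G) :
    ∃ s, StreamInv c n (Nat.card G.edgeSet) (edgeStream σ) s ∧
      ∃ M, (matchAlg c).Returns (cells c n) (wordSize c n) σ M ∧ IsMatching G M ∧
        ∀ M', IsMatching G M' →
          (∀ e ∈ M', ∃ i < s varLen 0, (s arrFst i, s arrSnd i) = endpoints e) →
          M'.card ≤ M.card := by
  classical
  obtain ⟨s, hs⟩ := exists_streamInv (c := c) (card_edgeSet_le G) (edgeStream σ)
    (nodup_edgeStream σ) (fun x hx => by
      obtain ⟨i, rfl⟩ := (mem_edgeStream σ).1 hx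
      exact ⟨(endpoints_lt _).1, (endpoints_lt _).2, endpoints_ne (σ i).2⟩)
  refine ⟨s, hs, ?_⟩
  have hw := cap_lt_word c n
  have hn := lt_word c n
  have hlen := hs.cons.len
  obtain ⟨t, ht, X, hXL, hXi, hXmax, hXout⟩ := wp_finish
    (x := ⟨n, Nat.card G.edgeSet, 0, 0⟩) (S := cells c n) (w := wordSize c n) (L := s varLen 0)
    (f := s arrFst) (g := s arrSnd) (s := s) (by unfold cells; omega) (by unfold cells; omega)
    (by omega) (fun i hi => (hs.cons.edge i hi).1.trans hn)
    (fun i hi => (hs.cons.edge i hi).2.1.trans hn) ⟨rfl, rfl, rfl⟩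
  have hreturns : ∀ M : Finset (Sym2 (Fin n)),
      X.image (fun i => (s arrFst i, s arrSnd i)) = M.image endpoints →
      (matchAlg c).Returns (cells c n) (wordSize c n) σ M := by
    intro M hM
    refine ⟨_, ⟨fun _ _ => 0, s, t, Exec.skip _, ?_, ?_, rfl⟩, hXout.trans hM⟩
    · rw [length_edgeStream]; exact hs.reach
    · rw [length_edgeStream]; exact ht
  -- The empty case is `n = 0`; otherwise `e₀` is the default for indices beyond the list.
  rcases isEmpty_or_nonempty (Sym2 (Fin n)) with hemp | ⟨⟨e₀⟩⟩
  · refine ⟨∅, hreturns ∅ ?_, ⟨fun e => (hemp.false e).elim, fun e => (hemp.false e).elim⟩, ?_⟩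
    · have : X = ∅ := Finset.eq_empty_of_forall_notMem fun i hi => by
        have := (hs.cons.edge i (Finset.mem_range.1 (hXL hi))).1
        exact hemp.false s(⟨_, this⟩, ⟨_, this⟩)
      simp [this]
    · intro M' _ _
      rw [Finset.eq_empty_of_isEmpty M']
  have hstored : ∀ i, ∃ e : Sym2 (Fin n), i < s varLen 0 →
      e ∈ G.edgeSet ∧ endpoints e = (s arrFst i, s arrSnd i) := fun i => by
    by_cases hi : i < s varLen 0
    · obtain ⟨j, hj⟩ := (mem_edgeStream σ).1 (hs.mem i hi)
      exact ⟨σ j, fun _ => ⟨(σ j).2, hj⟩⟩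
    · exact ⟨e₀, fun h => absurd h hi⟩
  choose ed hed using hstored
  have hXlt : ∀ i ∈ X, i < s varLen 0 := fun i hi => Finset.mem_range.1 (hXL hi)
  have hconf : ∀ i < s varLen 0, ∀ j < s varLen 0, ∀ v, v ∈ ed i → v ∈ ed j →
      Conflict (s arrFst) (s arrSnd) i j := by
    intro i hi j hj v hvi hvj
    rw [mem_iff_endpoints, (hed i hi).2] at hvi
    rw [mem_iff_endpoints, (hed j hj).2] at hvj
    unfold Conflict
    dsimp only at hvi hvj
    omega
  have hshare : ∀ i < s varLen 0, ∀ j < s varLen 0,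
      Conflict (s arrFst) (s arrSnd) i j → ∃ v, v ∈ ed i ∧ v ∈ ed j := by
    intro i hi j hj hc
    have h1 := hs.cons.edge i hi
    simp only [mem_iff_endpoints, (hed i hi).2, (hed j hj).2]
    rcases hc with h | h | h | h
    · exact ⟨⟨_, h1.1⟩, Or.inl rfl, Or.inl h⟩
    · exact ⟨⟨_, h1.1⟩, Or.inl rfl, Or.inr h⟩
    · exact ⟨⟨_, h1.2.1⟩, Or.inr rfl, Or.inl h⟩
    · exact ⟨⟨_, h1.2.1⟩, Or.inr rfl, Or.inr h⟩
  have hedinj : ∀ i < s varLen 0, ∀ j < s varLen 0, ed i = ed j → i = j := by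
    intro i hi j hj h
    have h1 := (hed i hi).2
    rw [h, (hed j hj).2] at h1
    simp only [Prod.mk.injEq] at h1
    exact hs.inj i hi j hj h1.1.symm h1.2.symm
  have hcard : (X.image ed).card = X.card := Finset.card_image_of_injOn fun i hi j hj h =>
    hedinj i (hXlt i hi) j (hXlt j hj) h
  refine ⟨X.image ed, hreturns _ ?_, ⟨?_, ?_⟩, ?_⟩
  · rw [Finset.image_image]
    exact Finset.image_congr fun i hi => ((hed i (hXlt i hi)).2).symm
  · intro e he
    obtain ⟨i, hi, rfl⟩ := Finset.mem_image.1 he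
    exact (hed i (hXlt i hi)).1
  · intro e he f hf v hve hvf
    obtain ⟨i, hi, rfl⟩ := Finset.mem_image.1 he
    obtain ⟨j, hj, rfl⟩ := Finset.mem_image.1 hf
    by_contra hne
    have hij : i ≠ j := fun h => hne (by rw [h])
    exact indepEdges_ne hXi hi hj hij (hconf i (hXlt i hi) j (hXlt j hj) v hve hvf)
  · intro M' hM' hst
    rw [hcard]
    let Y := (Finset.range (s varLen 0)).filter fun i => ed i ∈ M'
    have hYlt : ∀ i ∈ Y, i < s varLen 0 := fun i hi =>
      Finset.mem_range.1 (Finset.mem_filter.1 hi).1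
    have hY : IndepEdges (s arrFst) (s arrSnd) Y := by
      intro i hi j hj hji hc
      obtain ⟨v, hv1, hv2⟩ := hshare i (hYlt i hi) j (hYlt j hj) hc
      have := hM'.2 _ (Finset.mem_filter.1 hi).2 _ (Finset.mem_filter.1 hj).2 v hv1 hv2
      have := hedinj i (hYlt i hi) j (hYlt j hj) this
      omega
    refine le_trans ?_ (hXmax Y (Finset.filter_subset _ _) hY)
    refine (Finset.card_le_card (t := Y.image ed) fun e he => ?_).trans Finset.card_image_le
    obtain ⟨i, hi, h⟩ := hst e he
    have : ed i = e := endpoints_injective ((hed i hi).2.trans h)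
    exact Finset.mem_image.2 ⟨i, Finset.mem_filter.2 ⟨Finset.mem_range.2 hi, this ▸ he⟩, this⟩

end Output

/-! ### The graph of the stored edges -/

section StoredGraph

variable {n : ℕ}

/-- The graph with edges `(f i, g i)` for `i ∈ X`. -/
def listGraph (n : ℕ) (f g : ℕ → ℕ) (X : Finset ℕ) : SimpleGraph (Fin n) where
  Adj u v := u ≠ v ∧ ∃ i ∈ X, (f i = u ∧ g i = v) ∨ (f i = v ∧ g i = u)
  symm := ⟨fun _ _ h => ⟨h.1.symm, h.2.imp fun _ h => ⟨h.1, h.2.symm⟩⟩⟩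
  loopless := ⟨fun _ h => h.1 rfl⟩

/-- Pairs are increasing and distinct, so there are no loops or parallel edges. -/
theorem listGraph_degree {f g : ℕ → ℕ} {X : Finset ℕ} [DecidableRel (listGraph n f g X).Adj]
    (hlt : ∀ i ∈ X, f i < n ∧ g i < n) (hord : ∀ i ∈ X, f i < g i)
    (hinj : ∀ i ∈ X, ∀ j ∈ X, f i = f j → g i = g j → i = j) (v : Fin n) :
    (listGraph n f g X).degree v = edgeDeg f g X v := by
  classical
  have h1 : edgeDeg f g X v = (X.filter fun i => f i = v ∨ g i = v).card := by
    unfold edgeDeg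
    rw [Finset.card_filter]
    refine Finset.sum_congr rfl fun i hi => ?_
    have := hord i hi
    split_ifs <;> omega
  have h2 : ((listGraph n f g X).neighborFinset v).image Fin.val =
      (X.filter fun i => f i = v ∨ g i = v).image fun i => if f i = v then g i else f i := by
    ext u
    simp only [Finset.mem_image, SimpleGraph.mem_neighborFinset, Finset.mem_filter]
    constructor
    · rintro ⟨w, ⟨hne, i, hi, h | h⟩, rfl⟩
      · exact ⟨i, ⟨hi, Or.inl h.1⟩, by rw [if_pos h.1, h.2]⟩
      · refine ⟨i, ⟨hi, Or.inr h.2⟩, ?_⟩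
        rw [if_neg (fun h' => hne (Fin.ext (h'.symm.trans h.1))), h.1]
    · rintro ⟨i, ⟨hi, h⟩, rfl⟩
      have hi' := hord i hi
      split_ifs with hf
      · refine ⟨⟨g i, (hlt i hi).2⟩, ⟨fun h' => ?_, i, hi, Or.inl ⟨hf, rfl⟩⟩, rfl⟩
        have : (v : ℕ) = g i := by rw [h']
        omega
      · have hg : g i = v := h.resolve_left hf
        refine ⟨⟨f i, (hlt i hi).1⟩, ⟨fun h' => ?_, i, hi, Or.inr ⟨rfl, hg⟩⟩, rfl⟩
        exact hf (by rw [h'])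
  rw [h1, ← SimpleGraph.card_neighborFinset_eq_degree,
    ← Finset.card_image_of_injective _ Fin.val_injective, h2]
  refine Finset.card_image_of_injOn fun i hi j hj hij => ?_
  simp only [Finset.coe_filter, Set.mem_ofPred_eq] at hi hj
  have h3 := hord i hi.1
  have h4 := hord j hj.1
  by_cases e1 : f i = v <;> by_cases e2 : f j = v
  · rw [if_pos e1, if_pos e2] at hij
    exact hinj i hi.1 j hj.1 (e1.trans e2.symm) hij
  · rw [if_pos e1, if_neg e2] at hij
    have := hj.2.resolve_left e2
    omega
  · rw [if_neg e1, if_pos e2] at hij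
    have := hi.2.resolve_left e1
    omega
  · rw [if_neg e1, if_neg e2] at hij
    exact hinj i hi.1 j hj.1 hij ((hi.2.resolve_left e1).trans (hj.2.resolve_left e2).symm)

end StoredGraph

/-! ### Good orders of the edges -/

section Good

open MatchParam

variable {c n : ℕ} {G : SimpleGraph (Fin n)}

open Classical in
/-- The edges that have not arrived among the first `s` ones, but whose edge degree is small in the
memory at that time. -/
noncomputable def pending (c s : ℕ) (σ : EdgeOrder G) : Finset G.edgeSet :=
  {e | (∀ i : Fin (Nat.card G.edgeSet), (i : ℕ) < s → σ i ≠ e) ∧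
    ∃ t, Reach c n (Nat.card G.edgeSet) ((edgeStream σ).take s) t ∧
      Under c n (t arrDeg) (endpoints (e : Sym2 (Fin n)))}

/-- The hypothesis of `orderCount_avoidsLarge_le`: later arrivals influence neither the memory after
`s` edges nor which edges are left. -/
theorem pending_congr {s : ℕ} {σ σ' : EdgeOrder G}
    (h : ∀ i : Fin (Nat.card G.edgeSet), (i : ℕ) < s → σ i = σ' i) :
    pending c s σ = pending c s σ' := by
  classical
  ext e
  simp only [pending, Finset.mem_filter, Finset.mem_univ, true_and, take_edgeStream_congr h]
  exact and_congr_left fun _ => forall₂_congr fun i hi => by rw [h i hi]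

/-- A bound for the length of the first phase. -/
def firstPhase (c n m : ℕ) : ℕ := (inserts c n + 1) * period c n m

theorem period_ratio_le (c n m : ℕ) : ratio c n * period c n m ≤ m := by
  unfold period; exact Nat.mul_div_le m (ratio c n)

theorem firstPhase_le (c n m : ℕ) : 2 ^ 22 * firstPhase c n m ≤ m := by
  have := period_ratio_le c n m
  unfold ratio at this
  unfold firstPhase
  linarith

open Classical in
/-- An order of the edges is good for the matching `M` if few edges of `M` arrive in the first
phase, and if a period without edges of small edge degree is only observed when few such edges are
pending. -/
def GoodOrder (c : ℕ) (M : Finset G.edgeSet) (σ : EdgeOrder G) : Prop :=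
  (M.filter fun e => (σ.symm e : ℕ) < firstPhase c n (Nat.card G.edgeSet)).card ≤ M.card / 11 ∧
  (0 < period c n (Nat.card G.edgeSet) → ∀ s, s + period c n (Nat.card G.edgeSet) ≤
    Nat.card G.edgeSet → ¬ AvoidsLarge (pending c s) (late c n)
      (s + period c n (Nat.card G.edgeSet)) σ)

/-- The source of 1792 = 2 · 896: with R = `unit`/4 and β = 14 · `unit` the exponent is `unit`/896 ≥
2 · `logSize n`. -/
theorem two_mul_lt_exp (c n : ℕ) :
    2 * (n : ℝ) < Real.exp (((unit c n : ℝ) / 4) ^ 2 / (4 * (beta c n : ℝ))) := by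
  have hu : (0 : ℝ) < unit c n := by exact_mod_cast unit_pos c n
  have hl : (1 : ℝ) ≤ logSize n := by exact_mod_cast logSize_pos n
  have e1 : ((unit c n : ℝ) / 4) ^ 2 / (4 * (beta c n : ℝ)) = unit c n / 896 := by
    unfold beta; push_cast; field_simp; ring
  have e2 : 2 * (logSize n : ℝ) ≤ unit c n / 896 := by
    unfold unit
    push_cast
    have : (0 : ℝ) ≤ c * logSize n := by positivity
    nlinarith
  rw [e1]
  refine lt_of_lt_of_le ?_ (Real.exp_le_exp.2 e2)
  have h2 : (2 : ℝ) ≤ Real.exp 1 := by linarith [Real.add_one_le_exp (1 : ℝ)]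
  have h3 : (n : ℝ) < 2 ^ logSize n := by exact_mod_cast lt_two_pow_logSize n
  have h4 : (2 : ℝ) ≤ 2 ^ logSize n := by
    calc (2 : ℝ) = 2 ^ 1 := by norm_num
      _ ≤ _ := pow_le_pow_right₀ (by norm_num) (logSize_pos n)
  calc 2 * (n : ℝ) < 2 ^ logSize n * 2 ^ logSize n := by nlinarith
    _ = 2 ^ (2 * logSize n) := by rw [← pow_add]; congr 1; ring
    _ ≤ Real.exp 1 ^ (2 * logSize n) := pow_le_pow_left₀ (by norm_num) h2 _
    _ = _ := by rw [← Real.exp_nat_mul]; congr 1; push_cast; ring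

/-- In a good order, not too many edges are stored, and the first phase is short. -/
theorem GoodOrder.history {M : Finset G.edgeSet} {σ : EdgeOrder G} (hσ : GoodOrder c M σ)
    {s : Mem 17} (hs : StreamInv c n (Nat.card G.edgeSet) (edgeStream σ) s) :
    ∀ e : G.edgeSet, firstPhase c n (Nat.card G.edgeSet) ≤ (σ.symm e : ℕ) →
      Under c n (s arrDeg) (endpoints (e : Sym2 (Fin n))) →
      ∃ i < s varLen 0, s arrFst i = (endpoints (e : Sym2 (Fin n))).1 ∧
        s arrSnd i = (endpoints (e : Sym2 (Fin n))).2 := by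
  classical
  intro e he hunder
  obtain ⟨l₀, l₁, l₂, k, hl, hh⟩ := hs.hist
  have hk := hh.le_inserts
  have hlen := length_edgeStream σ
  rw [hl, List.length_append, List.length_append] at hlen
  -- At most `inserts` insertions with one period each, and the final idle period.
  have hfirst : l₀.length + l₁.length ≤ firstPhase c n (Nat.card G.edgeSet) := by
    have h1 := hh.length_le
    have h2 := hh.idle_le
    have h3 : k * period c n (Nat.card G.edgeSet) ≤ inserts c n * period c n (Nat.card G.edgeSet) := Nat.mul_le_mul_right _ hk
    rw [hh.idle]
    unfold firstPhase
    rw [add_mul, one_mul]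
    omega
  have hpos : (σ.symm e : ℕ) < Nat.card G.edgeSet := (σ.symm e).2
  -- Were the idle period incomplete, the whole stream would belong to the first phase, which ends
  -- before the position of `e`.
  have hidle : s varIdle 0 = period c n (Nat.card G.edgeSet) := by
    by_contra hne
    have hlt := lt_of_le_of_ne hh.idle_le hne
    have h2 := (hh.first hlt).1
    rw [h2] at hlen
    simp only [List.length_nil] at hlen
    omega
  have hmem₂ : endpoints (e : Sym2 (Fin n)) ∈ l₂ := by
    have hmem : endpoints (e : Sym2 (Fin n)) ∈ edgeStream σ :=
      (mem_edgeStream σ).2 ⟨σ.symm e, by rw [Equiv.apply_symm_apply]⟩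
    have hnot : endpoints (e : Sym2 (Fin n)) ∉ l₀ ++ l₁ := by
      have h1 : l₀ ++ l₁ = (edgeStream σ).take (l₀.length + l₁.length) := by
        rw [hl, ← List.length_append, List.take_left]
      have h2 := mem_take_edgeStream σ (s := l₀.length + l₁.length) (i := σ.symm e)
      rw [Equiv.apply_symm_apply] at h2
      rw [h1, h2]
      omega
    rw [hl] at hmem
    exact (List.mem_append.1 hmem).resolve_left hnot
  refine hh.stored ?_ _ hmem₂ hunder
  have hfilter : (l₂.filter fun e => Under c n (s arrDeg) e).length ≤ late c n := by
    -- With period 0 there are fewer than `ratio ≤ late` edges in all.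
    rcases Nat.eq_zero_or_pos (period c n (Nat.card G.edgeSet)) with hp | hp
    · refine (List.length_filter_le _ _).trans ?_
      have h1 : Nat.card G.edgeSet < ratio c n := by
        unfold period at hp
        exact (Nat.div_eq_zero_iff_lt (ratio_pos c n)).1 hp
      have h2 := ratio_le_late c n
      omega
    · obtain ⟨t, ht, htD⟩ := hh.reach
      have htake : (edgeStream σ).take l₀.length = l₀ := by
        rw [hl, List.append_assoc, List.take_left]
      have htake₁ : (edgeStream σ).take (l₀.length + period c n (Nat.card G.edgeSet)) = l₀ ++ l₁ := by
        rw [hl, ← hidle, ← hh.idle, ← List.length_append, List.take_left]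
      have hav := hσ.2 hp l₀.length (by have := hh.idle; omega)
      have hnodup := nodup_edgeStream σ
      rw [hl, List.append_assoc] at hnodup
      -- Determinism identifies the memory after `l₀`, and the degrees have not changed since.
      have hpend : ∀ f : G.edgeSet, f ∈ pending c l₀.length σ ↔
          (∀ i : Fin (Nat.card G.edgeSet), (i : ℕ) < l₀.length → σ i ≠ f) ∧
          Under c n (s arrDeg) (endpoints (f : Sym2 (Fin n))) := by
        intro f
        simp only [pending, Finset.mem_filter, Finset.mem_univ, true_and, htake]
        refine and_congr_right fun _ => ⟨?_, fun h => ⟨t, ht, by rw [htD]; exact h⟩⟩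
        rintro ⟨t', ht', hu⟩
        rwa [ht'.deterministic ht, htD] at hu
      -- Otherwise more than `late` edges were pending after `l₀`, and yet none of them arrived
      -- during `l₁`.
      by_contra hlarge
      refine hav ⟨?_, ?_⟩
      · have hnd : (l₂.filter fun e => Under c n (s arrDeg) e).Nodup :=
          ((List.nodup_append.1 (List.nodup_append.1 hnodup).2.1).2.1).filter _
        rw [not_le, ← List.toFinset_card_of_nodup hnd] at hlarge
        refine hlarge.le.trans ((Finset.card_le_card (t := (pending c l₀.length σ).image
          fun f : G.edgeSet => endpoints (f : Sym2 (Fin n))) fun x hx => ?_).trans Finset.card_image_le)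
        rw [List.mem_toFinset, List.mem_filter] at hx
        obtain ⟨hx, hxu⟩ := hx
        have hxs : x ∈ edgeStream σ := by rw [hl]; exact List.mem_append_right _ hx
        obtain ⟨i, rfl⟩ := (mem_edgeStream σ).1 hxs
        refine Finset.mem_image.2 ⟨σ i, (hpend _).2 ⟨fun j hj hji => ?_, by simpa using hxu⟩, rfl⟩
        have h1 := (mem_take_edgeStream σ (s := l₀.length) (i := j)).2 hj
        rw [htake, hji] at h1
        exact (List.nodup_append.1 hnodup).2.2 _ h1 _ (List.mem_append_right _ hx) rfl
      · intro j hj hjp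
        have h1 := (mem_take_edgeStream σ).2 hj
        rw [htake₁] at h1
        obtain ⟨h2, h3⟩ := (hpend _).1 hjp
        rcases List.mem_append.1 h1 with h | h
        · rw [← htake] at h
          exact h2 j ((mem_take_edgeStream σ).1 h) rfl
        · exact hh.quiet _ h h3
  have := hh.len
  unfold cap
  omega

/-- Apply `exists_matching_of_bounded_edge_degree` to the edges of `M` that arrive after the first
phase: by `GoodOrder.history` such an edge is stored if its edge degree in the final alive graph is
small. -/
theorem GoodOrder.exists_matching {M : Finset G.edgeSet} {σ : EdgeOrder G} (hσ : GoodOrder c M σ)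
    (hM : IsMatching G (M.image Subtype.val)) :
    ∃ M', (matchAlg c).Returns (cells c n) (wordSize c n) σ M' ∧ IsMatching G M' ∧
      6 * M.card ≤ 11 * M'.card := by
  classical
  obtain ⟨s, hs, M', hret, hmatch, hmax⟩ := exists_returns (c := c) σ
  refine ⟨M', hret, hmatch, ?_⟩
  have hord : ∀ i < s varLen 0, s arrFst i < s arrSnd i := fun i hi => by
    obtain ⟨j, hj⟩ := (mem_edgeStream σ).1 (hs.mem i hi)
    have h1 := (hs.cons.edge i hi).2.2
    have h2 : (endpoints (σ j : Sym2 (Fin n))).1 ≤ (endpoints (σ j : Sym2 (Fin n))).2 :=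
      Sym2.inf_le_sup (σ j : Sym2 (Fin n))
    rw [hj] at h2
    exact lt_of_le_of_ne h2 h1
  have halive : ∀ i ∈ alive s, i < s varLen 0 := fun i hi => mem_alive_lt hi
  set H := listGraph n (s arrFst) (s arrSnd) (alive s) with hH
  set W := listGraph n (s arrFst) (s arrSnd) (Finset.range (s varLen 0)) with hW
  have hdeg : ∀ v, H.degree v = s arrDeg v := fun v => by
    rw [hs.cons.deg v]
    exact listGraph_degree (fun i hi => ⟨(hs.cons.edge i (halive i hi)).1,
      (hs.cons.edge i (halive i hi)).2.1⟩) (fun i hi => hord i (halive i hi))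
      (fun i hi j hj => hs.inj i (halive i hi) j (halive j hj)) v
  let ι := {e : G.edgeSet // e ∈ M ∧ firstPhase c n (Nat.card G.edgeSet) ≤ (σ.symm e : ℕ)}
  let a : ι → Fin n := fun e => ⟨_, (endpoints_lt (e.1 : Sym2 (Fin n))).1⟩
  let b : ι → Fin n := fun e => ⟨_, (endpoints_lt (e.1 : Sym2 (Fin n))).2⟩
  have ha : ∀ e : ι, a e ∈ (e.1 : Sym2 (Fin n)) := fun e => mem_iff_endpoints.2 (Or.inl rfl)
  have hb : ∀ e : ι, b e ∈ (e.1 : Sym2 (Fin n)) := fun e => mem_iff_endpoints.2 (Or.inr rfl)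
  have huniq : ∀ e f : ι, ∀ v, v ∈ (e.1 : Sym2 (Fin n)) → v ∈ (f.1 : Sym2 (Fin n)) → e = f :=
    fun e f v he hf => Subtype.ext (Subtype.ext (hM.2 _ (Finset.mem_image_of_mem _ e.2.1) _
      (Finset.mem_image_of_mem _ f.2.1) v he hf))
  have hcount : 10 * M.card ≤ 11 * Fintype.card ι := by
    have h1 : Fintype.card ι = (M.filter fun e => ¬ (σ.symm e : ℕ) < firstPhase c n (Nat.card G.edgeSet)).card := by
      rw [Fintype.card_subtype]
      congr 1
      ext e
      simp [not_lt]
    have h2 := Finset.card_filter_add_card_filter_not (s := M)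
      (fun e => (σ.symm e : ℕ) < firstPhase c n (Nat.card G.edgeSet))
    have h3 := hσ.1
    omega
  have hunit : (0 : ℝ) < unit c n := by exact_mod_cast unit_pos c n
  obtain ⟨M₁, hM₁, hcard⟩ := exists_matching_of_bounded_edge_degree H W
    (fun u v ⟨h1, i, hi, h⟩ => ⟨h1, i, Finset.mem_range.2 (halive i hi), h⟩) a b
    (fun e f h => huniq e f _ (ha e) (h ▸ ha f)) (fun e f h => huniq e f _ (hb e) (h ▸ hb f))
    (fun e f h => by
      have := huniq e f _ (ha e) (h ▸ hb f)
      subst this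
      exact endpoints_ne e.1.2 (congrArg Fin.val h))
    -- In multiples of `unit`, β + 2R = 14.5 and θ - 2R = 12.5, and 6 · 14.5 = 87 ≤ 87.5 = 7 · 12.5.
    (β := beta c n) (θ := theta c n) (R := unit c n / 4)
    (by unfold beta; push_cast; linarith) (by positivity)
    (by
      rintro u v ⟨-, i, hi, h⟩
      have h1 := hs.cons.bdd i hi
      rw [hdeg, hdeg]
      have : s arrDeg u + s arrDeg v ≤ beta c n := by
        rcases h with ⟨h2, h3⟩ | ⟨h2, h3⟩
        · rwa [h2, h3] at h1
        · rw [h2, h3] at h1; omega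
      exact_mod_cast this)
    (by
      intro e hW'
      by_contra hlt
      rw [hdeg, hdeg, not_le] at hlt
      have hu : Under c n (s arrDeg) (endpoints (e.1 : Sym2 (Fin n))) := by
        have : s arrDeg (a e) + s arrDeg (b e) < theta c n := by exact_mod_cast hlt
        exact this
      obtain ⟨i, hi, h1, h2⟩ := hσ.history hs e.1 e.2.2 hu
      exact hW' ⟨fun h => endpoints_ne e.1.2 (congrArg Fin.val h), i, Finset.mem_range.2 hi,
        Or.inl ⟨h1, h2⟩⟩)
    (by rw [Fintype.card_fin]; exact two_mul_lt_exp c n)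
    (by unfold theta beta; push_cast; linarith)
    (by unfold theta; push_cast; linarith)
    (by unfold theta beta; push_cast; linarith)
  have hstored : ∀ e ∈ M₁, ∃ i < s varLen 0, (s arrFst i, s arrSnd i) = endpoints e := by
    intro e he
    have := hM₁.1 e he
    induction e using Sym2.ind with
    | _ u v =>
      rw [SimpleGraph.mem_edgeSet] at this
      obtain ⟨-, i, hi, h⟩ := this
      have hi' := Finset.mem_range.1 hi
      refine ⟨i, hi', ?_⟩
      have ho := hord i hi'
      rw [endpoints_mk]
      rcases h with ⟨h1, h2⟩ | ⟨h1, h2⟩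
      · rw [h1, h2] at ho ⊢
        have hle : u ≤ v := by rw [Fin.le_def]; omega
        rw [min_eq_left hle, max_eq_right hle]
      · rw [h1, h2] at ho ⊢
        have hle : v ≤ u := by rw [Fin.le_def]; omega
        rw [min_eq_right hle, max_eq_left hle]
  have hM₁G : IsMatching G M₁ := by
    refine ⟨fun e he => ?_, hM₁.2⟩
    obtain ⟨i, hi, h⟩ := hstored e he
    obtain ⟨j, hj⟩ := (mem_edgeStream σ).1 (hs.mem i hi)
    have : (σ j : Sym2 (Fin n)) = e := endpoints_injective (hj.trans h)
    rw [← this]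
    exact (σ j).2
  have := hmax M₁ hM₁G hstored
  omega

end Good

/-! ### Maximum matchings -/

section MatchingNumber

variable {n : ℕ} (G : SimpleGraph (Fin n))

theorem bddAbove_matching_card : BddAbove {k | ∃ M, IsMatching G M ∧ M.card = k} := by
  refine ⟨Fintype.card (Sym2 (Fin n)), ?_⟩
  rintro k ⟨M, -, rfl⟩
  exact Finset.card_le_univ M

theorem exists_matching_card_eq : ∃ M, IsMatching G M ∧ M.card = matchingNumber G :=
  Nat.sSup_mem (s := {k | ∃ M, IsMatching G M ∧ M.card = k})
    ⟨0, ∅, ⟨by simp, by simp⟩, rfl⟩ (bddAbove_matching_card G)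

/-- A maximum matching is maximal, so every edge contains one of its 2μ endpoints, and each endpoint
lies in at most n pairs. -/
theorem card_edgeSet_le_matchingNumber :
    Nat.card G.edgeSet ≤ 2 * (n * matchingNumber G) := by
  classical
  obtain ⟨M, hM, hcard⟩ := exists_matching_card_eq G
  have hmeet : ∀ e ∈ G.edgeSet, ∃ f ∈ M, ∃ v, v ∈ e ∧ v ∈ f := by
    intro e he
    by_contra hcon
    push Not at hcon
    have heM : e ∉ M := fun h =>
      hcon e h _ (Sym2.out_fst_mem e) (Sym2.out_fst_mem e)
    have hM' : IsMatching G (insert e M) := by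
      refine ⟨fun f hf => ?_, fun f hf g hg v hvf hvg => ?_⟩
      · rcases Finset.mem_insert.1 hf with rfl | hf
        · exact he
        · exact hM.1 f hf
      · rcases Finset.mem_insert.1 hf with hf | hf <;> rcases Finset.mem_insert.1 hg with hg | hg
        · rw [hf, hg]
        · rw [hf] at hvf; exact absurd hvg (hcon g hg v hvf)
        · rw [hg] at hvg; exact absurd hvf (hcon f hf v hvg)
        · exact hM.2 f hf g hg v hvf hvg
    have h1 : (insert e M).card ≤ matchingNumber G :=
      le_csSup (bddAbove_matching_card G) ⟨_, hM', rfl⟩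
    rw [Finset.card_insert_of_notMem heM] at h1
    omega
  have hsub : G.edgeFinset ⊆ M.biUnion fun f =>
      (Finset.univ.image fun u => s(f.inf, u)) ∪ Finset.univ.image fun u => s(f.sup, u) := by
    intro e he
    obtain ⟨f, hf, v, hve, hvf⟩ := hmeet e (SimpleGraph.mem_edgeFinset.1 he)
    obtain ⟨u, rfl⟩ := Sym2.mem_iff_exists.1 hve
    refine Finset.mem_biUnion.2 ⟨f, hf, Finset.mem_union.2 ?_⟩
    rcases mem_iff_endpoints.1 hvf with h | h
    · exact Or.inl (Finset.mem_image.2 ⟨u, Finset.mem_univ _, by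
        rw [show v = f.inf from Fin.ext h]⟩)
    · exact Or.inr (Finset.mem_image.2 ⟨u, Finset.mem_univ _, by
        rw [show v = f.sup from Fin.ext h]⟩)
  rw [Nat.card_eq_fintype_card, ← SimpleGraph.edgeFinset_card, ← hcard]
  refine (Finset.card_le_card hsub).trans (Finset.card_biUnion_le.trans ?_)
  refine (Finset.sum_le_card_nsmul M _ (2 * n) fun f _ => ?_).trans (by
    rw [smul_eq_mul]; exact le_of_eq (by ring))
  refine (Finset.card_union_le _ _).trans ?_
  have h1 : ∀ x : Fin n, (Finset.univ.image fun u => s(x, u)).card ≤ n := fun x =>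
    Finset.card_image_le.trans (by simp)
  have := h1 f.inf
  have := h1 f.sup
  omega

end MatchingNumber

/-! ### Most orders are good -/

section Probability

open MatchParam

variable {c n : ℕ} {G : SimpleGraph (Fin n)}

theorem pow_le_exp (c n : ℕ) : (n : ℝ) ^ (c + 4) ≤ Real.exp ((c + 4) * logSize n) := by
  have h2 : (2 : ℝ) ≤ Real.exp 1 := by linarith [Real.add_one_le_exp (1 : ℝ)]
  have h3 : (n : ℝ) ≤ Real.exp 1 ^ logSize n := by
    have : (n : ℝ) ≤ 2 ^ logSize n := by exact_mod_cast (lt_two_pow_logSize n).le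
    exact this.trans (pow_le_pow_left₀ (by norm_num) h2 _)
  calc (n : ℝ) ^ (c + 4) ≤ (Real.exp 1 ^ logSize n) ^ (c + 4) :=
        pow_le_pow_left₀ (by positivity) h3 _
    _ = _ := by rw [← pow_mul, ← Real.exp_nat_mul]; congr 1; push_cast; ring

/-- The factor 2 in `late` absorbs the rounding in `period`: m < ratio · (period + 1) ≤ 2 · ratio ·
period. -/
theorem le_late_mul_period {m : ℕ} (hp : 0 < period c n m) :
    (c + 4) * logSize n * m ≤ late c n * period c n m := by
  have h1 : m < ratio c n * (period c n m + 1) := by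
    unfold period; exact Nat.lt_mul_div_succ m (ratio_pos c n)
  have h2 : m ≤ 2 * (ratio c n * period c n m) := by nlinarith [ratio_pos c n]
  calc (c + 4) * logSize n * m ≤ (c + 4) * logSize n * (2 * (ratio c n * period c n m)) :=
        Nat.mul_le_mul_left _ h2
    _ = _ := by unfold late; ring

/-- A positive period forces m ≥ 2²² nβ², whereas m ≤ 2nμ; so μ ≥ β², which is more than enough. -/
theorem le_matchingNumber (hn : 0 < n) (hp : 0 < period c n (Nat.card G.edgeSet)) :
    (c + 4) * logSize n ≤ matchingNumber G := by
  have h1 := card_edgeSet_le_matchingNumber G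
  have h2 : ratio c n ≤ Nat.card G.edgeSet := by
    have := period_ratio_le c n (Nat.card G.edgeSet)
    nlinarith
  have h3 : n * (beta c n * beta c n) * 2 ^ 22 ≤ ratio c n := by
    unfold ratio inserts; exact Nat.mul_le_mul_right _ (Nat.le_succ _)
  have h4 : n * (beta c n * beta c n) ≤ n * matchingNumber G := by omega
  have h5 := Nat.le_of_mul_le_mul_left h4 hn
  have h6 : (c + 4) * logSize n ≤ beta c n := by
    unfold beta unit; nlinarith [Nat.zero_le ((c + 4) * logSize n)]
  have h7 : beta c n ≤ beta c n * beta c n := Nat.le_mul_self _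
  omega

/-- Union bound over at most m starting points of a period and the single event about the first
phase: m + 1 ≤ n⁴ events, each of probability at most n^-(c+4). -/
theorem orderCount_not_good (M : Finset G.edgeSet) (hM : M.card = matchingNumber G) :
    (Nat.card {σ : EdgeOrder G // ¬ GoodOrder c M σ} : ℝ) ≤
      1 / (n : ℝ) ^ c * Nat.card (EdgeOrder G) := by
  classical
  set α := period c n (Nat.card G.edgeSet) with hα
  -- With period 0 the bound for the first phase is 0, and every order is good.
  rcases Nat.eq_zero_or_pos α with hp | hp
  · have hgood : ∀ σ : EdgeOrder G, GoodOrder c M σ := fun σ => by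
      refine ⟨?_, fun h => absurd hp h.ne'⟩
      have : firstPhase c n (Nat.card G.edgeSet) = 0 := by
        unfold firstPhase; rw [← hα, hp, mul_zero]
      simp only [this, Nat.not_lt_zero, Finset.filter_false, Finset.card_empty, Nat.zero_le]
    have : IsEmpty {σ : EdgeOrder G // ¬ GoodOrder c M σ} := ⟨fun σ => σ.2 (hgood σ.1)⟩
    rw [Nat.card_of_isEmpty]
    simp only [Nat.cast_zero]
    positivity
  have hm : 0 < Nat.card G.edgeSet := by
    by_contra h
    have h0 : Nat.card G.edgeSet = 0 := by omega
    rw [hα, h0] at hp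
    simp [period] at hp
  have hn : 2 ≤ n := by
    obtain ⟨⟨e, he⟩⟩ := (Nat.card_pos_iff.1 hm).1
    have h1 := endpoints_lt e
    have h2 := endpoints_ne he
    omega
  have hn0 : (0 : ℝ) < n := by
    have : 0 < n := by omega
    exact_mod_cast this
  have hm0 : (0 : ℝ) < Nat.card G.edgeSet := by exact_mod_cast hm
  have hF : (0 : ℝ) ≤ Fintype.card (EdgeOrder G) := by positivity
  have hpow := pow_le_exp c n
  have hpow0 : (0 : ℝ) < (n : ℝ) ^ (c + 4) := by positivity
  have havoid : ∀ s, s + α ≤ Nat.card G.edgeSet →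
      (orderCount (AvoidsLarge (pending (G := G) c s) (late c n) (s + α)) : ℝ) ≤
        1 / (n : ℝ) ^ (c + 4) * Fintype.card (EdgeOrder G) := by
    intro s hs
    refine (orderCount_avoidsLarge_le (fun σ σ' h => pending_congr h) (late c n) α hs).trans ?_
    refine mul_le_mul_of_nonneg_right ?_ hF
    rw [Real.exp_neg, ← one_div]
    refine one_div_le_one_div_of_le hpow0 (hpow.trans (Real.exp_le_exp.2 ?_))
    rw [le_div_iff₀ hm0]
    exact_mod_cast le_late_mul_period hp
  have hprefix : (orderCount (fun σ : EdgeOrder G => M.card / 11 + 1 ≤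
      (M.filter fun e => (σ.symm e : ℕ) < firstPhase c n (Nat.card G.edgeSet)).card) : ℝ) ≤
        1 / (n : ℝ) ^ (c + 4) * Fintype.card (EdgeOrder G) := by
    refine (orderCount_prefix_large M _ hm _).trans (mul_le_mul_of_nonneg_right ?_ hF)
    have h1 : ((firstPhase c n (Nat.card G.edgeSet) : ℝ) / Nat.card G.edgeSet) ≤ 1 / 2 ^ 22 := by
      rw [div_le_div_iff₀ hm0 (by positivity)]
      have := firstPhase_le c n (Nat.card G.edgeSet)
      have h2 : (2 : ℝ) ^ 22 * firstPhase c n (Nat.card G.edgeSet) ≤ Nat.card G.edgeSet := by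
        exact_mod_cast this
      linarith
    -- 22(⌊|M|/11⌋ + 1) ≥ 2|M|, and one half of this pays for `2 ^ M.card`.
    have h2 : (2 : ℝ) ^ M.card * (1 / 2 ^ 22) ^ (M.card / 11 + 1) ≤ 1 / 2 ^ M.card := by
      rw [one_div, inv_pow, ← pow_mul, ← div_eq_mul_inv, div_le_div_iff₀ (by positivity)
        (by positivity), one_mul, ← pow_add]
      exact pow_le_pow_right₀ (by norm_num) (by omega)
    have h3 : (n : ℝ) ^ (c + 4) ≤ 2 ^ M.card := by
      have h4 : (n : ℝ) ≤ 2 ^ logSize n := by exact_mod_cast (lt_two_pow_logSize n).le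
      calc (n : ℝ) ^ (c + 4) ≤ (2 ^ logSize n) ^ (c + 4) := pow_le_pow_left₀ hn0.le h4 _
        _ = 2 ^ ((c + 4) * logSize n) := by rw [← pow_mul, mul_comm]
        _ ≤ 2 ^ M.card := pow_le_pow_right₀ (by norm_num)
            (hM ▸ le_matchingNumber (by omega) hp)
    calc _ ≤ (2 : ℝ) ^ M.card * (1 / 2 ^ 22) ^ (M.card / 11 + 1) := by gcongr
      _ ≤ 1 / 2 ^ M.card := h2
      _ ≤ _ := one_div_le_one_div_of_le hpow0 h3
  -- The last index, m, stands for the event about the first phase; starting points are below m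
  -- because α > 0.
  have hunion := orderCount_le_sum (m := Nat.card G.edgeSet) (E := G.edgeSet)
    (Finset.range (Nat.card G.edgeSet + 1)) (P := fun σ => ¬ GoodOrder c M σ)
    (fun s σ => if s < Nat.card G.edgeSet then s + α ≤ Nat.card G.edgeSet ∧
      AvoidsLarge (pending (G := G) c s) (late c n) (s + α) σ
      else M.card / 11 + 1 ≤
        (M.filter fun e => (σ.symm e : ℕ) < firstPhase c n (Nat.card G.edgeSet)).card) (by
      intro σ hσ
      by_cases h : (M.filter fun e =>
          (σ.symm e : ℕ) < firstPhase c n (Nat.card G.edgeSet)).card ≤ M.card / 11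
      · have : ∃ s, s + α ≤ Nat.card G.edgeSet ∧
            AvoidsLarge (pending (G := G) c s) (late c n) (s + α) σ := by
          by_contra hcon
          push Not at hcon
          refine hσ ⟨?_, fun _ s hs => hcon s hs⟩
          convert h
        obtain ⟨s, hs, hav⟩ := this
        have hlt : s < Nat.card G.edgeSet := by omega
        exact ⟨s, Finset.mem_range.2 (by omega), by rw [if_pos hlt]; exact ⟨hs, hav⟩⟩
      · exact ⟨Nat.card G.edgeSet, Finset.mem_range.2 (by omega), by
          rw [if_neg (lt_irrefl _)]; omega⟩)
  have hterm : ∀ s ∈ Finset.range (Nat.card G.edgeSet + 1), (orderCount (fun σ : EdgeOrder G =>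
      if s < Nat.card G.edgeSet then s + α ≤ Nat.card G.edgeSet ∧
      AvoidsLarge (pending (G := G) c s) (late c n) (s + α) σ
      else M.card / 11 + 1 ≤
        (M.filter fun e => (σ.symm e : ℕ) < firstPhase c n (Nat.card G.edgeSet)).card) : ℝ) ≤
      1 / (n : ℝ) ^ (c + 4) * Fintype.card (EdgeOrder G) := by
    intro s _
    by_cases hs : s < Nat.card G.edgeSet
    · by_cases hs' : s + α ≤ Nat.card G.edgeSet
      · refine le_trans ?_ (havoid s hs')
        exact_mod_cast orderCount_mono fun σ hσ => by
          rw [if_pos hs] at hσ; exact hσ.2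
      · have h0 : orderCount (fun σ : EdgeOrder G =>
            if s < Nat.card G.edgeSet then s + α ≤ Nat.card G.edgeSet ∧
            AvoidsLarge (pending (G := G) c s) (late c n) (s + α) σ
            else M.card / 11 + 1 ≤ (M.filter fun e =>
              (σ.symm e : ℕ) < firstPhase c n (Nat.card G.edgeSet)).card) = 0 := by
          refine orderCount_eq_zero fun σ h => ?_
          rw [if_pos hs] at h
          exact hs' h.1
        rw [h0]
        simp only [Nat.cast_zero]
        positivity
    · refine le_trans ?_ hprefix
      exact_mod_cast orderCount_mono fun σ hσ => by
        rw [if_neg hs] at hσ; exact hσ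
  have hcount : (Nat.card {σ : EdgeOrder G // ¬ GoodOrder c M σ} : ℝ) =
      orderCount (fun σ : EdgeOrder G => ¬ GoodOrder c M σ) := by
    rw [Nat.card_eq_fintype_card, Fintype.card_subtype, orderCount_eq]
  rw [hcount, Nat.card_eq_fintype_card (α := EdgeOrder G)]
  have hsum : (orderCount (fun σ : EdgeOrder G => ¬ GoodOrder c M σ) : ℝ) ≤
      (Nat.card G.edgeSet + 1) * (1 / (n : ℝ) ^ (c + 4) * Fintype.card (EdgeOrder G)) := by
    refine (Nat.cast_le.2 hunion).trans ?_
    rw [Nat.cast_sum]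
    refine (Finset.sum_le_sum hterm).trans_eq ?_
    rw [Finset.sum_const, Finset.card_range, nsmul_eq_mul, Nat.cast_add, Nat.cast_one]
  refine hsum.trans ?_
  rw [← mul_assoc]
  refine mul_le_mul_of_nonneg_right ?_ hF
  have hmn : (Nat.card G.edgeSet : ℝ) + 1 ≤ (n : ℝ) ^ 4 := by
    have h1 := card_edgeSet_le G
    have h2 : Nat.card G.edgeSet + 1 ≤ n ^ 4 := by
      have h3 : 4 ≤ n * n := Nat.mul_le_mul hn hn
      have h4 : n ^ 4 = (n * n) * (n * n) := by ring
      rw [h4]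
      nlinarith
    exact_mod_cast h2
  rw [mul_one_div, div_le_div_iff₀ hpow0 (by positivity), one_mul, pow_add, mul_comm ((n : ℝ) ^ c)]
  exact mul_le_mul_of_nonneg_right hmn (by positivity)

theorem one_sub_le_orderProb {P Q : EdgeOrder G → Prop} {ε : ℝ}
    (h : (Nat.card {σ : EdgeOrder G // ¬ Q σ} : ℝ) ≤ ε * Nat.card (EdgeOrder G))
    (hQP : ∀ σ, Q σ → P σ) : 1 - ε ≤ orderProb G P := by
  classical
  have hne : Nonempty (EdgeOrder G) := ⟨(Finite.equivFin G.edgeSet).symm⟩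
  have hpos : (0 : ℝ) < Nat.card (EdgeOrder G) := by exact_mod_cast Nat.card_pos
  unfold orderProb
  rw [le_div_iff₀ hpos]
  have h1 : Nat.card {σ : EdgeOrder G // Q σ} ≤ Nat.card {σ : EdgeOrder G // P σ} :=
    Nat.card_le_card_of_injective (fun σ => ⟨σ.1, hQP σ.1 σ.2⟩) fun σ τ h =>
      Subtype.ext (Subtype.mk.inj h)
  have h2 : Nat.card {σ : EdgeOrder G // Q σ} + Nat.card {σ : EdgeOrder G // ¬ Q σ} =
      Nat.card (EdgeOrder G) := by
    rw [Nat.card_eq_fintype_card (α := {σ : EdgeOrder G // Q σ}),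
      Nat.card_eq_fintype_card (α := {σ : EdgeOrder G // ¬ Q σ}),
      Nat.card_eq_fintype_card (α := EdgeOrder G), Fintype.card_subtype, Fintype.card_subtype, Finset.card_filter_add_card_filter_not,
      Finset.card_univ]
  have h1' : (Nat.card {σ : EdgeOrder G // Q σ} : ℝ) ≤ Nat.card {σ : EdgeOrder G // P σ} := by
    exact_mod_cast h1
  have h2' : (Nat.card {σ : EdgeOrder G // Q σ} : ℝ) + Nat.card {σ : EdgeOrder G // ¬ Q σ} =
      Nat.card (EdgeOrder G) := by exact_mod_cast h2
  linarith

end Probability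

/-! ### The memory of the algorithm -/

section Memory

open MatchParam

/-- `inserts` and `ratio` are of order n log² n, and `late` has one more logarithm. -/
theorem cells_le (c : ℕ) : ∃ C, ∀ n, 0 < n → cells c n ≤ C * (n * logSize n ^ 3) := by
  obtain ⟨A, hA⟩ : ∃ A, A = 14 * (1792 * (c + 4)) := ⟨_, rfl⟩
  obtain ⟨D, hD⟩ : ∃ D, D = 2 ^ 22 := ⟨_, rfl⟩
  obtain ⟨B, hB⟩ : ∃ B, B = (A * A + 1) * D := ⟨_, rfl⟩
  refine ⟨A * A + 2 * (c + 4) * B + 3, fun n hn => ?_⟩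
  have hl := logSize_pos n
  set l := logSize n with hldef
  have hl2 : 1 ≤ l ^ 2 := Nat.one_le_pow _ _ hl
  have hl3 : l ^ 2 ≤ l ^ 3 := Nat.pow_le_pow_right hl (by norm_num)
  have hnl : 1 ≤ n * l ^ 2 := Nat.mul_pos hn hl2
  have hnl3 : n * l ^ 2 ≤ n * l ^ 3 := Nat.mul_le_mul_left _ hl3
  have hi : inserts c n = A * A * (n * l ^ 2) := by
    unfold inserts beta unit; rw [← hldef]; rw [hA]; ring
  have hr : ratio c n ≤ B * (n * l ^ 2) := by
    unfold ratio
    rw [hi, hB, ← hD]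
    calc (A * A * (n * l ^ 2) + 1) * D ≤ (A * A * (n * l ^ 2) + n * l ^ 2) * D :=
          Nat.mul_le_mul_right _ (Nat.add_le_add_left hnl _)
      _ = _ := by ring
  have ht : late c n ≤ 2 * (c + 4) * B * (n * l ^ 3) := by
    unfold late
    rw [← hldef]
    calc 2 * (c + 4) * (ratio c n * l) ≤ 2 * (c + 4) * (B * (n * l ^ 2) * l) :=
          Nat.mul_le_mul_left _ (Nat.mul_le_mul_right _ hr)
      _ = _ := by ring
  have hi' : inserts c n ≤ A * A * (n * l ^ 3) := hi ▸ Nat.mul_le_mul_left _ hnl3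
  have hn3 : n ≤ n * l ^ 3 := Nat.le_mul_of_pos_right n (by omega)
  unfold cells cap
  calc inserts c n + late c n + 1 + n + 1 ≤ A * A * (n * l ^ 3) +
        2 * (c + 4) * B * (n * l ^ 3) + 3 * (n * l ^ 3) := by omega
    _ = _ := by ring

theorem logSize_le_log {n : ℕ} (hn : 2 ≤ n) : (logSize n : ℝ) ≤ 4 * Real.log n := by
  have h1 : 1 ≤ Nat.log 2 n := Nat.log_pos (by norm_num) hn
  have h2 : (Nat.log 2 n : ℝ) ≤ Real.logb 2 n := by exact_mod_cast Real.natLog_le_logb n 2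
  have h3 : Real.logb 2 n ≤ 2 * Real.log n := by
    unfold Real.logb
    rw [div_le_iff₀ (Real.log_pos (by norm_num))]
    have h4 := Real.log_two_gt_d9
    have h5 : 0 ≤ Real.log n := Real.log_natCast_nonneg n
    nlinarith
  have h6 : (1 : ℝ) ≤ Nat.log 2 n := by exact_mod_cast h1
  unfold logSize
  push_cast
  linarith

theorem memoryBits_isBigO (c : ℕ) :
    (fun n : ℕ => ((matchAlg c).memoryBits (cells c n) (wordSize c n) : ℝ)) =O[atTop]
      (fun n : ℕ => (n : ℝ) * Real.log n ^ 4) := by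
  obtain ⟨C, hC⟩ := cells_le c
  refine IsBigO.of_bound (17 * (C * (3 * c + 80)) * 4 ^ 4) ?_
  filter_upwards [eventually_ge_atTop 2] with n hn
  have hlog := logSize_le_log hn
  have h5 : 0 ≤ Real.log n := Real.log_natCast_nonneg n
  have h1 : (matchAlg c).memoryBits (cells c n) (wordSize c n) ≤
      17 * (C * (3 * c + 80)) * (n * logSize n ^ 4) := by
    change 17 * (cells c n * wordSize c n) ≤ _
    unfold wordSize
    calc 17 * (cells c n * ((3 * c + 80) * logSize n)) ≤
          17 * (C * (n * logSize n ^ 3) * ((3 * c + 80) * logSize n)) :=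
          Nat.mul_le_mul_left _ (Nat.mul_le_mul_right _ (hC n (by omega)))
      _ = _ := by ring
  have h2 : ((matchAlg c).memoryBits (cells c n) (wordSize c n) : ℝ) ≤
      17 * (C * (3 * c + 80)) * (n * (logSize n : ℝ) ^ 4) := by exact_mod_cast h1
  rw [Real.norm_of_nonneg (by positivity), Real.norm_of_nonneg (by positivity)]
  refine h2.trans ?_
  have h3 : (logSize n : ℝ) ^ 4 ≤ (4 * Real.log n) ^ 4 :=
    pow_le_pow_left₀ (by positivity) hlog 4
  calc 17 * (C * (3 * c + 80)) * (n * (logSize n : ℝ) ^ 4) ≤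
        17 * (C * (3 * c + 80)) * (n * (4 * Real.log n) ^ 4) := by gcongr
    _ = _ := by ring

end Memory

/-! ### The main theorem -/

theorem theorem3 (c : ℕ) :
    ∃ (A : StreamAlg) (S w : ℕ → ℕ) (k : ℕ) (δ : ℕ → ℝ),
      (fun n : ℕ => (A.memoryBits (S n) (w n) : ℝ)) =O[atTop]
        (fun n : ℕ => (n : ℝ) * Real.log n ^ k) ∧
      Tendsto δ atTop (𝓝 0) ∧
      ∀ (n : ℕ) (G : SimpleGraph (Fin n)),
        (∀ σ : EdgeOrder G, ∃ M, A.Returns (S n) (w n) σ M ∧ IsMatching G M) ∧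
        1 - 1 / (n : ℝ) ^ c ≤
          orderProb G fun σ => ∃ M, A.Returns (S n) (w n) σ M ∧ IsMatching G M ∧
            (6 / 11 - δ n) * (matchingNumber G : ℝ) ≤ (M.card : ℝ) := by
  classical
  -- No error term is needed: the losses from θ < β, from R and from the first phase are all
  -- contained in 6/11.
  refine ⟨matchAlg c, MatchParam.cells c, MatchParam.wordSize c, 4, fun _ => 0,
    memoryBits_isBigO c, tendsto_const_nhds, fun n G => ⟨fun σ => ?_, ?_⟩⟩
  · obtain ⟨s, -, M, hret, hM, -⟩ := exists_returns (c := c) σ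
    exact ⟨M, hret, hM⟩
  obtain ⟨M, hM, hcard⟩ := exists_matching_card_eq G
  let M' : Finset G.edgeSet := Finset.univ.filter fun e => (e : Sym2 (Fin n)) ∈ M
  have himage : M'.image Subtype.val = M := by
    ext e
    simp only [M', Finset.mem_image, Finset.mem_filter, Finset.mem_univ, true_and]
    exact ⟨fun ⟨f, hf, hfe⟩ => hfe ▸ hf, fun he => ⟨⟨e, hM.1 e he⟩, he, rfl⟩⟩
  have hcard' : M'.card = matchingNumber G := by
    rw [← hcard, ← himage, Finset.card_image_of_injective _ Subtype.val_injective]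
  refine one_sub_le_orderProb (orderCount_not_good M' hcard') fun σ hσ => ?_
  obtain ⟨N, hret, hN, hsize⟩ := hσ.exists_matching (himage.symm ▸ hM)
  refine ⟨N, hret, hN, ?_⟩
  have : (6 : ℝ) * matchingNumber G ≤ 11 * N.card := by rw [← hcard']; exact_mod_cast hsize
  linarith
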